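/- Let $\tau\in\mathbb C$ with $b:=\operatorname{Im}\tau>0$, let $\Lambda=\mathbb Z+\mathbb Z\tau$, and let $\mathbb T_\tau=\mathbb C/\Lambda$. Let $D_1,\dots,D_M\subset\mathbb C$ be bounded, open, simply connected sets whose closures embed in $\mathbb T_\tau$ and are pairwise disjoint there, each bounded by a $C^2$ Jordan curve. Put $D=\bigcup_j D_j$, $\Omega=\mathbb T_\tau\setminus\overline D$, $\partial\Omega=\bigcup_j\partial D_j$, and let $\nu$ be the unit normal on $\partial\Omega$ pointing into $D$. Let $C(\partial\Omega)$ be the space of real continuous functions on $\partial\Omega$ with the supremum norm and $C_0(\partial\Omega)=\{\phi\in C(\partial\Omega):\int_{\partial\Omega}\phi(\xi)\,|d\xi|=0\}$. Let $$\vartheta_1(z)=-i\sum_{n\in\mathbb Z}(-1)^n e^{\pi i\tau(n+1/2)^2}e^{(2n+1)\pi i z},\qquad G(z)=-\frac1{2\pi}\log|\vartheta_1(z)|+\frac{(\operatorname{Im}z)^2}{2b},$$ and for $\phi\in C(\partial\Omega)$ let $$\mathcal S[\phi](z)=\int_{\partial\Omega}G(z-\xi)\phi(\xi)\,|d\xi|,\qquad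 \mathrm K^*[\phi](z_0)=\mathrm{p.v.}\!\int_{\partial\Omega}\partial_{\nu_z}G(z_0-\xi)\,\phi(\xi)\,|d\xi|\quad(z_0\in\partial\Omega),$$ where $\partial_{\nu_z}G(z_0-\xi)=\nu(z_0)\cdot\nabla G(z_0-\xi)$. 1. For every $\phi\in C_0(\partial\Omega)$, the integral defining $\mathcal S[\phi](z)$ converges absolutely for every $z$, and $\mathcal S[\phi]$ is doubly periodic (with periods $1$ and $\tau$), continuous on $\mathbb T_\tau$, smooth on $\mathbb T_\tau\setminus\partial\Omega$, and satisfies $\Delta\mathcal S[\phi]=0$ there. 2. For every $\phi\in C_0(\partial\Omega)$ and $z_0\in\partial\Omega$, the principal value $\mathrm K^*[\phi](z_0)$ exists, and the jump relations $$\partial_\nu\mathcal S[\phi](z_0^\pm)=\mathrm K^*[\phi](z_0)\pm\tfrac12\phi(z_0)$$ hold. Here $\partial_\nu\mathcal S[\phi](z_0^{+})$ and $\partial_\nu\mathcal S[\phi](z_0^{-})$ denote the limits of $\nu(z_0)\cdot\nabla\mathcal S[\phi](z)$ as $z\to z_0$ from $\Omega$ and from $D$ respectively, both along the normal, $z=z_0\mp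 h\nu(z_0)$ with $h\downarrow0$, and nontangentially, that is, for every $c>0$, within the set of $z$ with $c\,|z-z_0|\le\operatorname{dist}(z,\partial\Omega+\Lambda)$. 3. The restriction of $\mathcal S[\phi]$ to $\partial\Omega$ defines a compact linear operator $\mathrm S\colon C_0(\partial\Omega)\to C(\partial\Omega)$. -/

import Mathlib

open Complex MeasureTheory Filter Topology Set
open scoped ContDiff

noncomputable section

/-- The lattice `ℤ + ℤ τ` in the plane. The flat torus is the quotient `ℂ ⧸ torusLattice τ`. -/
def torusLattice (τ : ℂ) : AddSubgroup ℂ := AddSubgroup.closure {1, τ}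

/-- The Jacobi theta function
`ϑ₁(z) = -i ∑_{n ∈ ℤ} (-1)^n q^{(n+1/2)^2} e^{(2n+1)π i z}`, where `q = e^{π i τ}`. -/
def theta1 (τ z : ℂ) : ℂ :=
  -I * ∑' n : ℤ, (-1 : ℂ) ^ n * cexp (Real.pi * I * τ * ((n : ℂ) + 1 / 2) ^ 2)
    * cexp ((2 * (n : ℂ) + 1) * Real.pi * I * z)

/-- The Green's function of the torus,
`G(z) = -(1/2π) log |ϑ₁(z)| + (Im z)² / (2 Im τ)`, as a function on the plane. -/
def torusGreen (τ z : ℂ) : ℝ :=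
  -(1 / (2 * Real.pi)) * Real.log ‖theta1 τ z‖ + z.im ^ 2 / (2 * τ.im)

/-- A flat torus `ℂ ⧸ (ℤ + ℤ τ)` with `M` holes: open, bounded, simply connected sets in the plane
whose closures are disjoint in the torus, each bounded by a `C²` Jordan curve. The curve comes with
a regular `1`-periodic `C²` parametrization `γ`, oriented so that `-i γ' / |γ'|` is the unit normal
pointing into the hole. -/
structure HoledTorus (τ : ℂ) (M : ℕ) where
  hole : Fin M → Set ℂ
  curve : Fin M → ℝ → ℂ
  isOpen_hole : ∀ j, IsOpen (hole j)
  isBounded_hole : ∀ j, Bornology.IsBounded (hole j)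
  isSimplyConnected_hole : ∀ j, IsSimplyConnected (hole j)
  /-- The quotient map onto the torus is injective on the disjoint union of the closures. -/
  disjoint_closures : ∀ i j, ∀ z ∈ closure (hole i), ∀ w ∈ closure (hole j),
    z - w ∈ torusLattice τ → i = j ∧ z = w
  contDiff_curve : ∀ j, ContDiff ℝ 2 (curve j)
  periodic_curve : ∀ j, Function.Periodic (curve j) 1
  injOn_curve : ∀ j, InjOn (curve j) (Ico 0 1)
  deriv_curve_ne_zero : ∀ j t, deriv (curve j) t ≠ 0
  range_curve : ∀ j, range (curve j) = frontier (hole j)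
  normal_inward : ∀ j t, ∀ᶠ h : ℝ in 𝓝[>] 0,
    curve j t + h * (-I * deriv (curve j) t / ‖deriv (curve j) t‖) ∈ hole j ∧
    curve j t - h * (-I * deriv (curve j) t / ‖deriv (curve j) t‖) ∉ closure (hole j)

namespace HoledTorus

variable {τ : ℂ} {M : ℕ} (Ω : HoledTorus τ M)

/-- The boundary `∂Ω = ⋃ⱼ ∂Dⱼ`, with the holes regarded as subsets of the plane. -/
def boundary : Set ℂ := ⋃ j, frontier (Ω.hole j)

/-- The preimage in the plane of the domain `Ω`, the complement in the torus of `closure D`. -/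
def outerRegion : Set ℂ := {z | ∀ j, ∀ l ∈ torusLattice τ, z - l ∉ closure (Ω.hole j)}

/-- The preimage in the plane of `D = ⋃ⱼ Dⱼ`, regarded as a subset of the torus. -/
def innerRegion : Set ℂ := {z | ∃ j, ∃ l ∈ torusLattice τ, z - l ∈ Ω.hole j}

/-- The preimage in the plane of `∂Ω`, regarded as a subset of the torus. -/
def periodicBoundary : Set ℂ := {z | ∃ l ∈ torusLattice τ, z - l ∈ Ω.boundary}

lemma curve_mem_boundary (j : Fin M) (t : ℝ) : Ω.curve j t ∈ Ω.boundary :=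
  mem_iUnion.2 ⟨j, Ω.range_curve j ▸ mem_range_self t⟩

/-- The point `γⱼ(t)` of `∂Ω`. -/
def pt (j : Fin M) (t : ℝ) : Ω.boundary := ⟨Ω.curve j t, Ω.curve_mem_boundary j t⟩

/-- The unit normal at `γⱼ(t)` pointing into the hole `Dⱼ`. -/
def normal (j : Fin M) (t : ℝ) : ℂ := -I * deriv (Ω.curve j) t / ‖deriv (Ω.curve j) t‖

lemma continuous_pt (j : Fin M) : Continuous (Ω.pt j) :=
  (Ω.contDiff_curve j).continuous.subtype_mk _

lemma continuous_norm_deriv (j : Fin M) : Continuous fun t => ‖deriv (Ω.curve j) t‖ :=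
  ((Ω.contDiff_curve j).continuous_deriv (by norm_num)).norm

lemma isCompact_boundary : IsCompact Ω.boundary :=
  isCompact_iUnion fun j =>
    Metric.isCompact_of_isClosed_isBounded isClosed_frontier
      ((Ω.isBounded_hole j).closure.subset frontier_subset_closure)

instance : CompactSpace Ω.boundary := isCompact_iff_compactSpace.1 Ω.isCompact_boundary

/-- The integral `∫_{∂Ω} f(ξ) |dξ|` with respect to arc length. -/
def arcIntegral (f : Ω.boundary → ℝ) : ℝ :=
  ∑ j, ∫ t in (0 : ℝ)..1, f (Ω.pt j t) * ‖deriv (Ω.curve j) t‖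

/-- Integrability with respect to arc length on `∂Ω`. -/
def ArcIntegrable (f : Ω.boundary → ℝ) : Prop :=
  ∀ j, IntervalIntegrable (fun t => f (Ω.pt j t) * ‖deriv (Ω.curve j) t‖) volume 0 1

lemma arcIntegrable_of_continuous (φ : C(Ω.boundary, ℝ)) : Ω.ArcIntegrable φ := fun j =>
  ((φ.continuous.comp (Ω.continuous_pt j)).mul (Ω.continuous_norm_deriv j)).intervalIntegrable _ _

/-- The space `C₀(∂Ω)` of continuous functions on `∂Ω` whose integral vanishes. -/
def C0 : Submodule ℝ C(Ω.boundary, ℝ) where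
  carrier := {φ | Ω.arcIntegral φ = 0}
  zero_mem' := by simp [arcIntegral]
  add_mem' := by
    intro φ ψ hφ hψ
    have h : Ω.arcIntegral (φ + ψ : C(Ω.boundary, ℝ)) = Ω.arcIntegral φ + Ω.arcIntegral ψ := by
      simp only [arcIntegral]
      rw [← Finset.sum_add_distrib]
      refine Finset.sum_congr rfl fun j _ => ?_
      rw [← intervalIntegral.integral_add (Ω.arcIntegrable_of_continuous φ j)
        (Ω.arcIntegrable_of_continuous ψ j)]
      simp only [ContinuousMap.add_apply, add_mul]
    exact h.trans (by rw [show Ω.arcIntegral φ = 0 from hφ, show Ω.arcIntegral ψ = 0 from hψ,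
      add_zero])
  smul_mem' := by
    intro c φ hφ
    have h : Ω.arcIntegral (c • φ : C(Ω.boundary, ℝ)) = c * Ω.arcIntegral φ := by
      simp only [arcIntegral, ContinuousMap.smul_apply, smul_eq_mul, mul_assoc,
        intervalIntegral.integral_const_mul, Finset.mul_sum]
    exact h.trans (by rw [show Ω.arcIntegral φ = 0 from hφ, mul_zero])

/-- The single-layer potential `S[φ](z) = ∫_{∂Ω} G(z - ξ) φ(ξ) |dξ|`, as a function on the plane. -/
def singleLayer (φ : C(Ω.boundary, ℝ)) (z : ℂ) : ℝ :=
  Ω.arcIntegral fun ξ => torusGreen τ (z - ξ) * φ ξ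

/-- The integral of the kernel `∂_{ν_z} G(z₀ - ξ)` of `K*`, at `z₀ = γᵢ(s)`, against `φ` over the
part of `∂Ω` at distance more than `ε` from `z₀`. -/
def adjointDoubleLayerTrunc (φ : C(Ω.boundary, ℝ)) (i : Fin M) (s ε : ℝ) : ℝ :=
  Ω.arcIntegral ({ξ : Ω.boundary | ε < ‖Ω.curve i s - ξ‖}.indicator fun ξ =>
    fderiv ℝ (torusGreen τ) (Ω.curve i s - ξ) (Ω.normal i s) * φ ξ)

/-- `K*[φ](z₀)` at `z₀ = γᵢ(s)`, as a Cauchy principal value. -/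
def adjointDoubleLayer (φ : C(Ω.boundary, ℝ)) (i : Fin M) (s : ℝ) : ℝ :=
  limUnder (𝓝[>] (0 : ℝ)) (Ω.adjointDoubleLayerTrunc φ i s)

/-- The part of a region `A` that lies in the nontangential approach region
`{z | c |z - z₀| ≤ dist(z, ∂Ω)}` with vertex `z₀ = γᵢ(s)`. -/
def approachRegion (A : Set ℂ) (i : Fin M) (s c : ℝ) : Set ℂ :=
  {z ∈ A | c * ‖z - Ω.curve i s‖ ≤ Metric.infDist z Ω.periodicBoundary}

end HoledTorus

end

/-! ### The lattice -/

/-! Everything rests on the splitting G(z) = -(1/2π) log|z| + R(z), with R smooth away from the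
nonzero lattice points (`exists_torusGreen_eq`). It amounts to ϑ₁ vanishing only on the lattice,
with a simple zero at 0. The zeros are read off from the Jacobi product: ϑ₁ and the product have the
same multipliers under lattice translations, so their quotient is doubly periodic. Its modulus
attains a maximum on a compact cell, and the maximum principle makes it constant
(`exists_theta1_eq_thetaProd`). The same multipliers show that the quadratic term of G restores
double periodicity (`torusGreen_add_of_mem`). Since the closed holes embed disjointly, a difference
of two boundary points is never a nonzero lattice point. So near ∂Ω the potential is a logarithmic
one plus a regular one, and near the other translates periodicity applies.

Continuity and compactness come from the L¹ distance of the kernels with poles z and w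
(`kernelDist`). It tends to 0 as z tends to w on ∂Ω, because log|z - ξ| is Hölder-1/2 in z in L¹
along a curve satisfying a chord-arc inequality (`exists_chord_arc`,
`exists_integral_abs_log_sub_le`). This bounds the oscillation of S[φ] by ‖φ‖ times a modulus
independent of φ, and Arzelà–Ascoli gives a compact operator.

Off the boundary, the log|ϑ₁| part is locally the real part of an analytic function, namely of a
primitive of ∫ ϑ₁'/ϑ₁. The quadratic part contributes (Im z)² ∫ φ plus an affine function of Im z.
The mean of φ is zero, so S[φ] is locally the real part of an analytic function
(`exists_singleLayer_eq_re`), hence smooth and harmonic.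

For the jump, the curve is moved so that it passes through 0 with velocity 1. The normal derivative
of log|z - ξ| becomes Im 1/(ζ - γ(u)) up to a factor, and γ(u) = u + O(u²) because the curve is C².
In a sector |ζ - γ(u)| and |ζ - u| are both at least a constant times |u|, so replacing γ(u) by u
changes the kernel by a bounded amount, and dominated convergence applies to the difference. For the
line itself, Im 1/(ζ - u) is -π times the Poisson kernel, whose limit is ∓π times the density; the
factor -1/(2π) turns this into ±φ/2 (`tendsto_integral_im_inv`). The same bound at ζ = 0 shows that
the kernel of K* is absolutely integrable, so the principal value is an ordinary integral. Finally a
connectedness argument identifies nontangential approach from Ω or D with approach in the left or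
right sector (`eventually_mem_of_sector`). -/

lemma mem_torusLattice {τ z : ℂ} : z ∈ torusLattice τ ↔ ∃ m n : ℤ, (m : ℂ) + n * τ = z := by
  simp [torusLattice, AddSubgroup.mem_closure_pair]

lemma countable_torusLattice (τ : ℂ) : (torusLattice τ : Set ℂ).Countable := by
  have : (torusLattice τ : Set ℂ) = range fun p : ℤ × ℤ => (p.1 : ℂ) + p.2 * τ := by
    ext z
    simp [mem_torusLattice]
  rw [this]
  exact countable_range _

lemma one_mem_torusLattice (τ : ℂ) : (1 : ℂ) ∈ torusLattice τ :=
  AddSubgroup.subset_closure (by simp)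

lemma tau_mem_torusLattice (τ : ℂ) : τ ∈ torusLattice τ :=
  AddSubgroup.subset_closure (by simp)

/-- If the coefficient of τ is nonzero, the imaginary part is at least Im τ in size; otherwise the
point is a nonzero integer. This uniform separation makes every subset of the lattice closed. -/
lemma min_one_im_le_norm_of_mem_torusLattice {τ z : ℂ} (hz : z ∈ torusLattice τ)
    (h0 : z ≠ 0) : min 1 τ.im ≤ ‖z‖ := by
  obtain ⟨m, n, rfl⟩ := mem_torusLattice.1 hz
  rcases eq_or_ne n 0 with rfl | hn
  · refine (min_le_left _ _).trans ?_
    have hm : m ≠ 0 := by rintro rfl; simp at h0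
    have : (1 : ℝ) ≤ |(m : ℝ)| := by exact_mod_cast Int.one_le_abs hm
    simpa using this
  · have h1 : (1 : ℝ) ≤ |(n : ℝ)| := by exact_mod_cast Int.one_le_abs hn
    have h2 := Complex.abs_im_le_norm ((m : ℂ) + n * τ)
    simp only [add_im, intCast_im, zero_add, mul_im, intCast_re, zero_mul, add_zero] at h2
    rw [abs_mul] at h2
    refine (min_le_right _ _).trans (le_trans ?_ h2)
    nlinarith [le_abs_self τ.im, abs_nonneg τ.im]

lemma isClosed_of_subset_torusLattice {τ : ℂ} (hτ : 0 < τ.im) {s : Set ℂ}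
    (hs : s ⊆ torusLattice τ) : IsClosed s := by
  refine Metric.isClosed_of_pairwise_le_dist (lt_min one_pos hτ) fun x hx y hy hxy => ?_
  change _ ≤ dist x y
  rw [dist_eq_norm]
  exact min_one_im_le_norm_of_mem_torusLattice (sub_mem (hs hx) (hs hy)) (sub_ne_zero.2 hxy)

/-- The plane without the nonzero lattice points. -/
def latticeCompl (τ : ℂ) : Set ℂ := ((torusLattice τ : Set ℂ) \ {0})ᶜ

lemma isOpen_latticeCompl {τ : ℂ} (hτ : 0 < τ.im) : IsOpen (latticeCompl τ) :=
  (isClosed_of_subset_torusLattice hτ sdiff_subset).isOpen_compl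

lemma mem_latticeCompl {τ z : ℂ} : z ∈ latticeCompl τ ↔ (z ∈ torusLattice τ → z = 0) := by
  simp only [latticeCompl, mem_compl_iff, Set.mem_sdiff, SetLike.mem_coe, mem_singleton_iff]
  tauto

lemma mem_latticeCompl_of_notMem {τ z : ℂ} (hz : z ∉ torusLattice τ) : z ∈ latticeCompl τ :=
  mem_latticeCompl.2 fun h => absurd h hz

/-- A countable set does not disconnect a real vector space of dimension greater than one.
Connectedness is what the maximum principle for ϑ₁ divided by its product needs. -/
lemma isPreconnected_latticeCompl (τ : ℂ) : IsPreconnected (latticeCompl τ) :=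
  ((countable_torusLattice τ).mono sdiff_subset).isPathConnected_compl_of_one_lt_rank
    (by rw [Complex.rank_real_complex]; norm_num) |>.isConnected.isPreconnected

/-- The fundamental parallelogram centred at the origin. -/
def centredCell (τ : ℂ) : Set ℂ :=
  (fun p : ℝ × ℝ => (p.1 : ℂ) + p.2 * τ) '' (Icc (-(1 / 2)) (1 / 2) ×ˢ Icc (-(1 / 2)) (1 / 2))

lemma isCompact_centredCell (τ : ℂ) : IsCompact (centredCell τ) :=
  (isCompact_Icc.prod isCompact_Icc).image (by fun_prop)

lemma zero_mem_centredCell (τ : ℂ) : (0 : ℂ) ∈ centredCell τ :=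
  ⟨(0, 0), by constructor <;> constructor <;> norm_num, by simp⟩

lemma exists_add_mem_centredCell {τ : ℂ} (hτ : 0 < τ.im) (z : ℂ) :
    ∃ l ∈ torusLattice τ, z + l ∈ centredCell τ := by
  set y : ℝ := z.im / τ.im with hy
  set x : ℝ := z.re - y * τ.re with hx
  have hz : z = x + y * τ := by
    apply Complex.ext
    · simp [hx]
    · simp [hy]; field_simp
  refine ⟨((-round x : ℤ) : ℂ) + ((-round y : ℤ) : ℂ) * τ, mem_torusLattice.2 ⟨_, _, rfl⟩,
    (x - round x, y - round y), ?_, ?_⟩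
  · exact ⟨abs_le.1 (abs_sub_round x), abs_le.1 (abs_sub_round y)⟩
  · rw [hz]; push_cast; ring

lemma centredCell_subset_latticeCompl {τ : ℂ} (hτ : 0 < τ.im) :
    centredCell τ ⊆ latticeCompl τ := by
  rintro _ ⟨⟨x, y⟩, ⟨⟨hx1, hx2⟩, ⟨hy1, hy2⟩⟩, rfl⟩
  refine mem_latticeCompl.2 fun h => ?_
  obtain ⟨m, n, hmn⟩ := mem_torusLattice.1 h
  simp only at hx1 hx2 hy1 hy2 hmn
  have him := congrArg Complex.im hmn
  have hre := congrArg Complex.re hmn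
  simp at him hre
  have hn : (n : ℝ) = y := by
    rcases him with h | h
    · exact h
    · exact absurd h hτ.ne'
  have hn0 : n = 0 := by
    have h1 : (n : ℝ) < 1 := by linarith
    have h2 : (-1 : ℝ) < n := by linarith
    have h1' : n < 1 := by exact_mod_cast h1
    have h2' : -1 < n := by exact_mod_cast h2
    omega
  have hm : (m : ℝ) = x := by
    rw [← hn] at hre
    linarith
  have hm0 : m = 0 := by
    have h1 : (m : ℝ) < 1 := by linarith
    have h2 : (-1 : ℝ) < m := by linarith
    have h1' : m < 1 := by exact_mod_cast h1
    have h2' : -1 < m := by exact_mod_cast h2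
    omega
  simp [← hn, ← hm, hn0, hm0]

/-! ### The theta function and its product expansion -/

/-- The sign (-1)ⁿ is e^{πin} and the square is expanded, so ϑ₁ is the standard theta function
shifted by the half period (1 + τ)/2, up to an exponential factor. -/
lemma theta1_eq_jacobiTheta₂ (τ z : ℂ) : theta1 τ z =
    -I * cexp (Real.pi * I * τ / 4 + Real.pi * I * z) * jacobiTheta₂ (z + (1 + τ) / 2) τ := by
  rw [theta1, jacobiTheta₂, mul_assoc (-I)]
  congr 1
  rw [← tsum_mul_left]
  refine tsum_congr fun n => ?_
  have h : (-1 : ℂ) ^ n = cexp (n * (Real.pi * I)) := by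
    rw [Complex.exp_int_mul, Complex.exp_pi_mul_I]
  rw [jacobiTheta₂_term, h, ← Complex.exp_add, ← Complex.exp_add, ← Complex.exp_add]
  congr 1
  ring

lemma differentiable_theta1 {τ : ℂ} (hτ : 0 < τ.im) : Differentiable ℂ (theta1 τ) := by
  have h : theta1 τ = fun z => -I * cexp (Real.pi * I * τ / 4 + Real.pi * I * z) *
      jacobiTheta₂ (z + (1 + τ) / 2) τ := funext (theta1_eq_jacobiTheta₂ τ)
  rw [h]
  have h2 : Differentiable ℂ fun z => jacobiTheta₂ z τ :=
    fun z => differentiableAt_jacobiTheta₂_fst z hτ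
  have h3 : Differentiable ℂ fun z : ℂ => jacobiTheta₂ (z + (1 + τ) / 2) τ :=
    h2.comp (by fun_prop : Differentiable ℂ fun z : ℂ => z + (1 + τ) / 2)
  fun_prop

lemma theta1_add_one (τ z : ℂ) : theta1 τ (z + 1) = -1 * theta1 τ z := by
  rw [theta1_eq_jacobiTheta₂, theta1_eq_jacobiTheta₂,
    show z + 1 + (1 + τ) / 2 = z + (1 + τ) / 2 + 1 by ring, jacobiTheta₂_add_left,
    show (Real.pi : ℂ) * I * τ / 4 + Real.pi * I * (z + 1) =
      Real.pi * I * τ / 4 + Real.pi * I * z + Real.pi * I by ring, Complex.exp_add _ (Real.pi * I),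
    Complex.exp_pi_mul_I]
  ring

lemma theta1_add_tau (τ z : ℂ) : theta1 τ (z + τ) =
    -cexp (-Real.pi * I * τ - 2 * Real.pi * I * z) * theta1 τ z := by
  rw [theta1_eq_jacobiTheta₂, theta1_eq_jacobiTheta₂,
    show z + τ + (1 + τ) / 2 = z + (1 + τ) / 2 + τ by ring, jacobiTheta₂_add_left']
  have h : cexp (Real.pi * I * τ / 4 + Real.pi * I * (z + τ)) *
      cexp (-Real.pi * I * (τ + 2 * (z + (1 + τ) / 2))) =
      -cexp (-Real.pi * I * τ - 2 * Real.pi * I * z) *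
        cexp (Real.pi * I * τ / 4 + Real.pi * I * z) := by
    rw [neg_mul (cexp _), ← Complex.exp_add, ← Complex.exp_add, ← Complex.exp_add_pi_mul_I,
      Complex.exp_eq_exp_iff_exists_int]
    exact ⟨-1, by push_cast; ring⟩
  linear_combination (-I * jacobiTheta₂ (z + (1 + τ) / 2) τ) * h

/-- The two half periods ±(1 + τ)/2 differ by 1 + τ. Evenness and the two quasi-periodicities then
force the theta value there to equal its own negative. -/
lemma theta1_zero (τ : ℂ) : theta1 τ 0 = 0 := by
  have h1 := jacobiTheta₂_add_left' (-((1 + τ) / 2)) τ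
  have h2 := jacobiTheta₂_add_left (-((1 + τ) / 2) + τ) τ
  rw [show -((1 + τ) / 2) + τ + 1 = (1 + τ) / 2 by ring, h1, jacobiTheta₂_neg_left,
    show -Real.pi * I * (τ + 2 * -((1 + τ) / 2)) = Real.pi * I by ring,
    Complex.exp_pi_mul_I] at h2
  have h3 : jacobiTheta₂ ((1 + τ) / 2) τ = 0 := by linear_combination h2 / 2
  rw [theta1_eq_jacobiTheta₂, zero_add, h3, mul_zero]

lemma integral_cexp_two_pi_int_mul {n : ℤ} (hn : n ≠ 0) :
    ∫ x in (0 : ℝ)..1, cexp (2 * Real.pi * I * n * x) = 0 := by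
  have hc : (2 * Real.pi * I * n : ℂ) ≠ 0 := by
    simp [Real.pi_ne_zero, hn]
  rw [integral_exp_mul_complex hc]
  have : cexp (2 * Real.pi * I * n) = 1 := Complex.exp_eq_one_iff.2 ⟨n, by ring⟩
  simp [this]

/-- This is the zeroth Fourier coefficient; all that is needed from it is that theta is not
identically zero. -/
lemma integral_jacobiTheta₂ {τ : ℂ} (hτ : 0 < τ.im) :
    ∫ x in (0 : ℝ)..1, jacobiTheta₂ x τ = 1 := by
  have hterm : ∀ n : ℤ, Continuous fun x : ℝ => jacobiTheta₂_term n x τ := fun n => by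
    unfold jacobiTheta₂_term
    fun_prop
  have hnorm : ∀ (n : ℤ) (x : ℝ), ‖jacobiTheta₂_term n x τ‖ = ‖jacobiTheta₂_term n 0 τ‖ := by
    intro n x
    rw [norm_jacobiTheta₂_term, norm_jacobiTheta₂_term]
    simp
  have hs : HasSum (fun n : ℤ => ∫ x in (0 : ℝ)..1, jacobiTheta₂_term n x τ)
      (∫ x in (0 : ℝ)..1, jacobiTheta₂ x τ) := by
    refine intervalIntegral.hasSum_integral_of_dominated_convergence
      (fun n _ => ‖jacobiTheta₂_term n 0 τ‖) (fun n => (hterm n).aestronglyMeasurable) ?_ ?_ ?_ ?_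
    · exact fun n => .of_forall fun x _ => (hnorm n x).le
    · exact .of_forall fun x _ => ((summable_jacobiTheta₂_term_iff 0 τ).2 hτ).norm
    · exact intervalIntegrable_const
    · exact .of_forall fun x _ => hasSum_jacobiTheta₂_term _ hτ
  refine hs.unique ?_
  convert hasSum_single (0 : ℤ) ?_ using 1
  · simp [jacobiTheta₂_term]
  · intro n hn
    unfold jacobiTheta₂_term
    simp only [Complex.exp_add, intervalIntegral.integral_mul_const,
      integral_cexp_two_pi_int_mul hn, zero_mul]

lemma exists_theta1_ne_zero {τ : ℂ} (hτ : 0 < τ.im) : ∃ z, theta1 τ z ≠ 0 := by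
  by_contra! h
  have h2 : ∀ z, jacobiTheta₂ z τ = 0 := fun z => by
    have := h (z - (1 + τ) / 2)
    rw [theta1_eq_jacobiTheta₂, sub_add_cancel] at this
    simpa [Complex.exp_ne_zero] using this
  have := integral_jacobiTheta₂ hτ
  simp [h2] at this

/-! ### The Jacobi product and its comparison with the theta function -/

/-- The product `∏ (1 - qⁿ u)` over `n ≥ 0`. -/
noncomputable def qProd (q u : ℂ) : ℂ := ∏' n : ℕ, (1 + -(q ^ n * u))

lemma differentiable_qProd {q : ℂ} (hq : ‖q‖ < 1) : Differentiable ℂ (qProd q) := by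
  intro u₀
  have hsum : Summable fun n : ℕ => ‖q‖ ^ n * (‖u₀‖ + 1) :=
    (summable_geometric_of_lt_one (norm_nonneg _) hq).mul_right _
  have hp := hsum.hasProdLocallyUniformlyOn_nat_one_add (f := fun n u => -(q ^ n * u))
    (Metric.isOpen_ball (x := u₀) (ε := 1)) (.of_forall fun n u hu => by
      rw [norm_neg, norm_mul, norm_pow]
      gcongr
      have := norm_le_norm_add_norm_sub' u u₀
      rw [mem_ball_iff_norm] at hu
      linarith) (fun n => by fun_prop)
  have hd := hp.differentiableOn (.of_forall fun s => by
    simpa [Finset.prod_fn] using DifferentiableOn.finsetProd (fun _ _ => by fun_prop))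
    Metric.isOpen_ball
  exact hd.differentiableAt (Metric.ball_mem_nhds _ one_pos)

lemma summable_norm_qProd {q : ℂ} (hq : ‖q‖ < 1) (u : ℂ) :
    Summable fun n : ℕ => ‖-(q ^ n * u)‖ := by
  simp only [norm_neg, norm_mul, norm_pow]
  exact (summable_geometric_of_lt_one (norm_nonneg _) hq).mul_right _

lemma qProd_eq {q : ℂ} (hq : ‖q‖ < 1) (u : ℂ) : qProd q u = (1 - u) * qProd q (q * u) := by
  have hm : ∀ v, Multipliable fun n : ℕ => 1 + -(q ^ n * v) := fun v =>
    multipliable_one_add_of_summable (summable_norm_qProd hq v)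
  have h2 : (fun n : ℕ => 1 + -(q ^ (n + 1) * u)) = fun n : ℕ => 1 + -(q ^ n * (q * u)) := by
    funext n
    ring
  rw [qProd, tprod_eq_zero_mul' (by rw [h2]; exact hm _), h2, qProd]
  simp [sub_eq_add_neg]

lemma qProd_ne_zero {q : ℂ} (hq : ‖q‖ < 1) {u : ℂ} (hu : ∀ n : ℕ, q ^ n * u ≠ 1) :
    qProd q u ≠ 0 :=
  tprod_one_add_ne_zero_of_summable
    (fun n h => hu n (by linear_combination -h)) (summable_norm_qProd hq u)

/-- The nome `e^{2π i τ}`. -/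
noncomputable def nome (τ : ℂ) : ℂ := cexp (2 * Real.pi * I * τ)

lemma norm_nome_lt_one {τ : ℂ} (hτ : 0 < τ.im) : ‖nome τ‖ < 1 := by
  rw [nome, Complex.norm_exp]
  simp
  positivity

/-- The product of the theta function's factors that do not vanish away from the nonzero lattice
points. -/
noncomputable def thetaUnit (τ z : ℂ) : ℂ :=
  cexp (-(Real.pi * I * z)) * (qProd (nome τ) (nome τ * nome z) * qProd (nome τ) (nome τ * nome (-z)))

/-- The product expansion of the theta function, up to a constant. -/
noncomputable def thetaProd (τ z : ℂ) : ℂ := (1 - nome z) * thetaUnit τ z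

lemma nome_add (z w : ℂ) : nome (z + w) = nome z * nome w := by
  rw [nome, nome, nome, ← Complex.exp_add]
  ring_nf

lemma nome_ne_zero (z : ℂ) : nome z ≠ 0 := Complex.exp_ne_zero _

lemma nome_one : nome 1 = 1 := by simp [nome, Complex.exp_two_pi_mul_I]

lemma nome_zero : nome 0 = 1 := by simp [nome]

lemma nome_neg_mul (z : ℂ) : nome (-z) * nome z = 1 := by
  rw [← nome_add, neg_add_cancel, nome_zero]

lemma nome_nsmul (n : ℕ) (z : ℂ) : nome (n * z) = nome z ^ n := by
  rw [nome, nome, ← Complex.exp_nat_mul]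
  ring_nf

lemma nome_eq_one {z : ℂ} : nome z = 1 ↔ ∃ n : ℤ, z = n := by
  rw [nome, Complex.exp_eq_one_iff]
  have : (2 * Real.pi * I : ℂ) ≠ 0 := Complex.two_pi_I_ne_zero
  refine exists_congr fun n => ⟨fun h => ?_, fun h => by rw [h]; ring⟩
  exact mul_left_cancel₀ this (by rw [h]; ring)

lemma differentiable_nome : Differentiable ℂ nome := by
  unfold nome
  fun_prop

lemma differentiable_thetaUnit {τ : ℂ} (hτ : 0 < τ.im) : Differentiable ℂ (thetaUnit τ) := by
  have h := differentiable_qProd (norm_nome_lt_one hτ)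
  have h1 : Differentiable ℂ fun z => nome τ * nome z := differentiable_nome.const_mul _
  have h2 : Differentiable ℂ fun z => nome τ * nome (-z) :=
    (differentiable_nome.comp differentiable_neg).const_mul _
  have h3 : Differentiable ℂ fun z => qProd (nome τ) (nome τ * nome z) := h.comp h1
  have h4 : Differentiable ℂ fun z => qProd (nome τ) (nome τ * nome (-z)) := h.comp h2
  unfold thetaUnit
  fun_prop

lemma differentiable_thetaProd {τ : ℂ} (hτ : 0 < τ.im) : Differentiable ℂ (thetaProd τ) := by
  have h1 := differentiable_thetaUnit hτ
  have h2 := differentiable_nome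
  unfold thetaProd
  fun_prop

/-- A vanishing factor means that ±z + (n + 1)τ is an integer for some n ≥ 0, so z is a lattice
point, hence 0 by assumption; but (n + 1)τ is not real. -/
lemma thetaUnit_ne_zero {τ : ℂ} (hτ : 0 < τ.im) {z : ℂ} (hz : z ∈ latticeCompl τ) :
    thetaUnit τ z ≠ 0 := by
  have key : ∀ w : ℂ, (w ∈ torusLattice τ → w = 0) → qProd (nome τ) (nome τ * nome w) ≠ 0 := by
    intro w hw
    refine qProd_ne_zero (norm_nome_lt_one hτ) fun n hn => ?_
    rw [← nome_nsmul, ← nome_add, ← nome_add] at hn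
    obtain ⟨m, hm⟩ := nome_eq_one.1 hn
    have hw' : w = m + (-(n + 1 : ℕ) : ℤ) * τ := by
      push_cast
      linear_combination hm
    have h0 := hw (mem_torusLattice.2 ⟨m, _, hw'.symm⟩)
    rw [h0, add_zero] at hm
    have him := congrArg Complex.im hm
    simp at him
    have : (0 : ℝ) < n * τ.im + τ.im := by positivity
    linarith
  rw [mem_latticeCompl] at hz
  refine mul_ne_zero (Complex.exp_ne_zero _) (mul_ne_zero (key z hz) (key (-z) fun h => ?_))
  rw [hz (by simpa using neg_mem h), neg_zero]

lemma thetaProd_ne_zero {τ : ℂ} (hτ : 0 < τ.im) {z : ℂ} (hz : z ∉ torusLattice τ) :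
    thetaProd τ z ≠ 0 := by
  refine mul_ne_zero (fun h => ?_) (thetaUnit_ne_zero hτ (mem_latticeCompl_of_notMem hz))
  obtain ⟨n, hn⟩ := nome_eq_one.1 (sub_eq_zero.1 h).symm
  exact hz (mem_torusLattice.2 ⟨n, 0, by simp [hn]⟩)

lemma thetaProd_zero (τ : ℂ) : thetaProd τ 0 = 0 := by simp [thetaProd, nome_zero]

lemma deriv_thetaProd_zero {τ : ℂ} (hτ : 0 < τ.im) : deriv (thetaProd τ) 0 ≠ 0 := by
  have h1 : HasDerivAt nome (2 * Real.pi * I) 0 := by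
    have : HasDerivAt (fun z : ℂ => 2 * Real.pi * I * z) (2 * Real.pi * I) 0 := by
      simpa using (hasDerivAt_id (0 : ℂ)).const_mul (2 * Real.pi * I)
    have h := this.cexp
    rw [mul_zero, Complex.exp_zero, one_mul] at h
    exact h
  have h2 := (h1.const_sub 1).mul (differentiable_thetaUnit hτ 0).hasDerivAt
  have h3 : deriv (thetaProd τ) 0 = -(2 * Real.pi * I) * thetaUnit τ 0 := by
    refine (HasDerivAt.deriv h2).trans ?_
    simp [nome_zero]
  rw [h3]
  exact mul_ne_zero (neg_ne_zero.2 Complex.two_pi_I_ne_zero)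
    (thetaUnit_ne_zero hτ (mem_latticeCompl.2 fun _ => rfl))

lemma thetaProd_add_one (τ z : ℂ) : thetaProd τ (z + 1) = -1 * thetaProd τ z := by
  have h : nome (-(z + 1)) = nome (-z) := by
    have h1 := nome_add (-(z + 1)) 1
    rw [nome_one, mul_one] at h1
    rw [← h1]
    congr 1
    ring
  rw [thetaProd, thetaProd, thetaUnit, thetaUnit, nome_add, nome_one, mul_one, h,
    show -(Real.pi * I * (z + 1)) = -(Real.pi * I * z) + -(Real.pi * I) by ring, Complex.exp_add,
    Complex.exp_neg (Real.pi * I), Complex.exp_pi_mul_I]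
  ring

/-- Translation by τ multiplies u = e^{2πiz} by q, so one product loses its first factor and the
other gains one. These boundary factors combine with the exponential prefactor into the multiplier
of ϑ₁. -/
lemma thetaProd_add_tau {τ : ℂ} (hτ : 0 < τ.im) (z : ℂ) : thetaProd τ (z + τ) =
    -cexp (-Real.pi * I * τ - 2 * Real.pi * I * z) * thetaProd τ z := by
  have hq := norm_nome_lt_one hτ
  have h1 : nome τ * nome (-(z + τ)) = nome (-z) := by
    rw [← nome_add]
    congr 1
    ring
  have h2 := qProd_eq hq (nome (z + τ))
  have h3 := qProd_eq hq (nome (-z))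
  have h4 : cexp (-(Real.pi * I * (z + τ))) * nome z =
      cexp (-Real.pi * I * τ - 2 * Real.pi * I * z) * (cexp (-(Real.pi * I * z)) * nome z * nome z)
      := by
    rw [nome, ← Complex.exp_add, ← Complex.exp_add, ← Complex.exp_add, ← Complex.exp_add]
    congr 1
    ring
  have h6 : cexp (-(Real.pi * I * (z + τ))) =
      cexp (-Real.pi * I * τ - 2 * Real.pi * I * z) * (cexp (-(Real.pi * I * z)) * nome z) :=
    mul_right_cancel₀ (nome_ne_zero z) (h4.trans (by ring))
  have h5 := nome_neg_mul z
  have h7 : nome (z + τ) = nome τ * nome z := by rw [nome_add, mul_comm]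
  have h8 : (1 - nome (z + τ)) * qProd (nome τ) (nome τ * nome (z + τ)) =
      qProd (nome τ) (nome τ * nome z) := by rw [← h2, h7]
  rw [thetaProd, thetaProd, thetaUnit, thetaUnit, h1, h3, h6]
  linear_combination (cexp (-Real.pi * I * τ - 2 * Real.pi * I * z) * (cexp (-(Real.pi * I * z)) *
    nome z) * (1 - nome (-z)) * qProd (nome τ) (nome τ * nome (-z))) * h8 -
    cexp (-Real.pi * I * τ - 2 * Real.pi * I * z) * cexp (-(Real.pi * I * z)) *
      qProd (nome τ) (nome τ * nome z) * qProd (nome τ) (nome τ * nome (-z)) * h5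

/-- The point is that the multiplier c, which may depend on z, is the same for both functions, so it
cancels in the quotient. -/
lemma exists_factor_of_mem_torusLattice {τ : ℂ} (hτ : 0 < τ.im) {l : ℂ} (hl : l ∈ torusLattice τ) :
    ∀ z, ∃ c : ℂ, c ≠ 0 ∧ theta1 τ (z + l) = c * theta1 τ z ∧
      thetaProd τ (z + l) = c * thetaProd τ z := by
  induction hl using AddSubgroup.closure_induction with
  | mem x hx =>
    intro z
    rcases hx with rfl | rfl
    · exact ⟨-1, by norm_num, theta1_add_one _ z, thetaProd_add_one _ z⟩
    · exact ⟨_, neg_ne_zero.2 (Complex.exp_ne_zero _), theta1_add_tau _ z, thetaProd_add_tau hτ z⟩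
  | zero => exact fun z => ⟨1, one_ne_zero, by simp, by simp⟩
  | add x y _ _ hx hy =>
    intro z
    obtain ⟨c, hc, h1, h2⟩ := hx z
    obtain ⟨d, hd, h3, h4⟩ := hy (z + x)
    exact ⟨d * c, mul_ne_zero hd hc, by rw [← add_assoc, h3, h1, mul_assoc],
      by rw [← add_assoc, h4, h2, mul_assoc]⟩
  | neg x _ hx =>
    intro z
    obtain ⟨c, hc, h1, h2⟩ := hx (z + -x)
    rw [neg_add_cancel_right] at h1 h2
    exact ⟨c⁻¹, inv_ne_zero hc, by rw [h1, inv_mul_cancel_left₀ hc],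
      by rw [h2, inv_mul_cancel_left₀ hc]⟩

/-- A Liouville argument. The common zero at 0 is divided out of both functions by `dslope`, and the
other lattice points are left out of the domain, so removability has to be handled only at one
point. -/
lemma exists_theta1_eq_thetaProd {τ : ℂ} (hτ : 0 < τ.im) :
    ∃ C : ℂ, C ≠ 0 ∧ ∀ z, theta1 τ z = C * thetaProd τ z := by
  have hds : ∀ (f : ℂ → ℂ), f 0 = 0 → ∀ z, f z = z * dslope f 0 z := by
    intro f hf z
    have := sub_smul_dslope f 0 z
    simpa [hf] using this.symm
  set a := dslope (theta1 τ) 0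
  set b := dslope (thetaProd τ) 0
  have ha : Differentiable ℂ a := fun z =>
    ((differentiableOn_dslope (univ_mem (f := 𝓝 (0 : ℂ)))).2
      (differentiable_theta1 hτ).differentiableOn).differentiableAt univ_mem
  have hb : Differentiable ℂ b := fun z =>
    ((differentiableOn_dslope (univ_mem (f := 𝓝 (0 : ℂ)))).2
      (differentiable_thetaProd hτ).differentiableOn).differentiableAt univ_mem
  have hb0 : ∀ z ∈ latticeCompl τ, b z ≠ 0 := by
    intro z hz
    rcases eq_or_ne z 0 with rfl | h0
    · simpa [b] using deriv_thetaProd_zero hτ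
    · intro h
      have hP := hds (thetaProd τ) (thetaProd_zero τ) z
      exact thetaProd_ne_zero hτ (fun hl => h0 (mem_latticeCompl.1 hz hl))
        (hP.trans (by rw [show dslope (thetaProd τ) 0 z = b z from rfl, h, mul_zero]))
  have hdiff : DifferentiableOn ℂ (fun z => a z / b z) (latticeCompl τ) :=
    fun z hz => ((ha z).div (hb z) (hb0 z hz)).differentiableWithinAt
  have hquot : ∀ z, z ≠ 0 → a z / b z = theta1 τ z / thetaProd τ z := by
    intro z hz
    rw [hds _ (theta1_zero τ) z, hds _ (thetaProd_zero τ) z, mul_div_mul_left _ _ hz]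
  obtain ⟨p, hp, hmax⟩ := (isCompact_centredCell τ).exists_isMaxOn ⟨0, zero_mem_centredCell τ⟩
    (hdiff.continuousOn.mono (centredCell_subset_latticeCompl hτ)).norm
  -- A point outside the lattice is translated into the cell, where periodicity of the quotient
  -- compares it with p. The maximum over the cell is thus a maximum over the open connected domain.
  have hmax' : IsMaxOn (norm ∘ fun z => a z / b z) (latticeCompl τ) p := by
    intro z hz
    rcases eq_or_ne z 0 with rfl | h0
    · exact hmax (zero_mem_centredCell τ)
    · have hzl : z ∉ torusLattice τ := fun h => h0 (mem_latticeCompl.1 hz h)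
      obtain ⟨l, hl, hzK⟩ := exists_add_mem_centredCell hτ z
      obtain ⟨c, hc, h1, h2⟩ := exists_factor_of_mem_torusLattice hτ hl z
      have hzl' : z + l ≠ 0 := fun h =>
        hzl (by rw [eq_neg_of_add_eq_zero_left h]; exact neg_mem hl)
      have := hmax hzK
      simp only [mem_ofPred_eq] at this
      rw [hquot _ hzl', h1, h2, mul_div_mul_left _ _ hc, ← hquot z h0] at this
      exact this
  have hconst := Complex.eqOn_of_isPreconnected_of_isMaxOn_norm (isPreconnected_latticeCompl τ)
    (isOpen_latticeCompl hτ) hdiff (centredCell_subset_latticeCompl hτ hp) hmax'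
  set C : ℂ := a p / b p with hC
  have heq : ∀ z, theta1 τ z = C * thetaProd τ z := by
    intro z
    by_cases hz : z ∈ torusLattice τ
    · obtain ⟨c, hc, h1, h2⟩ := exists_factor_of_mem_torusLattice hτ hz 0
      rw [zero_add] at h1 h2
      rw [h1, h2, theta1_zero, thetaProd_zero]
      simp
    · have h0 : z ≠ 0 := by rintro rfl; exact hz (zero_mem _)
      have h1 := hconst (mem_latticeCompl_of_notMem hz)
      simp only [Function.const_apply] at h1
      rw [hquot z h0, div_eq_iff (thetaProd_ne_zero hτ hz)] at h1
      exact h1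
  refine ⟨C, fun h => ?_, heq⟩
  obtain ⟨z, hz⟩ := exists_theta1_ne_zero hτ
  exact hz (by rw [heq, h, zero_mul])

lemma theta1_ne_zero {τ : ℂ} (hτ : 0 < τ.im) {z : ℂ} (hz : z ∉ torusLattice τ) :
    theta1 τ z ≠ 0 := by
  obtain ⟨C, hC, h⟩ := exists_theta1_eq_thetaProd hτ
  rw [h]
  exact mul_ne_zero hC (thetaProd_ne_zero hτ hz)

/-- The theta function has a simple zero at the origin. -/
lemma exists_theta1_eq_mul {τ : ℂ} (hτ : 0 < τ.im) :
    ∃ g : ℂ → ℂ, Differentiable ℂ g ∧ (∀ z, theta1 τ z = z * g z) ∧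
      ∀ z ∈ latticeCompl τ, g z ≠ 0 := by
  obtain ⟨C, hC, h⟩ := exists_theta1_eq_thetaProd hτ
  have hmul : ∀ z, theta1 τ z = z * dslope (theta1 τ) 0 z := fun z => by
    have := sub_smul_dslope (theta1 τ) 0 z
    simpa [theta1_zero] using this.symm
  refine ⟨dslope (theta1 τ) 0, fun z => ((differentiableOn_dslope (univ_mem (f := 𝓝 (0 : ℂ)))).2
      (differentiable_theta1 hτ).differentiableOn).differentiableAt univ_mem, hmul,
    fun z hz h0 => ?_⟩
  rcases eq_or_ne z 0 with rfl | hz0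
  · rw [dslope_same, funext h, deriv_const_mul_field] at h0
    exact mul_ne_zero hC (deriv_thetaProd_zero hτ) h0
  · refine theta1_ne_zero hτ (fun hl => hz0 (mem_latticeCompl.1 hz hl)) ?_
    rw [hmul, h0, mul_zero]

/-! ### The Green's function -/

/-- Under z ↦ z + τ the modulus of the multiplier of ϑ₁ is exactly compensated by the change of (Im
z)²/(2 Im τ). Lattice points are excluded because there the logarithm takes its default value 0 and
the quadratic term alone is not periodic. -/
lemma torusGreen_add_of_mem {τ : ℂ} (hτ : 0 < τ.im) {l : ℂ} (hl : l ∈ torusLattice τ) :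
    ∀ z ∉ torusLattice τ, torusGreen τ (z + l) = torusGreen τ z := by
  induction hl using AddSubgroup.closure_induction with
  | mem x hx =>
    intro z hz
    have h0 := norm_ne_zero_iff.2 (theta1_ne_zero hτ hz)
    rcases hx with rfl | rfl
    · rw [torusGreen, torusGreen, theta1_add_one]
      simp
    · rw [torusGreen, torusGreen, theta1_add_tau, norm_mul, norm_neg,
        Real.log_mul (norm_ne_zero_iff.2 (Complex.exp_ne_zero _)) h0, Complex.norm_exp,
        Real.log_exp]
      simp
      field_simp
      ring
  | zero => simp
  | add x y _ hy hx' hy' =>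
    intro z hz
    rw [add_comm x, ← add_assoc, hx' _ fun h => hz (by simpa using sub_mem h hy), hy' z hz]
  | neg x hx hx' =>
    intro z hz
    rw [← hx' (z + -x) fun h => hz (by simpa using add_mem h hx), neg_add_cancel_right]

lemma contDiffAt_log_norm {f : ℂ → ℂ} (hf : Differentiable ℂ f) {z : ℂ} (hz : f z ≠ 0) :
    ContDiffAt ℝ ∞ (fun z => Real.log ‖f z‖) z := by
  have h : ContDiff ℂ ∞ f := hf.contDiff
  exact ((h.restrict_scalars ℝ).contDiffAt.norm ℝ hz).log (norm_ne_zero_iff.2 hz)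

lemma contDiffOn_torusGreen {τ : ℂ} (hτ : 0 < τ.im) :
    ContDiffOn ℝ ∞ (torusGreen τ) (torusLattice τ : Set ℂ)ᶜ := by
  intro z hz
  have h1 := contDiffAt_log_norm (differentiable_theta1 hτ) (theta1_ne_zero hτ hz)
  have h2 : ContDiff ℝ ∞ fun z : ℂ => z.im := Complex.imCLM.contDiff
  refine ContDiffAt.contDiffWithinAt ?_
  unfold torusGreen
  exact (contDiffAt_const.mul h1).add ((h2.contDiffAt.pow 2).div_const _)

/-- The Green's function is a logarithm plus a function smooth near the origin. -/
lemma exists_torusGreen_eq {τ : ℂ} (hτ : 0 < τ.im) :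
    ∃ R : ℂ → ℝ, ContDiffOn ℝ ∞ R (latticeCompl τ) ∧ ∀ z ∈ latticeCompl τ, z ≠ 0 →
      torusGreen τ z = -(1 / (2 * Real.pi)) * Real.log ‖z‖ + R z := by
  obtain ⟨g, hg, hmul, hne⟩ := exists_theta1_eq_mul hτ
  refine ⟨fun z => -(1 / (2 * Real.pi)) * Real.log ‖g z‖ + z.im ^ 2 / (2 * τ.im),
    fun z hz => ?_, fun z hz h0 => ?_⟩
  · have h2 : ContDiff ℝ ∞ fun z : ℂ => z.im := Complex.imCLM.contDiff
    exact ((contDiffAt_const.mul (contDiffAt_log_norm hg (hne z hz))).add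
      ((h2.contDiffAt.pow 2).div_const _)).contDiffWithinAt
  · rw [torusGreen, hmul, norm_mul,
      Real.log_mul (norm_ne_zero_iff.2 h0) (norm_ne_zero_iff.2 (hne z hz))]
    ring

/-! ### Integrals of smooth kernels along a curve -/

/-- A tube-lemma argument: compactness of the parameter interval makes both the inclusion and the
continuity estimate uniform along the curve. -/
lemma eventually_forall_comp_sub {H E : Type*} [NormedAddCommGroup H] [NormedAddCommGroup E]
    {k : H → E} {O : Set H} (hO : IsOpen O) (hk : ContinuousOn k O) {γ : ℝ → H}
    (hγ : Continuous γ) {z : H} (hz : ∀ t ∈ Icc (0 : ℝ) 1, z - γ t ∈ O) {ε : ℝ} (hε : 0 < ε) :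
    ∀ᶠ w in 𝓝 z, ∀ t ∈ Icc (0 : ℝ) 1, w - γ t ∈ O ∧ ‖k (w - γ t) - k (z - γ t)‖ ≤ ε := by
  refine isCompact_Icc.eventually_forall_of_forall_eventually fun t ht => ?_
  have h1 : ContinuousAt (fun p : H × ℝ => p.1 - γ p.2) (z, t) := by fun_prop
  have h2 : ContinuousAt (fun p : H × ℝ => z - γ p.2) (z, t) := by fun_prop
  have hkz : ContinuousAt k (z - γ t) := hk.continuousAt (hO.mem_nhds (hz t ht))
  have h3 : ContinuousAt (fun p : H × ℝ => ‖k (p.1 - γ p.2) - k (z - γ p.2)‖) (z, t) :=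
    ((ContinuousAt.comp (f := fun p : H × ℝ => p.1 - γ p.2) hkz h1).sub
      (ContinuousAt.comp (f := fun p : H × ℝ => z - γ p.2) hkz h2)).norm
  filter_upwards [h1.eventually (hO.mem_nhds (hz t ht)),
    h3.eventually (Iio_mem_nhds (by simpa using hε))] with p hp1 hp2
  exact ⟨hp1, (mem_Iio.1 hp2).le⟩

lemma continuousOn_smul_comp_sub {𝕜 H F : Type*} [RCLike 𝕜]
    [NormedAddCommGroup H] [NormedAddCommGroup F] [NormedSpace 𝕜 F] {f : H → F}
    {O : Set H} (hf : ContinuousOn f O) {γ : ℝ → H} (hγ : Continuous γ) {g : ℝ → 𝕜}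
    (hg : Continuous g) {z : H} (hz : ∀ t ∈ Icc (0 : ℝ) 1, z - γ t ∈ O) :
    ContinuousOn (fun t => g t • f (z - γ t)) (Icc (0 : ℝ) 1) :=
  hg.continuousOn.smul (hf.comp (by fun_prop) hz)

lemma aestronglyMeasurable_smul_comp_sub {𝕜 H F : Type*} [RCLike 𝕜]
    [NormedAddCommGroup H] [NormedAddCommGroup F] [NormedSpace 𝕜 F]
    {f : H → F} {O : Set H} (hf : ContinuousOn f O) {γ : ℝ → H} (hγ : Continuous γ) {g : ℝ → 𝕜}
    (hg : Continuous g) {z : H} (hz : ∀ t ∈ Icc (0 : ℝ) 1, z - γ t ∈ O) :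
    AEStronglyMeasurable (fun t => g t • f (z - γ t)) (volume.restrict (Set.uIoc (0 : ℝ) 1)) := by
  refine ((continuousOn_smul_comp_sub hf hγ hg hz).aestronglyMeasurable measurableSet_Icc).mono_set ?_
  rw [uIoc_of_le zero_le_one]
  exact Ioc_subset_Icc_self

section

variable {𝕜 : Type*} [RCLike 𝕜] {E : Type*} [NormedAddCommGroup E]
  [NormedSpace ℝ E] [NormedSpace 𝕜 E] {H : Type*} [NormedAddCommGroup H]
  [NormedSpace 𝕜 H]

/-- Differentiation under the integral; near z the derivative of the kernel stays within 1 of its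
value at z, which supplies the dominating function. The scalars are kept general since both real
gradients and complex derivatives are taken this way. -/
lemma hasFDerivAt_integral_comp_sub {k : H → E} {O : Set H} (hO : IsOpen O)
    (hk : ContDiffOn 𝕜 1 k O) {γ : ℝ → H} (hγ : Continuous γ) {g : ℝ → 𝕜} (hg : Continuous g)
    {z : H} (hz : ∀ t ∈ Icc (0 : ℝ) 1, z - γ t ∈ O) :
    HasFDerivAt (fun z => ∫ t in (0 : ℝ)..1, g t • k (z - γ t))
      (∫ t in (0 : ℝ)..1, g t • fderiv 𝕜 k (z - γ t)) z := by
  have hk' : ContinuousOn (fderiv 𝕜 k) O := hk.continuousOn_fderiv_of_isOpen hO le_rfl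
  have hev := eventually_forall_comp_sub hO hk' hγ hz one_pos
  have huIoc : Set.uIoc (0 : ℝ) 1 ⊆ Icc 0 1 := by
    rw [uIoc_of_le zero_le_one]
    exact Ioc_subset_Icc_self
  refine intervalIntegral.hasFDerivAt_integral_of_dominated_of_fderiv_le (𝕜 := 𝕜)
    (F' := fun w t => g t • fderiv 𝕜 k (w - γ t))
    (bound := fun t => ‖g t‖ * (1 + ‖fderiv 𝕜 k (z - γ t)‖)) hev ?_ ?_ ?_ ?_ ?_ ?_
  · filter_upwards [hev] with w hw
    exact aestronglyMeasurable_smul_comp_sub hk.continuousOn hγ hg fun t ht => (hw t ht).1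
  · exact (continuousOn_smul_comp_sub hk.continuousOn hγ hg hz).intervalIntegrable_of_Icc zero_le_one
  · exact aestronglyMeasurable_smul_comp_sub hk' hγ hg hz
  · refine .of_forall fun t ht w hw => ?_
    rw [norm_smul]
    gcongr
    have := norm_le_norm_add_norm_sub' (fderiv 𝕜 k (w - γ t)) (fderiv 𝕜 k (z - γ t))
    linarith [(hw t (huIoc ht)).2]
  · refine ContinuousOn.intervalIntegrable_of_Icc zero_le_one ?_
    exact hg.norm.continuousOn.mul (continuousOn_const.add
      (hk'.comp (f := fun t => z - γ t) (by fun_prop) hz).norm)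
  · refine .of_forall fun t ht w hw => ?_
    have h1 : DifferentiableAt 𝕜 k (w - γ t) :=
      (hk.differentiableOn one_ne_zero).differentiableAt (hO.mem_nhds (hw t (huIoc ht)).1)
    exact ((hasFDerivAt_comp_sub (γ t)).2 h1.hasFDerivAt).const_smul (g t)

end

/-! ### Logarithmic potentials as real parts of analytic functions -/

/-- The real linear form `v ↦ Re (c v)`. -/
noncomputable def reMul : ℂ →L[ℝ] ℂ →L[ℝ] ℝ :=
  (ContinuousLinearMap.compL ℝ ℂ ℂ ℝ reCLM) ∘L (ContinuousLinearMap.mul ℝ ℂ)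

lemma reMul_apply (c v : ℂ) : reMul c v = (c * v).re := rfl

lemma hasFDerivAt_re_of_hasDerivAt {F : ℂ → ℂ} {c z : ℂ} (h : HasDerivAt F c z) :
    HasFDerivAt (fun w => (F w).re) (reMul c) z := by
  refine (reCLM.hasFDerivAt.comp z (h.hasFDerivAt.restrictScalars ℝ)).congr_fderiv ?_
  ext v
  simp [reMul_apply, mul_comm]

lemma hasFDerivAt_log_norm {θ : ℂ → ℂ} (hθ : Differentiable ℂ θ) {z : ℂ} (hz : θ z ≠ 0) :
    HasFDerivAt (fun w => Real.log ‖θ w‖) (reMul (deriv θ z / θ z)) z := by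
  -- Dividing by the value at z brings the argument of the logarithm to 1, away from the branch cut;
  -- only an additive constant is lost.
  have h1 : HasDerivAt (fun w => Complex.log (θ w / θ z)) (deriv θ z / θ z) z := by
    have h := ((hθ z).hasDerivAt.div_const (θ z)).clog (by rw [div_self hz]; exact one_mem_slitPlane)
    rwa [div_self hz, div_one] at h
  refine ((hasFDerivAt_re_of_hasDerivAt h1).add_const (Real.log ‖θ z‖)).congr_of_eventuallyEq ?_
  filter_upwards [hθ.continuous.continuousAt.eventually_ne hz] with w hw
  rw [Complex.log_re, norm_div, Real.log_div (norm_ne_zero_iff.2 hw) (norm_ne_zero_iff.2 hz)]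
  ring

/-- The logarithmic potential of an analytic function without zeros on the relevant set is locally
the real part of an analytic function. -/
lemma exists_analyticAt_integral_log_norm {θ : ℂ → ℂ} (hθ : Differentiable ℂ θ) {γ : ℝ → ℂ}
    (hγ : Continuous γ) {g : ℝ → ℝ} (hg : Continuous g) {z : ℂ}
    (hz : ∀ t ∈ Icc (0 : ℝ) 1, θ (z - γ t) ≠ 0) :
    ∃ F : ℂ → ℂ, AnalyticAt ℂ F z ∧
      (fun w => ∫ t in (0 : ℝ)..1, g t * Real.log ‖θ (w - γ t)‖) =ᶠ[𝓝 z] fun w => (F w).re := by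
  set O : Set ℂ := {w | θ w ≠ 0} with hOdef
  have hO : IsOpen O := isOpen_ne_fun hθ.continuous continuous_const
  have hlog : ContDiffOn ℝ 1 (fun w => Real.log ‖θ w‖) O := fun w hw =>
    ((contDiffAt_log_norm hθ hw).of_le (by exact_mod_cast le_top)).contDiffWithinAt
  have hquot : ContDiffOn ℂ 1 (fun w => deriv θ w / θ w) O := by
    have h1 : ContDiff ℂ 1 θ := hθ.contDiff
    have h2 : ContDiff ℂ 1 (deriv θ) := (hθ.contDiff (n := 2)).deriv' 
    exact h2.contDiffOn.div h1.contDiffOn fun w hw => hw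
  obtain ⟨r, hr, hball⟩ := Metric.eventually_nhds_iff_ball.1
    (eventually_forall_comp_sub hO hlog.continuousOn hγ (z := z) hz one_pos)
  -- The real differential of the potential is v ↦ Re(f v). A primitive F of f on the ball therefore
  -- has real part equal to the potential up to a constant.
  set f : ℂ → ℂ := fun w => ∫ t in (0 : ℝ)..1, (g t : ℂ) • (deriv θ (w - γ t) / θ (w - γ t))
  have hf : DifferentiableOn ℂ f (Metric.ball z r) := fun w hw =>
    (hasFDerivAt_integral_comp_sub (𝕜 := ℂ) hO hquot hγ (continuous_ofReal.comp hg)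
      fun t ht => (hball w hw t ht).1).differentiableAt.differentiableWithinAt
  obtain ⟨F, hF⟩ := hf.isExactOn_ball
  set U : ℂ → ℝ := fun w => ∫ t in (0 : ℝ)..1, g t * Real.log ‖θ (w - γ t)‖
  have hU : ∀ w ∈ Metric.ball z r, HasFDerivAt U
      (reMul (f w)) w := by
    intro w hw
    have hwO : ∀ t ∈ Icc (0 : ℝ) 1, w - γ t ∈ O := fun t ht => (hball w hw t ht).1
    have h := hasFDerivAt_integral_comp_sub (𝕜 := ℝ) hO hlog hγ hg hwO
    refine h.congr_fderiv ?_
    have hi : IntervalIntegrable (fun t => (g t : ℂ) • (deriv θ (w - γ t) / θ (w - γ t)))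
        volume 0 1 :=
      (continuousOn_smul_comp_sub (g := fun t => (g t : ℂ)) hquot.continuousOn hγ
        (continuous_ofReal.comp hg) hwO).intervalIntegrable_of_Icc zero_le_one
    rw [← reMul.intervalIntegral_comp_comm hi]
    refine intervalIntegral.integral_congr fun t ht => ?_
    rw [uIcc_of_le zero_le_one] at ht
    rw [(hasFDerivAt_log_norm hθ (hwO t ht)).fderiv, ← map_smul]
    simp
  have hconst : ∀ w ∈ Metric.ball z r, U w - (F w).re = U z - (F z).re := by
    intro w hw
    have hd : ∀ x ∈ Metric.ball z r, HasFDerivAt (fun w => U w - (F w).re) 0 x := fun x hx => by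
      have h := (hU x hx).sub (hasFDerivAt_re_of_hasDerivAt (hF x hx))
      rwa [sub_self] at h
    refine (convex_ball z r).is_const_of_fderivWithin_eq_zero (𝕜 := ℝ)
      (f := fun w => U w - (F w).re) ?_ ?_ hw (Metric.mem_ball_self hr)
    · exact fun x hx => (hd x hx).differentiableAt.differentiableWithinAt
    · intro x hx
      rw [fderivWithin_of_isOpen Metric.isOpen_ball hx, (hd x hx).fderiv]
  refine ⟨fun w => F w + ((U z - (F z).re : ℝ) : ℂ), ?_, ?_⟩
  · have : DifferentiableOn ℂ F (Metric.ball z r) := fun w hw => (hF w hw).differentiableAt.differentiableWithinAt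
    exact (this.analyticAt (Metric.ball_mem_nhds z hr)).add analyticAt_const
  · filter_upwards [Metric.ball_mem_nhds z hr] with w hw
    have := hconst w hw
    simp only [add_re, ofReal_re]
    linarith

/-! ### Regular closed curves -/

lemma Function.Periodic.exists_eq_add_int {E : Type*} {γ : ℝ → E} (hper : Function.Periodic γ 1)
    (hinj : InjOn γ (Ico 0 1)) {s t : ℝ} (h : γ s = γ t) : ∃ n : ℤ, s = t + n := by
  have hfr : ∀ x, γ (Int.fract x) = γ x := fun x => by
    have := hper.sub_int_mul_eq (x := x) ⌊x⌋
    rwa [mul_one] at this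
  have := hinj ⟨Int.fract_nonneg s, Int.fract_lt_one s⟩ ⟨Int.fract_nonneg t, Int.fract_lt_one t⟩
    (by rw [hfr, hfr, h])
  obtain ⟨n, hn⟩ := Int.fract_eq_fract.1 this
  exact ⟨n, by linarith⟩

/-- Each value is taken at most once per period. This discards, as a null set, the parameters at
which a kernel is evaluated on the lattice. -/
lemma Function.Periodic.countable_preimage {E : Type*} {γ : ℝ → E} (hper : Function.Periodic γ 1)
    (hinj : InjOn γ (Ico 0 1)) {C : Set E} (hC : C.Countable) : (γ ⁻¹' C).Countable := by
  have h : γ ⁻¹' C = ⋃ c ∈ C, {t | γ t = c} := by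
    ext t
    simp
  rw [h]
  refine hC.biUnion fun c _ => ?_
  by_cases hne : ∃ t, γ t = c
  · obtain ⟨t, rfl⟩ := hne
    refine (countable_range fun n : ℤ => t + n).mono fun s hs => ?_
    obtain ⟨n, hn⟩ := hper.exists_eq_add_int hinj hs
    exact ⟨n, hn.symm⟩
  · have : {t | γ t = c} = ∅ := eq_empty_of_forall_notMem fun t ht => hne ⟨t, ht⟩
    rw [this]
    exact countable_empty

/-- The quotient (γ(s + u) - γ(s))/u extends continuously to u = 0 as the mean of γ' over the
segment. It never vanishes for |u| ≤ 1/2: by injectivity if u ≠ 0, by regularity if u = 0. Its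
minimum over a compact set is the constant. -/
lemma exists_chord_arc {γ : ℝ → ℂ} (hγ : ContDiff ℝ 1 γ) (hper : Function.Periodic γ 1)
    (hinj : InjOn γ (Ico 0 1)) (hne : ∀ t, deriv γ t ≠ 0) :
    ∃ m > 0, ∀ s u : ℝ, |u| ≤ 1 / 2 → m * |u| ≤ ‖γ (s + u) - γ s‖ := by
  have hd : Continuous (deriv γ) := hγ.continuous_deriv le_rfl
  set F : ℝ × ℝ → ℂ := fun p => ∫ θ in (0 : ℝ)..1, deriv γ (p.1 + θ * p.2)
  have hF : Continuous F :=
    intervalIntegral.continuous_parametric_intervalIntegral_of_continuous' (by fun_prop) 0 1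
  have hFeq : ∀ s u : ℝ, u • F (s, u) = γ (s + u) - γ s := by
    intro s u
    have h := intervalIntegral.smul_integral_comp_add_mul (a := 0) (b := 1) (deriv γ) u s
    simp only [mul_zero, add_zero, mul_one] at h
    rw [intervalIntegral.integral_deriv_eq_sub
      (fun x _ => (hγ.differentiable one_ne_zero).differentiableAt)
      (hd.intervalIntegrable _ _)] at h
    rw [← h]
    simp only [F, mul_comm]
  obtain ⟨p, hp, hmin⟩ := (isCompact_Icc.prod isCompact_Icc).exists_isMinOn
    (s := Icc (0 : ℝ) 1 ×ˢ Icc (-(1 / 2) : ℝ) (1 / 2)) ⟨(0, 0), by norm_num⟩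
    hF.norm.continuousOn
  have hpos : ∀ p ∈ Icc (0 : ℝ) 1 ×ˢ Icc (-(1 / 2) : ℝ) (1 / 2), F p ≠ 0 := by
    rintro ⟨s, u⟩ ⟨-, hu⟩ h0
    rcases eq_or_ne u 0 with rfl | hu0
    · simp [F] at h0
      exact hne s h0
    · have h := hFeq s u
      rw [h0, smul_zero] at h
      obtain ⟨n, hn⟩ := hper.exists_eq_add_int hinj (sub_eq_zero.1 h.symm)
      have hun : u = n := by linarith
      simp only [hun] at hu hu0
      have h1 : (n : ℝ) < 1 := by linarith [hu.2]
      have h2 : (-1 : ℝ) < n := by linarith [hu.1]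
      have h1' : n < 1 := by exact_mod_cast h1
      have h2' : -1 < n := by exact_mod_cast h2
      exact hu0 (by rw [show n = 0 by omega]; simp)
  refine ⟨‖F p‖, norm_pos_iff.2 (hpos p hp), fun s u hu => ?_⟩
  have hfr : ∀ x, γ (Int.fract s + x) = γ (s + x) := fun x => by
    have := hper.sub_int_mul_eq (x := s + x) ⌊s⌋
    rw [mul_one] at this
    rw [← this, Int.fract]
    congr 1
    ring
  have h0 := hfr 0
  rw [add_zero, add_zero] at h0
  rw [← hfr, ← h0, ← hFeq, norm_smul, Real.norm_eq_abs, mul_comm]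
  gcongr
  exact hmin (show (Int.fract s, u) ∈ _ from
    ⟨⟨Int.fract_nonneg s, (Int.fract_lt_one s).le⟩, abs_le.1 hu⟩)

/-! ### The logarithmic kernel on a curve -/

lemma abs_log_le_add_rpow {a : ℝ} (ha : 0 < a) : |Real.log a| ≤ a + 2 * a ^ (-(1 / 2) : ℝ) := by
  have hp : 0 < a ^ (-(1 / 2) : ℝ) := Real.rpow_pos_of_pos ha _
  have h1 := Real.log_le_sub_one_of_pos ha
  have h2 := Real.log_le_sub_one_of_pos hp
  rw [Real.log_rpow ha] at h2
  rw [abs_le]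
  constructor <;> linarith

/-- Write the difference as 2 log √(a/b), then use log x ≤ x - 1 and √(1 + y) ≤ 1 + √y. The square
root gives the Hölder exponent, and the remaining power of b is integrable along the curve. -/
lemma log_sub_log_le {a b : ℝ} (hb : 0 < b) (hab : b ≤ a) :
    Real.log a - Real.log b ≤ 2 * (Real.sqrt (a - b) * b ^ (-(1 / 2) : ℝ)) := by
  have ha : 0 < a := hb.trans_le hab
  have h1 : Real.sqrt (a / b) ≤ 1 + Real.sqrt ((a - b) / b) := by
    rw [Real.sqrt_le_left (by positivity)]
    have h2 : 0 ≤ (a - b) / b := div_nonneg (by linarith) hb.le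
    have h3 : a / b = 1 + (a - b) / b := by field_simp; ring
    rw [h3, add_sq, Real.sq_sqrt h2]
    nlinarith [Real.sqrt_nonneg ((a - b) / b)]
  have h4 := Real.log_le_sub_one_of_pos (Real.sqrt_pos.2 (div_pos ha hb))
  rw [Real.log_sqrt (by positivity), Real.log_div ha.ne' hb.ne'] at h4
  have h5 : Real.sqrt ((a - b) / b) = Real.sqrt (a - b) * b ^ (-(1 / 2) : ℝ) := by
    rw [Real.sqrt_div' _ hb.le, Real.rpow_neg hb.le, ← Real.sqrt_eq_rpow, div_eq_mul_inv]
  rw [← h5]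
  linarith

lemma abs_log_sub_log_le {a b : ℝ} (ha : 0 < a) (hb : 0 < b) : |Real.log a - Real.log b| ≤
    2 * (Real.sqrt |a - b| * (a ^ (-(1 / 2) : ℝ) + b ^ (-(1 / 2) : ℝ))) := by
  have hpa : 0 < a ^ (-(1 / 2) : ℝ) := Real.rpow_pos_of_pos ha _
  have hpb : 0 < b ^ (-(1 / 2) : ℝ) := Real.rpow_pos_of_pos hb _
  have hs := Real.sqrt_nonneg |a - b|
  rcases le_total b a with h | h
  · have h1 := log_sub_log_le hb h
    rw [abs_of_nonneg (sub_nonneg.2 (Real.log_le_log hb h))]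
    rw [abs_of_nonneg (sub_nonneg.2 h)] at *
    nlinarith
  · have h1 := log_sub_log_le ha h
    rw [abs_sub_comm, abs_of_nonneg (sub_nonneg.2 (Real.log_le_log ha h))]
    rw [abs_sub_comm, abs_of_nonneg (sub_nonneg.2 h)] at *
    nlinarith

lemma intervalIntegrable_mul_abs_rpow {c : ℝ} (hc : 0 < c) :
    IntervalIntegrable (fun u : ℝ => (c * |u|) ^ (-(1 / 2) : ℝ)) volume (-(1 / 2)) (1 / 2) := by
  refine intervalIntegrable_of_even (by simp) fun x hx => ?_
  refine ((intervalIntegral.intervalIntegrable_rpow' (r := -(1 / 2)) (by norm_num)).const_mul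
    (c ^ (-(1 / 2) : ℝ))).congr fun u hu => ?_
  rw [uIoc_of_le hx.le] at hu
  rw [abs_of_pos hu.1, Real.mul_rpow hc.le hu.1.le]

/-- The weakly singular kernel `|z - ξ|^{-1/2}` is integrable along the curve, uniformly in `z`. -/
lemma exists_integral_rpow_le {γ : ℝ → ℂ} (hγ : ContDiff ℝ 1 γ) (hper : Function.Periodic γ 1)
    (hinj : InjOn γ (Ico 0 1)) (hne : ∀ t, deriv γ t ≠ 0) :
    ∃ B : ℝ, ∀ z : ℂ,
      IntervalIntegrable (fun t => ‖z - γ t‖ ^ (-(1 / 2) : ℝ)) volume 0 1 ∧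
      ∫ t in (0 : ℝ)..1, ‖z - γ t‖ ^ (-(1 / 2) : ℝ) ≤ B := by
  obtain ⟨m, hm, hchord⟩ := exists_chord_arc hγ hper hinj hne
  refine ⟨∫ u in (-(1 / 2) : ℝ)..(1 / 2), (m / 2 * |u|) ^ (-(1 / 2) : ℝ), fun z => ?_⟩
  set h : ℝ → ℝ := fun t => ‖z - γ t‖ ^ (-(1 / 2) : ℝ) with hh
  have hhper : Function.Periodic h 1 := fun t => by simp only [hh, hper t]
  -- Let γ(a) be a point of the curve nearest to z. Then |γ(a + u) - γ(a)| ≤ 2|z - γ(a + u)|, so the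
  -- chord-arc bound gives |z - γ(a + u)| ≥ (m/2)|u| with no dependence on z.
  obtain ⟨a, -, hmin⟩ := isCompact_Icc.exists_isMinOn (s := Icc (0 : ℝ) 1) ⟨0, by norm_num⟩
    (f := fun t => ‖z - γ t‖) (by have := hγ.continuous; fun_prop)
  have hmin' : ∀ t, ‖z - γ a‖ ≤ ‖z - γ t‖ := fun t => by
    have h1 := hmin (show Int.fract t ∈ Icc (0 : ℝ) 1 from
      ⟨Int.fract_nonneg t, (Int.fract_lt_one t).le⟩)
    have h2 := hper.sub_int_mul_eq (x := t) ⌊t⌋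
    rw [mul_one] at h2
    simp only [mem_ofPred_eq, Int.fract, h2] at h1
    exact h1
  have hle : ∀ u : ℝ, |u| ≤ 1 / 2 → u ≠ 0 →
      ‖z - γ (a + u)‖ ^ (-(1 / 2) : ℝ) ≤ (m / 2 * |u|) ^ (-(1 / 2) : ℝ) := by
    intro u hu h0
    have h1 := hchord a u hu
    have h2 := norm_sub_le_norm_sub_add_norm_sub (γ (a + u)) z (γ a)
    rw [norm_sub_rev (γ (a + u)) z] at h2
    have h3 := hmin' (a + u)
    exact Real.rpow_le_rpow_of_nonpos (by positivity) (by linarith) (by norm_num)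
  have hmeas : Measurable h := by
    have := hγ.continuous.measurable
    fun_prop
  have hae : ∀ᵐ u : ℝ, u ∈ Icc (-(1 / 2) : ℝ) (1 / 2) →
      ‖h (a + u)‖ ≤ (m / 2 * |u|) ^ (-(1 / 2) : ℝ) := by
    filter_upwards [compl_mem_ae_iff.2 (measure_singleton (0 : ℝ))] with u hu0 hu
    rw [Real.norm_of_nonneg (by positivity)]
    exact hle u (abs_le.2 hu) hu0
  have hint := intervalIntegrable_mul_abs_rpow (half_pos hm)
  have hi : IntervalIntegrable (fun u => h (a + u)) volume (-(1 / 2)) (1 / 2) :=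
    hint.mono_fun (hmeas.comp (measurable_const_add a)).aestronglyMeasurable (by
      rw [Filter.EventuallyLE, ae_restrict_iff' measurableSet_uIoc]
      filter_upwards [hae] with u hu huI
      rw [uIoc_of_le (by norm_num)] at huI
      exact (hu (Ioc_subset_Icc_self huI)).trans (le_abs_self _))
  have hi2 : IntervalIntegrable h volume (a - 1 / 2) (a - 1 / 2 + 1) := by
    have := hi.comp_sub_right a
    simp only [add_sub_cancel] at this
    convert this using 1 <;> ring
  constructor
  · exact hhper.intervalIntegrable one_ne_zero hi2 0 1
  · calc ∫ t in (0 : ℝ)..1, h t = ∫ t in (0 : ℝ)..(0 + 1), h t := by rw [zero_add]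
      _ = ∫ t in (a - 1 / 2)..(a - 1 / 2 + 1), h t := hhper.intervalIntegral_add_eq _ _
      _ = ∫ u in (-(1 / 2) : ℝ)..(1 / 2), h (a + u) := by
        rw [intervalIntegral.integral_comp_add_left]
        congr 1
        all_goals ring
      _ ≤ _ := by
        refine intervalIntegral.integral_mono_ae_restrict (by norm_num) hi hint ?_
        rw [Filter.EventuallyLE, ae_restrict_iff' measurableSet_Icc]
        filter_upwards [hae] with u hu huI
        exact (le_abs_self _).trans (hu huI)

/-- The logarithmic kernel is integrable along the curve, and its integral is Hölder continuous in
the pole. -/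
lemma exists_integral_abs_log_sub_le {γ : ℝ → ℂ} (hγ : ContDiff ℝ 1 γ)
    (hper : Function.Periodic γ 1) (hinj : InjOn γ (Ico 0 1)) (hne : ∀ t, deriv γ t ≠ 0) :
    (∀ z : ℂ, IntervalIntegrable (fun t => Real.log ‖z - γ t‖) volume 0 1) ∧
    ∃ B : ℝ, ∀ z w : ℂ, ∫ t in (0 : ℝ)..1, |Real.log ‖z - γ t‖ - Real.log ‖w - γ t‖| ≤
      B * Real.sqrt ‖z - w‖ := by
  obtain ⟨B, hB⟩ := exists_integral_rpow_le hγ hper hinj hne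
  have hc := hγ.continuous
  have hae : ∀ z : ℂ, ∀ᵐ t : ℝ, 0 < ‖z - γ t‖ := by
    intro z
    filter_upwards [compl_mem_ae_iff.2
      ((hper.countable_preimage hinj (countable_singleton z)).measure_zero volume)] with t ht
    exact norm_pos_iff.2 (sub_ne_zero.2 fun h => ht h.symm)
  have hint : ∀ z : ℂ, IntervalIntegrable (fun t => Real.log ‖z - γ t‖) volume 0 1 := by
    intro z
    have h1 : IntervalIntegrable (fun t => ‖z - γ t‖ + 2 * ‖z - γ t‖ ^ (-(1 / 2) : ℝ)) volume 0 1 :=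
      (Continuous.intervalIntegrable (by fun_prop) _ _).add ((hB z).1.const_mul 2)
    refine h1.mono_fun (Measurable.aestronglyMeasurable ?_) ?_
    · have := hc.measurable
      fun_prop
    · filter_upwards [ae_restrict_of_ae (hae z)] with t ht
      exact (abs_log_le_add_rpow ht).trans (le_abs_self _)
  refine ⟨hint, 4 * B, fun z w => ?_⟩
  calc ∫ t in (0 : ℝ)..1, |Real.log ‖z - γ t‖ - Real.log ‖w - γ t‖|
      ≤ ∫ t in (0 : ℝ)..1, 2 * Real.sqrt ‖z - w‖ *
        (‖z - γ t‖ ^ (-(1 / 2) : ℝ) + ‖w - γ t‖ ^ (-(1 / 2) : ℝ)) := by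
        refine intervalIntegral.integral_mono_ae zero_le_one ((hint z).sub (hint w)).abs
          (((hB z).1.add (hB w).1).const_mul _) ?_
        filter_upwards [hae z, hae w] with t hz hw
        refine (abs_log_sub_log_le hz hw).trans ?_
        rw [← mul_assoc]
        have h1 : |‖z - γ t‖ - ‖w - γ t‖| ≤ ‖z - w‖ := by
          have := abs_norm_sub_norm_le (z - γ t) (w - γ t)
          rwa [sub_sub_sub_cancel_right] at this
        gcongr
    _ ≤ 4 * B * Real.sqrt ‖z - w‖ := by
        rw [intervalIntegral.integral_const_mul, intervalIntegral.integral_add (hB z).1 (hB w).1]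
        have := (hB z).2
        have := (hB w).2
        nlinarith [Real.sqrt_nonneg ‖z - w‖]

/-! ### The Poisson kernel of the half plane -/

lemma inv_sub_ofReal_im (ζ : ℂ) (u : ℝ) :
    ((ζ - u)⁻¹).im = -(ζ.im / ((u - ζ.re) ^ 2 + ζ.im ^ 2)) := by
  rw [Complex.inv_im, Complex.normSq_apply]
  simp only [sub_im, ofReal_im, sub_zero, sub_re, ofReal_re, neg_div]
  congr 2
  ring

lemma integral_poisson_kernel {x y : ℝ} (hy : 0 < y) (a b : ℝ) :
    ∫ u in a..b, y / ((u - x) ^ 2 + y ^ 2) = Real.arctan ((b - x) / y) - Real.arctan ((a - x) / y) := by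
  have hd : ∀ u : ℝ, HasDerivAt (fun u => Real.arctan ((u - x) / y)) (y / ((u - x) ^ 2 + y ^ 2)) u := by
    intro u
    have h := (((hasDerivAt_id u).sub_const x).div_const y).arctan
    refine h.congr_deriv ?_
    simp only [id]
    have : 0 < (u - x) ^ 2 + y ^ 2 := by positivity
    field_simp
    ring
  refine intervalIntegral.integral_eq_sub_of_hasDerivAt (fun u _ => hd u)
    (Continuous.intervalIntegrable ?_ _ _)
  refine continuous_const.div (by fun_prop) fun u => ?_
  positivity

/-- The kernel -π⁻¹ Im 1/(ζ - u) is a nonnegative approximate identity as ζ tends to 0 in the upper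
half plane. This is the source of the jump. -/
lemma tendsto_integral_poisson {g : ℝ → ℝ} (hg : Continuous g) :
    Tendsto (fun ζ : ℂ => ∫ u in (-(1 / 2) : ℝ)..(1 / 2), ((ζ - u)⁻¹).im * g u)
      (𝓝[{ζ | 0 < ζ.im}] 0) (𝓝 (-(Real.pi * g 0))) := by
  set l : Filter ℂ := 𝓝[{ζ | 0 < ζ.im}] 0
  have hl : ∀ᶠ ζ : ℂ in l, 0 < ζ.im := self_mem_nhdsWithin
  have hl0 : Tendsto (fun ζ : ℂ => ζ) l (𝓝 0) := nhdsWithin_le_nhds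
  have him : Tendsto Complex.im l (𝓝[>] 0) := tendsto_nhdsWithin_iff.2
    ⟨(Complex.continuous_im.tendsto' 0 0 rfl).comp hl0, hl⟩
  have hre : Tendsto Complex.re l (𝓝 0) := (Complex.continuous_re.tendsto' 0 0 rfl).comp hl0
  -- The total mass is a difference of arctangents tending to π/2 and -π/2, divided by π.
  have hmass : Tendsto (fun ζ : ℂ => ∫ u in Ioc (-(1 / 2) : ℝ) (1 / 2),
      -(Real.pi⁻¹ * ((ζ - u)⁻¹).im)) l (𝓝 1) := by
    have hinv : Tendsto (fun ζ : ℂ => ζ.im⁻¹) l atTop := tendsto_inv_nhdsGT_zero.comp him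
    have h1 : Tendsto (fun ζ : ℂ => Real.arctan ((1 / 2 - ζ.re) / ζ.im)) l (𝓝 (Real.pi / 2)) := by
      refine (Real.tendsto_arctan_atTop.mono_right nhdsWithin_le_nhds).comp ?_
      simp only [div_eq_mul_inv _ (Complex.im _)]
      exact Tendsto.pos_mul_atTop (C := 1 / 2) (by norm_num)
        (by simpa only [sub_zero] using hre.const_sub (1 / 2)) hinv
    have h2 : Tendsto (fun ζ : ℂ => Real.arctan ((-(1 / 2) - ζ.re) / ζ.im)) l
        (𝓝 (-(Real.pi / 2))) := by
      refine (Real.tendsto_arctan_atBot.mono_right nhdsWithin_le_nhds).comp ?_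
      simp only [div_eq_mul_inv _ (Complex.im _)]
      exact Tendsto.neg_mul_atTop (C := -(1 / 2)) (by norm_num)
        (by simpa only [sub_zero] using hre.const_sub (-(1 / 2))) hinv
    have h3 := (h1.sub h2).const_mul Real.pi⁻¹
    rw [show Real.pi⁻¹ * (Real.pi / 2 - -(Real.pi / 2)) = 1 by
      have := Real.pi_ne_zero; field_simp; ring] at h3
    refine h3.congr' ?_
    filter_upwards [hl] with ζ hζ
    rw [← integral_poisson_kernel hζ, ← intervalIntegral.integral_of_le (by norm_num),
      ← intervalIntegral.integral_const_mul]
    refine intervalIntegral.integral_congr fun u _ => ?_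
    simp only [inv_sub_ofReal_im]
    ring
  have hpeak : Tendsto (fun ζ : ℂ => ∫ u in Ioc (-(1 / 2) : ℝ) (1 / 2),
      (-(Real.pi⁻¹ * ((ζ - u)⁻¹).im)) • g u) l (𝓝 (g 0)) := by
    refine tendsto_setIntegral_peak_smul_of_integrableOn_of_tendsto (x₀ := 0) measurableSet_Ioc
      measurableSet_Ioc subset_rfl self_mem_nhdsWithin (by simp) ?_ ?_ hmass ?_
      (hg.integrableOn_Ioc) (hg.tendsto 0 |>.mono_left nhdsWithin_le_nhds)
    · filter_upwards [hl] with ζ hζ u _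
      rw [inv_sub_ofReal_im, mul_neg, neg_neg]
      have := Real.pi_pos
      positivity
    · intro U hU h0
      obtain ⟨δ, hδ, hball⟩ := Metric.isOpen_iff.1 hU 0 h0
      rw [Metric.tendstoUniformlyOn_iff]
      intro ε hε
      have h1 : Tendsto (fun ζ : ℂ => Real.pi⁻¹ * (‖ζ‖ * (4 / δ ^ 2))) l (𝓝 0) := by
        have := ((hl0.norm).mul_const (4 / δ ^ 2)).const_mul Real.pi⁻¹
        simpa using this
      filter_upwards [hl, h1.eventually (Iio_mem_nhds hε),
        hl0.eventually (Metric.ball_mem_nhds 0 (half_pos hδ))] with ζ hζ hζε hζδ u hu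
      rw [dist_zero_right] at hζδ
      have hu' : δ ≤ |u| := by
        by_contra! h
        exact hu.2 (hball (by simpa using h))
      have hn : δ / 2 ≤ ‖ζ - u‖ := by
        have := norm_sub_norm_le (u : ℂ) ζ
        rw [norm_sub_rev, Complex.norm_real, Real.norm_eq_abs] at this
        linarith
      rw [Pi.zero_apply, dist_zero_left, norm_neg, norm_mul,
        Real.norm_of_nonneg (inv_nonneg.2 Real.pi_pos.le), Complex.inv_im, Complex.normSq_eq_norm_sq]
      refine lt_of_le_of_lt ?_ (mem_Iio.1 hζε)
      gcongr
      rw [Real.norm_eq_abs, abs_div, abs_neg, abs_of_nonneg (sq_nonneg ‖ζ - u‖), div_eq_mul_inv]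
      have h4 : (‖ζ - u‖ ^ 2)⁻¹ ≤ 4 / δ ^ 2 := by
        rw [show 4 / δ ^ 2 = ((δ / 2) ^ 2)⁻¹ by field_simp; norm_num]
        gcongr
      have h5 : |(ζ - u).im| ≤ ‖ζ‖ := by simpa using Complex.abs_im_le_norm ζ
      gcongr
    · refine .of_forall fun ζ => Measurable.aestronglyMeasurable ?_
      have : Measurable fun u : ℝ => ζ - (u : ℂ) := by fun_prop
      exact ((Complex.measurable_im.comp this.inv).const_mul _).neg
  have h := hpeak.const_mul (-Real.pi)
  rw [neg_mul] at h
  refine h.congr fun ζ => ?_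
  rw [← intervalIntegral.integral_of_le (by norm_num), ← intervalIntegral.integral_const_mul]
  refine intervalIntegral.integral_congr fun u _ => ?_
  have := Real.pi_ne_zero
  simp only [smul_eq_mul]
  field_simp

/-! ### The singular integral along a curve tangent to the real axis -/

/-- Since u is real, |Im ζ| ≤ |ζ - u|, so both ζ and ζ - u are controlled by ζ - u; the constant
comes from the triangle inequality for u. -/
lemma le_norm_sub_of_sector {c : ℝ} (hc : 0 < c) {ζ : ℂ} (hζ : c * ‖ζ‖ ≤ |ζ.im|) (u : ℝ) :
    c / (1 + c) * |u| ≤ ‖ζ - u‖ := by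
  have h1 : c * ‖ζ‖ ≤ ‖ζ - u‖ := hζ.trans (by simpa using Complex.abs_im_le_norm (ζ - u))
  have h2 : |u| ≤ ‖ζ - u‖ + ‖ζ‖ := by
    have := norm_sub_norm_le (u : ℂ) ζ
    rw [norm_sub_rev, Complex.norm_real, Real.norm_eq_abs] at this
    linarith
  rw [div_mul_eq_mul_div, div_le_iff₀ (by positivity)]
  nlinarith

section

variable {γ : ℝ → ℂ} {C m : ℝ}

lemma exists_le_norm_sub_of_sector (hC : ∀ u : ℝ, |u| ≤ 1 / 2 → ‖γ u - u‖ ≤ C * u ^ 2) (hm : 0 < m)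
    (hγm : ∀ u : ℝ, |u| ≤ 1 / 2 → m * |u| ≤ ‖γ u‖) {c : ℝ} (hc : 0 < c) :
    ∃ c₂ > 0, ∀ᶠ ζ : ℂ in 𝓝 0, c * ‖ζ‖ ≤ |ζ.im| → ∀ u : ℝ, |u| ≤ 1 / 2 → c₂ * |u| ≤ ‖ζ - γ u‖ := by
  set c₁ : ℝ := c / (1 + c)
  have hc₁ : 0 < c₁ := by positivity
  -- Chosen with (|C| + 1)δ = c₁/2. For |u| ≤ δ the quadratic deviation from the tangent costs at
  -- most half of the sector bound; for |u| ≥ δ the curve is at distance at least mδ from 0, and ζ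
  -- is negligible.
  set δ : ℝ := c₁ / (2 * (|C| + 1))
  have hδ : 0 < δ := by positivity
  refine ⟨min (c₁ / 2) (m / 2), by positivity, ?_⟩
  filter_upwards [Metric.ball_mem_nhds (0 : ℂ) (show 0 < m * δ / 2 by positivity)] with ζ hζ hsec u hu
  rw [mem_ball_zero_iff] at hζ
  rcases le_total |u| δ with h | h
  · have h1 := le_norm_sub_of_sector hc hsec u
    have h2 := hC u hu
    have h3 : ‖ζ - u‖ ≤ ‖ζ - γ u‖ + ‖γ u - u‖ := norm_sub_le_norm_sub_add_norm_sub _ _ _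
    have h4 : C * u ^ 2 ≤ c₁ / 2 * |u| := by
      have h5 : (|C| + 1) * |u| ≤ c₁ / 2 := by
        calc (|C| + 1) * |u| ≤ (|C| + 1) * δ := by gcongr
          _ = c₁ / 2 := by simp only [δ]; field_simp
      calc C * u ^ 2 ≤ (|C| + 1) * |u| ^ 2 := by
            rw [sq_abs]
            have := le_abs_self C
            gcongr
            linarith
        _ = (|C| + 1) * |u| * |u| := by ring
        _ ≤ _ := by gcongr
    have h6 : min (c₁ / 2) (m / 2) * |u| ≤ c₁ / 2 * |u| := by gcongr; exact min_le_left _ _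
    have h7 : c₁ / 2 * |u| = c₁ * |u| - c₁ / 2 * |u| := by ring
    linarith
  · have h1 := hγm u hu
    have h2 : ‖γ u‖ ≤ ‖ζ - γ u‖ + ‖ζ‖ := by
      have := norm_sub_norm_le (γ u) ζ
      rw [norm_sub_rev] at this
      linarith
    have h3 : m * δ ≤ m * |u| := by gcongr
    have h6 : min (c₁ / 2) (m / 2) * |u| ≤ m / 2 * |u| := by gcongr; exact min_le_right _ _
    linarith

/-- The numerator is O(u²) and each denominator is at least a multiple of |u|, so the singularities
cancel. This is where the second-order contact of the curve with its tangent is used. -/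
lemma norm_inv_sub_inv_le {a b : ℝ} {z w v : ℂ} {u : ℝ} (hC : ‖w - v‖ ≤ C * u ^ 2)
    (ha : 0 < a) (hb : 0 < b) (hz : a * |u| ≤ ‖z - w‖) (hw : b * |u| ≤ ‖z - v‖) (hu : u ≠ 0) :
    ‖(z - w)⁻¹ - (z - v)⁻¹‖ ≤ C / (a * b) := by
  have hu' : 0 < |u| := abs_pos.2 hu
  have h1 : 0 < ‖z - w‖ := lt_of_lt_of_le (by positivity) hz
  have h2 : 0 < ‖z - v‖ := lt_of_lt_of_le (by positivity) hw
  rw [inv_sub_inv (norm_pos_iff.1 h1) (norm_pos_iff.1 h2), sub_sub_sub_cancel_left, norm_div, norm_mul,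
    div_le_div_iff₀ (by positivity) (by positivity)]
  have hC0 : 0 ≤ C := by
    have := (norm_nonneg _).trans hC
    exact nonneg_of_mul_nonneg_left this (by positivity)
  calc ‖w - v‖ * (a * b) ≤ C * u ^ 2 * (a * b) := by gcongr
    _ = C * ((a * |u|) * (b * |u|)) := by rw [← sq_abs u]; ring
    _ ≤ _ := by gcongr

/-- Compare with the tangent line. The difference of the kernels is bounded uniformly in the sector
and passes to the limit by dominated convergence; the line contributes the Poisson limit -πg(0). -/
lemma tendsto_integral_im_inv (hγ : Continuous γ)
    (hC : ∀ u : ℝ, |u| ≤ 1 / 2 → ‖γ u - u‖ ≤ C * u ^ 2) (hm : 0 < m)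
    (hγm : ∀ u : ℝ, |u| ≤ 1 / 2 → m * |u| ≤ ‖γ u‖) {g : ℝ → ℝ} (hg : Continuous g) {c : ℝ}
    (hc : 0 < c) :
    Tendsto (fun ζ : ℂ => ∫ u in (-(1 / 2) : ℝ)..(1 / 2), ((ζ - γ u)⁻¹).im * g u)
      (𝓝[{ζ | 0 < ζ.im ∧ c * ‖ζ‖ ≤ ζ.im}] 0)
      (𝓝 ((∫ u in (-(1 / 2) : ℝ)..(1 / 2), ((0 - γ u)⁻¹).im * g u) - Real.pi * g 0)) := by
  set l : Filter ℂ := 𝓝[{ζ | 0 < ζ.im ∧ c * ‖ζ‖ ≤ ζ.im}] 0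
  have hl : ∀ᶠ ζ : ℂ in l, 0 < ζ.im ∧ c * ‖ζ‖ ≤ ζ.im := self_mem_nhdsWithin
  have hl0 : Tendsto (fun ζ : ℂ => ζ) l (𝓝 0) := nhdsWithin_le_nhds
  obtain ⟨c₂, hc₂, hev⟩ := exists_le_norm_sub_of_sector hC hm hγm hc
  have hγ0 : γ 0 = 0 := by simpa using hC 0 (by norm_num)
  have hpoisson := (tendsto_integral_poisson hg).mono_left
    (show l ≤ _ from nhdsWithin_mono _ fun ζ hζ => hζ.1)
  have hIcc : ∀ {u : ℝ}, u ∈ Set.uIoc (-(1 / 2) : ℝ) (1 / 2) → |u| ≤ 1 / 2 := fun {u} hu => by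
    rw [uIoc_of_le (by norm_num)] at hu
    exact abs_le.2 ⟨hu.1.le, hu.2⟩
  have hdiff : Tendsto (fun ζ : ℂ => ∫ u in (-(1 / 2) : ℝ)..(1 / 2),
      ((ζ - γ u)⁻¹ - (ζ - u)⁻¹).im * g u) l
      (𝓝 (∫ u in (-(1 / 2) : ℝ)..(1 / 2), ((0 - γ u)⁻¹).im * g u)) := by
    refine intervalIntegral.tendsto_integral_filter_of_dominated_convergence
      (fun u => C / (c₂ * (c / (1 + c))) * |g u|) ?_ ?_ ?_ ?_
    · refine .of_forall fun ζ => Measurable.aestronglyMeasurable ?_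
      have h1 : Measurable fun u : ℝ => ζ - (u : ℂ) := by fun_prop
      have h2 : Measurable fun u : ℝ => ζ - γ u := measurable_const.sub hγ.measurable
      exact (Complex.measurable_im.comp (h2.inv.sub h1.inv)).mul hg.measurable
    · filter_upwards [hl, hl0.eventually hev] with ζ hζ hζ2
      have hsec : c * ‖ζ‖ ≤ |ζ.im| := hζ.2.trans (le_abs_self _)
      filter_upwards [compl_mem_ae_iff.2 (measure_singleton (0 : ℝ))] with u hu0 hu
      rw [norm_mul, Real.norm_eq_abs, Real.norm_eq_abs]
      gcongr
      exact (Complex.abs_im_le_norm _).trans (norm_inv_sub_inv_le (hC u (hIcc hu)) hc₂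
        (by positivity) (hζ2 hsec u (hIcc hu)) (le_norm_sub_of_sector hc hsec u) hu0)
    · exact (hg.abs.const_mul _).intervalIntegrable _ _
    · filter_upwards [compl_mem_ae_iff.2 (measure_singleton (0 : ℝ))] with u hu0 hu
      have hu0' : u ≠ 0 := hu0
      have h1 : (0 : ℂ) - γ u ≠ 0 := by
        have := hγm u (hIcc hu)
        rw [zero_sub, neg_ne_zero, ← norm_pos_iff]
        exact lt_of_lt_of_le (by positivity) this
      have h2 : (0 : ℂ) - u ≠ 0 := by simpa using hu0'
      have h3 : Tendsto (fun ζ : ℂ => ((ζ - γ u)⁻¹ - (ζ - u)⁻¹).im * g u) l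
          (𝓝 (((0 - γ u)⁻¹ - (0 - (u : ℂ))⁻¹).im * g u)) :=
        ((Complex.continuous_im.tendsto _).comp (((hl0.sub_const _).inv₀ h1).sub
          ((hl0.sub_const _).inv₀ h2))).mul_const _
      convert h3 using 3
      -- At ζ = 0 the kernel of the line is 1/(0 - u), which is real, so the limit involves the
      -- kernel of the curve alone.
      rw [sub_im, inv_sub_ofReal_im]
      simp
  refine (hdiff.add hpoisson).congr' ?_
  filter_upwards [hl, hl0.eventually hev] with ζ hζ hζ2
  have hsec : c * ‖ζ‖ ≤ |ζ.im| := hζ.2.trans (le_abs_self _)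
  have hζ0 : ζ ≠ 0 := by rintro rfl; simp at hζ
  have hne : ∀ u : ℝ, |u| ≤ 1 / 2 → ζ - γ u ≠ 0 := by
    intro u hu h
    have := hζ2 hsec u hu
    rw [h, norm_zero] at this
    have hu0 : u = 0 := abs_nonpos_iff.1 (nonpos_of_mul_nonpos_right this hc₂)
    rw [hu0, hγ0, sub_zero] at h
    exact hζ0 h
  have hne2 : ∀ u : ℝ, ζ - u ≠ 0 := by
    intro u h
    have := congrArg Complex.im h
    simp at this
    exact hζ.1.ne' this
  have hi1 : ContinuousOn (fun u : ℝ => (ζ - γ u)⁻¹) (Icc (-(1 / 2)) (1 / 2)) :=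
    ContinuousOn.inv₀ (by fun_prop) fun u hu => hne u (abs_le.2 hu)
  have hi2 : Continuous (fun u : ℝ => (ζ - (u : ℂ))⁻¹) := Continuous.inv₀ (by fun_prop) hne2
  rw [← intervalIntegral.integral_add]
  · refine intervalIntegral.integral_congr fun u _ => ?_
    simp only [sub_im]
    ring
  · refine ContinuousOn.intervalIntegrable_of_Icc (by norm_num) ?_
    exact (Complex.continuous_im.comp_continuousOn (hi1.sub hi2.continuousOn)).mul hg.continuousOn
  · exact ((Complex.continuous_im.comp hi2).mul hg).intervalIntegrable _ _

/-- Complex conjugation exchanges the half planes and reverses the sign of the kernel, while the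
bounds on the curve are preserved. -/
lemma tendsto_integral_im_inv_neg (hγ : Continuous γ)
    (hC : ∀ u : ℝ, |u| ≤ 1 / 2 → ‖γ u - u‖ ≤ C * u ^ 2) (hm : 0 < m)
    (hγm : ∀ u : ℝ, |u| ≤ 1 / 2 → m * |u| ≤ ‖γ u‖) {g : ℝ → ℝ} (hg : Continuous g) {c : ℝ}
    (hc : 0 < c) :
    Tendsto (fun ζ : ℂ => ∫ u in (-(1 / 2) : ℝ)..(1 / 2), ((ζ - γ u)⁻¹).im * g u)
      (𝓝[{ζ | ζ.im < 0 ∧ c * ‖ζ‖ ≤ -ζ.im}] 0)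
      (𝓝 ((∫ u in (-(1 / 2) : ℝ)..(1 / 2), ((0 - γ u)⁻¹).im * g u) + Real.pi * g 0)) := by
  have hconj : ∀ (ζ : ℂ) (u : ℝ), (((starRingEnd ℂ) ζ - (starRingEnd ℂ) (γ u))⁻¹).im * g u =
      -(((ζ - γ u)⁻¹).im * g u) := fun ζ u => by
    rw [← map_sub, ← map_inv₀, Complex.conj_im, neg_mul]
  have h := tendsto_integral_im_inv (γ := fun u => (starRingEnd ℂ) (γ u)) (C := C) (m := m)
    (Complex.continuous_conj.comp hγ) (fun u hu => by
      rw [← Complex.conj_ofReal u, ← map_sub, Complex.norm_conj]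
      exact hC u hu) hm (fun u hu => by
      rw [Complex.norm_conj]
      exact hγm u hu) hg hc
  have ht : Tendsto (fun ζ : ℂ => (starRingEnd ℂ) ζ) (𝓝[{ζ | ζ.im < 0 ∧ c * ‖ζ‖ ≤ -ζ.im}] 0)
      (𝓝[{ζ | 0 < ζ.im ∧ c * ‖ζ‖ ≤ ζ.im}] 0) := by
    refine tendsto_nhdsWithin_iff.2 ⟨?_, ?_⟩
    · exact (Complex.continuous_conj.tendsto' 0 0 (by simp)).mono_left nhdsWithin_le_nhds
    · filter_upwards [self_mem_nhdsWithin] with ζ hζ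
      have h1 := hζ.1
      have h2 := hζ.2
      constructor
      · rw [Complex.conj_im]; linarith
      · rw [Complex.conj_im, Complex.norm_conj]; exact h2
  have h2 := (h.comp ht).neg
  have h0 := hconj 0
  rw [map_zero] at h0
  simp only [Function.comp_def, hconj, h0, intervalIntegral.integral_neg, neg_neg] at h2
  convert h2 using 2
  ring

/-- On the tangent the kernel at ζ = 0 has no imaginary part, so subtracting it changes nothing and
the comparison bound shows that the kernel of the curve is bounded almost everywhere. -/
lemma intervalIntegrable_im_inv (hγ : Continuous γ)
    (hC : ∀ u : ℝ, |u| ≤ 1 / 2 → ‖γ u - u‖ ≤ C * u ^ 2) (hm : 0 < m)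
    (hγm : ∀ u : ℝ, |u| ≤ 1 / 2 → m * |u| ≤ ‖γ u‖) {g : ℝ → ℝ} (hg : Continuous g) :
    IntervalIntegrable (fun u : ℝ => ((0 - γ u)⁻¹).im * g u) volume (-(1 / 2)) (1 / 2) := by
  refine (((hg.abs.const_mul (C / (m * 1))).intervalIntegrable (-(1 / 2)) (1 / 2))).mono_fun
    (Measurable.aestronglyMeasurable ?_) ?_
  · exact (Complex.measurable_im.comp (measurable_const.sub hγ.measurable).inv).mul hg.measurable
  · rw [Filter.EventuallyLE, ae_restrict_iff' measurableSet_uIoc]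
    filter_upwards [compl_mem_ae_iff.2 (measure_singleton (0 : ℝ))] with u hu0 hu
    rw [uIoc_of_le (by norm_num)] at hu
    have hu' : |u| ≤ 1 / 2 := abs_le.2 ⟨hu.1.le, hu.2⟩
    refine le_trans ?_ (le_abs_self _)
    rw [norm_mul, Real.norm_eq_abs, Real.norm_eq_abs]
    gcongr
    have h1 := norm_inv_sub_inv_le (z := 0) (hC u hu') hm one_pos
      (by simpa using hγm u hu') (by simp) hu0
    refine le_trans ?_ h1
    have h2 : ((0 - γ u)⁻¹).im = ((0 - γ u)⁻¹ - (0 - (u : ℂ))⁻¹).im := by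
      rw [sub_im, inv_sub_ofReal_im]
      simp
    rw [h2]
    exact Complex.abs_im_le_norm _

end

/-! ### Normalised curves -/

/-- The curve moved so that it passes through the origin at time `0` with velocity `1`. -/
noncomputable def normalisedCurve (γ : ℝ → ℂ) (s u : ℝ) : ℂ := (γ (s + u) - γ s) / deriv γ s

lemma continuous_normalisedCurve {γ : ℝ → ℂ} (hγ : Continuous γ) (s : ℝ) :
    Continuous (normalisedCurve γ s) := by
  unfold normalisedCurve
  fun_prop

/-- A second-order Taylor estimate, obtained by applying the mean value inequality first to γ' and
then to γ minus its linear part. -/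
lemma exists_norm_normalisedCurve_sub_le {γ : ℝ → ℂ} (hγ : ContDiff ℝ 2 γ) {s : ℝ}
    (hne : deriv γ s ≠ 0) :
    ∃ C, ∀ u : ℝ, |u| ≤ 1 / 2 → ‖normalisedCurve γ s u - u‖ ≤ C * u ^ 2 := by
  have hd : ContDiff ℝ 1 (deriv γ) := hγ.deriv'
  obtain ⟨K, hK⟩ := (isCompact_Icc (a := s - 1 / 2) (b := s + 1 / 2)).exists_bound_of_continuousOn
    (hd.continuous_deriv le_rfl).continuousOn
  have h1 : ∀ x ∈ Icc (s - 1 / 2) (s + 1 / 2), ‖deriv γ x - deriv γ s‖ ≤ K * ‖x - s‖ := fun x hx =>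
    (convex_Icc _ _).norm_image_sub_le_of_norm_deriv_le
      (fun y _ => (hd.differentiable one_ne_zero).differentiableAt) hK
      ⟨by linarith, by linarith⟩ hx
  have hK0 : 0 ≤ K := (norm_nonneg _).trans (hK s ⟨by linarith, by linarith⟩)
  refine ⟨K / ‖deriv γ s‖, fun u hu => ?_⟩
  have h2 : ‖(γ (s + u) - (s + u : ℝ) • deriv γ s) - (γ s - s • deriv γ s)‖ ≤
      K * |u| * ‖(s + u) - s‖ := by
    refine (convex_uIcc s (s + u)).norm_image_sub_le_of_norm_hasDerivWithin_le
      (f := fun x => γ x - x • deriv γ s) (f' := fun x => deriv γ x - deriv γ s)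
      (fun x _ => ?_) (fun x hx => ?_) left_mem_uIcc right_mem_uIcc
    · have h3 := ((hγ.differentiable two_ne_zero) x).hasDerivAt.sub
        ((hasDerivAt_id x).smul_const (deriv γ s))
      rw [one_smul] at h3
      exact h3.hasDerivWithinAt
    · have h4 : |x - s| ≤ |u| := by
        have := abs_sub_left_of_mem_uIcc hx
        simpa using this
      have h5 := abs_le.1 (h4.trans hu)
      refine (h1 x ⟨by linarith, by linarith⟩).trans ?_
      rw [Real.norm_eq_abs]
      gcongr
  have h6 : normalisedCurve γ s u - u =
      ((γ (s + u) - (s + u : ℝ) • deriv γ s) - (γ s - s • deriv γ s)) / deriv γ s := by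
    rw [normalisedCurve, eq_div_iff hne, sub_mul, div_mul_cancel₀ _ hne]
    simp only [real_smul]
    push_cast
    ring
  rw [h6, norm_div, div_mul_eq_mul_div, ← sq_abs]
  gcongr
  simpa [sq, mul_assoc] using h2

lemma exists_le_norm_normalisedCurve {γ : ℝ → ℂ} (hγ : ContDiff ℝ 1 γ)
    (hper : Function.Periodic γ 1) (hinj : InjOn γ (Ico 0 1)) (hne : ∀ t, deriv γ t ≠ 0) (s : ℝ) :
    ∃ m > 0, ∀ u : ℝ, |u| ≤ 1 / 2 → m * |u| ≤ ‖normalisedCurve γ s u‖ := by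
  obtain ⟨m, hm, h⟩ := exists_chord_arc hγ hper hinj hne
  have hs : 0 < ‖deriv γ s‖ := norm_pos_iff.2 (hne s)
  refine ⟨m / ‖deriv γ s‖, by positivity, fun u hu => ?_⟩
  rw [normalisedCurve, norm_div, div_mul_eq_mul_div]
  gcongr
  exact h s u hu

lemma Function.Periodic.integral_eq_symm {F : ℝ → ℝ} (hF : Function.Periodic F 1) (s : ℝ) :
    ∫ t in (0 : ℝ)..1, F t = ∫ u in (-(1 / 2) : ℝ)..(1 / 2), F (s + u) := by
  have h := hF.intervalIntegral_add_eq 0 (s - 1 / 2)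
  rw [zero_add] at h
  rw [h, intervalIntegral.integral_comp_add_left]
  congr 1
  ring

lemma Function.Periodic.intervalIntegrable_of_symm {F : ℝ → ℝ} (hF : Function.Periodic F 1) {s : ℝ}
    (h : IntervalIntegrable (fun u => F (s + u)) volume (-(1 / 2)) (1 / 2)) :
    IntervalIntegrable F volume 0 1 := by
  have h2 := h.comp_sub_right s
  simp only [add_sub_cancel] at h2
  refine hF.intervalIntegrable one_ne_zero (t := s - 1 / 2) ?_ 0 1
  convert h2 using 1
  · ring
  · ring

/-- The coordinate in which the curve passes through the origin at time `0` with velocity `1`. -/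
noncomputable def tangentCoord (γ : ℝ → ℂ) (s : ℝ) (z : ℂ) : ℂ := (z - γ s) / deriv γ s

lemma continuous_tangentCoord (γ : ℝ → ℂ) (s : ℝ) : Continuous (tangentCoord γ s) := by
  unfold tangentCoord
  fun_prop

lemma tangentCoord_self (γ : ℝ → ℂ) (s : ℝ) : tangentCoord γ s (γ s) = 0 := by
  simp [tangentCoord]

lemma tangentCoord_sub {γ : ℝ → ℂ} {s : ℝ} (z : ℂ) (u : ℝ) :
    tangentCoord γ s z - normalisedCurve γ s u = (z - γ (s + u)) / deriv γ s := by
  rw [tangentCoord, normalisedCurve, ← sub_div]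
  congr 1
  ring

/-- The normal derivative of the logarithmic kernel in tangential coordinates. -/
lemma normal_div_re (γ : ℝ → ℂ) (s : ℝ) (z : ℂ) (u : ℝ) :
    (-I * deriv γ s / ‖deriv γ s‖ / (z - γ (s + u))).re =
      ‖deriv γ s‖⁻¹ * ((tangentCoord γ s z - normalisedCurve γ s u)⁻¹).im := by
  rw [tangentCoord_sub, inv_div]
  have h : -I * deriv γ s / ‖deriv γ s‖ / (z - γ (s + u)) =
      ((‖deriv γ s‖⁻¹ : ℝ) : ℂ) * (-I * (deriv γ s / (z - γ (s + u)))) := by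
    push_cast
    ring
  rw [h, Complex.re_ofReal_mul]
  simp

/-- A regular simple closed curve of class `C²`, parametrized with period `1`. -/
structure IsRegularLoop (γ : ℝ → ℂ) : Prop where
  contDiff : ContDiff ℝ 2 γ
  periodic : Function.Periodic γ 1
  injOn : InjOn γ (Ico 0 1)
  deriv_ne_zero : ∀ t, deriv γ t ≠ 0

/-- The part of the plane seen from `γ s` at an angle to the left of the tangent. -/
def leftSector (γ : ℝ → ℂ) (s c : ℝ) : Set ℂ :=
  {z | 0 < (tangentCoord γ s z).im ∧ c * ‖tangentCoord γ s z‖ ≤ (tangentCoord γ s z).im}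

/-- The part of the plane seen from `γ s` at an angle to the right of the tangent. -/
def rightSector (γ : ℝ → ℂ) (s c : ℝ) : Set ℂ :=
  {z | (tangentCoord γ s z).im < 0 ∧ c * ‖tangentCoord γ s z‖ ≤ -(tangentCoord γ s z).im}

namespace IsRegularLoop

variable {γ : ℝ → ℂ}

lemma contDiff_one (h : IsRegularLoop γ) : ContDiff ℝ 1 γ := h.contDiff.of_le (by norm_num)

lemma continuous (h : IsRegularLoop γ) : Continuous γ := h.contDiff.continuous

lemma exists_normalisedCurve_bounds (h : IsRegularLoop γ) (s : ℝ) : ∃ C m : ℝ, 0 < m ∧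
    (∀ u : ℝ, |u| ≤ 1 / 2 → ‖normalisedCurve γ s u - u‖ ≤ C * u ^ 2) ∧
    ∀ u : ℝ, |u| ≤ 1 / 2 → m * |u| ≤ ‖normalisedCurve γ s u‖ := by
  obtain ⟨C, hC⟩ := exists_norm_normalisedCurve_sub_le h.contDiff (h.deriv_ne_zero s)
  obtain ⟨m, hm, hγm⟩ := exists_le_norm_normalisedCurve h.contDiff_one h.periodic h.injOn
    h.deriv_ne_zero s
  exact ⟨C, m, hm, hC, hγm⟩

lemma integral_normal_div_eq (h : IsRegularLoop γ) {g : ℝ → ℝ} (hgper : Function.Periodic g 1)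
    (s : ℝ) (z : ℂ) :
    ∫ t in (0 : ℝ)..1, (-I * deriv γ s / ‖deriv γ s‖ / (z - γ t)).re * g t =
      ‖deriv γ s‖⁻¹ * ∫ u in (-(1 / 2) : ℝ)..(1 / 2),
        ((tangentCoord γ s z - normalisedCurve γ s u)⁻¹).im * g (s + u) := by
  have hF : Function.Periodic (fun t => (-I * deriv γ s / ‖deriv γ s‖ / (z - γ t)).re * g t) 1 :=
    fun t => by simp only [h.periodic t, hgper t]
  rw [hF.integral_eq_symm s, ← intervalIntegral.integral_const_mul]
  refine intervalIntegral.integral_congr fun u _ => ?_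
  simp only [normal_div_re]
  ring

/-- The normal derivative of the logarithmic kernel is integrable along the curve. -/
lemma intervalIntegrable_normal_div (h : IsRegularLoop γ) {g : ℝ → ℝ} (hg : Continuous g)
    (hgper : Function.Periodic g 1) (s : ℝ) :
    IntervalIntegrable (fun t => (-I * deriv γ s / ‖deriv γ s‖ / (γ s - γ t)).re * g t)
      volume 0 1 := by
  obtain ⟨C, m, hm, hC, hγm⟩ := h.exists_normalisedCurve_bounds s
  have hF : Function.Periodic (fun t => (-I * deriv γ s / ‖deriv γ s‖ / (γ s - γ t)).re * g t) 1 :=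
    fun t => by simp only [h.periodic t, hgper t]
  refine hF.intervalIntegrable_of_symm (s := s) ?_
  have hi := (intervalIntegrable_im_inv (continuous_normalisedCurve h.continuous s) hC hm hγm
    (g := fun u => g (s + u)) (by fun_prop)).const_mul ‖deriv γ s‖⁻¹
  simpa only [normal_div_re, tangentCoord_self, mul_assoc] using hi

/-- The jump relation for the logarithmic kernel, on the left of the curve. -/
lemma tendsto_integral_normal_div_left (h : IsRegularLoop γ) {g : ℝ → ℝ} (hg : Continuous g)
    (hgper : Function.Periodic g 1) (s : ℝ) {c : ℝ} (hc : 0 < c) :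
    Tendsto (fun z => ∫ t in (0 : ℝ)..1, (-I * deriv γ s / ‖deriv γ s‖ / (z - γ t)).re * g t)
      (𝓝[leftSector γ s c] (γ s))
      (𝓝 ((∫ t in (0 : ℝ)..1, (-I * deriv γ s / ‖deriv γ s‖ / (γ s - γ t)).re * g t) -
        Real.pi * (‖deriv γ s‖⁻¹ * g s))) := by
  obtain ⟨C, m, hm, hC, hγm⟩ := h.exists_normalisedCurve_bounds s
  have hζ : Tendsto (tangentCoord γ s) (𝓝[leftSector γ s c] (γ s))
      (𝓝[{ζ | 0 < ζ.im ∧ c * ‖ζ‖ ≤ ζ.im}] 0) :=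
    tendsto_nhdsWithin_iff.2 ⟨((continuous_tangentCoord γ s).tendsto' _ _
      (tangentCoord_self γ s)).mono_left nhdsWithin_le_nhds, self_mem_nhdsWithin⟩
  have ht := ((tendsto_integral_im_inv (continuous_normalisedCurve h.continuous s) hC hm hγm
    (g := fun u => g (s + u)) (by fun_prop) hc).comp hζ).const_mul ‖deriv γ s‖⁻¹
  simp only [h.integral_normal_div_eq hgper, tangentCoord_self]
  convert ht using 2
  · rfl
  · rw [add_zero]
    ring

/-- The jump relation for the logarithmic kernel, on the right of the curve. -/
lemma tendsto_integral_normal_div_right (h : IsRegularLoop γ) {g : ℝ → ℝ} (hg : Continuous g)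
    (hgper : Function.Periodic g 1) (s : ℝ) {c : ℝ} (hc : 0 < c) :
    Tendsto (fun z => ∫ t in (0 : ℝ)..1, (-I * deriv γ s / ‖deriv γ s‖ / (z - γ t)).re * g t)
      (𝓝[rightSector γ s c] (γ s))
      (𝓝 ((∫ t in (0 : ℝ)..1, (-I * deriv γ s / ‖deriv γ s‖ / (γ s - γ t)).re * g t) +
        Real.pi * (‖deriv γ s‖⁻¹ * g s))) := by
  obtain ⟨C, m, hm, hC, hγm⟩ := h.exists_normalisedCurve_bounds s
  have hζ : Tendsto (tangentCoord γ s) (𝓝[rightSector γ s c] (γ s))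
      (𝓝[{ζ | ζ.im < 0 ∧ c * ‖ζ‖ ≤ -ζ.im}] 0) :=
    tendsto_nhdsWithin_iff.2 ⟨((continuous_tangentCoord γ s).tendsto' _ _
      (tangentCoord_self γ s)).mono_left nhdsWithin_le_nhds, self_mem_nhdsWithin⟩
  have ht := ((tendsto_integral_im_inv_neg (continuous_normalisedCurve h.continuous s) hC hm hγm
    (g := fun u => g (s + u)) (by fun_prop) hc).comp hζ).const_mul ‖deriv γ s‖⁻¹
  simp only [h.integral_normal_div_eq hgper, tangentCoord_self]
  convert ht using 2
  · rfl
  · rw [add_zero]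
    ring

/-- Near its vertex, a sector does not meet the curve. -/
lemma eventually_notMem_range (h : IsRegularLoop γ) (s : ℝ) {c : ℝ} (hc : 0 < c) :
    ∀ᶠ ζ : ℂ in 𝓝 0, ζ ≠ 0 → c * ‖ζ‖ ≤ |ζ.im| → γ s + deriv γ s * ζ ∉ range γ := by
  obtain ⟨C, m, hm, hC, hγm⟩ := h.exists_normalisedCurve_bounds s
  obtain ⟨c₂, hc₂, hev⟩ := exists_le_norm_sub_of_sector hC hm hγm hc
  filter_upwards [hev] with ζ hζ h0 hsec
  rintro ⟨t, ht⟩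
  -- Reducing the parameter by the nearest integer gives |u| ≤ 1/2, the range in which the bounds on
  -- the normalised curve hold.
  set n : ℤ := round (t - s)
  set u : ℝ := t - s - n
  have hγu : γ (s + u) = γ s + deriv γ s * ζ := by
    have := h.periodic.sub_int_mul_eq (x := t) n
    rw [mul_one] at this
    rw [← ht, ← this]
    congr 1
    ring
  have hnu : normalisedCurve γ s u = ζ := by
    rw [normalisedCurve, hγu, add_sub_cancel_left, mul_div_cancel_left₀ _ (h.deriv_ne_zero s)]
  have hu : |u| ≤ 1 / 2 := abs_sub_round (t - s)
  have h1 := hζ hsec u hu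
  rw [hnu, sub_self, norm_zero] at h1
  have hu0 : u = 0 := abs_nonpos_iff.1 (nonpos_of_mul_nonpos_right h1 hc₂)
  rw [hu0] at hnu
  exact h0 (by rw [← hnu]; simp [normalisedCurve])

/-- Points that approach the curve nontangentially lie in a sector. -/
lemma eventually_le_abs_im (h : IsRegularLoop γ) (s : ℝ) {c : ℝ} (hc : 0 < c) :
    ∀ᶠ z : ℂ in 𝓝 (γ s), (∀ t, c * ‖z - γ s‖ ≤ ‖z - γ t‖) →
      c / 2 * ‖tangentCoord γ s z‖ ≤ |(tangentCoord γ s z).im| := by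
  obtain ⟨C, m, hm, hC, hγm⟩ := h.exists_normalisedCurve_bounds s
  have hζ : Tendsto (fun z => ‖tangentCoord γ s z‖) (𝓝 (γ s)) (𝓝 0) :=
    (continuous_tangentCoord γ s).norm.tendsto' _ _ (by simp [tangentCoord_self])
  have h1 := hζ.eventually (Iio_mem_nhds (show (0 : ℝ) < 1 / 2 by norm_num))
  have h2 := (hζ.const_mul C).eventually (Iio_mem_nhds (show C * 0 < c / 2 by simpa using hc))
  filter_upwards [h1, h2] with z hz1 hz2 hz
  set ζ := tangentCoord γ s z
  have hd : 0 < ‖deriv γ s‖ := norm_pos_iff.2 (h.deriv_ne_zero s)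
  have hu : |ζ.re| ≤ 1 / 2 := (Complex.abs_re_le_norm ζ).trans (mem_Iio.1 hz1).le
  -- The nontangential condition is tested at the curve point with parameter s + Re ζ, which lies
  -- within |Im ζ| + C(Re ζ)² of ζ in these coordinates. Near the vertex the quadratic term absorbs
  -- half of c‖ζ‖.
  have h3 : c * ‖ζ‖ ≤ ‖ζ - normalisedCurve γ s ζ.re‖ := by
    rw [tangentCoord_sub, norm_div]
    simp only [ζ, tangentCoord, norm_div]
    rw [← mul_div_assoc]
    gcongr
    exact hz _
  have h4 : ‖ζ - normalisedCurve γ s ζ.re‖ ≤ |ζ.im| + C * ζ.re ^ 2 := by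
    have h5 := norm_sub_le_norm_sub_add_norm_sub ζ (ζ.re : ℂ) (normalisedCurve γ s ζ.re)
    have h6 : ζ - (ζ.re : ℂ) = ζ.im * I := by
      apply Complex.ext <;> simp
    have h7 : ‖ζ - (ζ.re : ℂ)‖ = |ζ.im| := by simp [h6]
    rw [h7, norm_sub_rev (ζ.re : ℂ)] at h5
    linarith [hC ζ.re hu]
  have h8 : C * ζ.re ^ 2 ≤ c / 2 * ‖ζ‖ := by
    have hC0 : 0 ≤ C := by
      have := (norm_nonneg _).trans (hC (1 / 2) (by norm_num [abs_of_pos]))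
      norm_num at this
      exact this
    calc C * ζ.re ^ 2 ≤ C * ‖ζ‖ ^ 2 := by
          rw [← sq_abs]
          gcongr
          exact Complex.abs_re_le_norm ζ
      _ = C * ‖ζ‖ * ‖ζ‖ := by ring
      _ ≤ _ := by gcongr
  have h9 : c * ‖ζ‖ = c / 2 * ‖ζ‖ + c / 2 * ‖ζ‖ := by ring
  linarith

end IsRegularLoop

/-! ### The two sides of a regular loop -/

/-- Otherwise the interior of A and the complement of its closure would separate t. -/
lemma IsPreconnected.inter_frontier_nonempty {X : Type*} [TopologicalSpace X] {t A : Set X}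
    (ht : IsPreconnected t) (h1 : (t ∩ A).Nonempty) (h2 : (t ∩ Aᶜ).Nonempty) :
    (t ∩ frontier A).Nonempty := by
  by_contra hne
  rw [not_nonempty_iff_eq_empty, eq_empty_iff_forall_notMem] at hne
  have key : ∀ x ∈ t, x ∈ interior A ∨ x ∈ (closure A)ᶜ := fun x hx => by
    by_contra! hcon
    exact hne x ⟨hx, not_notMem.1 hcon.2, hcon.1⟩
  obtain ⟨x, hx, hxA⟩ := h1
  obtain ⟨y, hy, hyA⟩ := h2
  obtain ⟨w, -, hw1, hw2⟩ := ht _ _ isOpen_interior isClosed_closure.isOpen_compl key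
    ⟨x, hx, (key x hx).resolve_right fun hc => hc (subset_closure hxA)⟩
    ⟨y, hy, (key y hy).resolve_left fun hc => hyA (interior_subset hc)⟩
  exact hw2 (subset_closure (interior_subset hw1))

lemma convex_sector (r c : ℝ) (hc : 0 ≤ c) :
    Convex ℝ {ζ : ℂ | ‖ζ‖ < r ∧ 0 < ζ.im ∧ c * ‖ζ‖ ≤ ζ.im} := by
  have h1 : Convex ℝ {ζ : ℂ | c * ‖ζ‖ ≤ ζ.im} := by
    intro x hx y hy a b ha hb _
    simp only [mem_ofPred_eq] at hx hy ⊢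
    have h2 : ‖a • x + b • y‖ ≤ a * ‖x‖ + b * ‖y‖ := by
      refine (norm_add_le _ _).trans ?_
      rw [norm_smul, norm_smul, Real.norm_of_nonneg ha, Real.norm_of_nonneg hb]
    have h3 : (a • x + b • y).im = a * x.im + b * y.im := by simp
    rw [h3]
    nlinarith [mul_le_mul_of_nonneg_left h2 hc, mul_le_mul_of_nonneg_left hx ha,
      mul_le_mul_of_nonneg_left hy hb]
  have h2 : Convex ℝ {ζ : ℂ | ‖ζ‖ < r} := by
    simpa [Metric.ball, dist_zero_right] using convex_ball (0 : ℂ) r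
  exact h2.inter ((convex_halfSpace_im_gt 0).inter h1)

namespace IsRegularLoop

variable {γ : ℝ → ℂ}

/-- Near its vertex, the right sector lies in the set bounded by the curve, and the left one in its
exterior, if that is the case along the normal. -/
lemma eventually_mem_of_sector (h : IsRegularLoop γ) {D : Set ℂ} (hD : frontier D = range γ)
    {s : ℝ} (hin : ∀ᶠ r : ℝ in 𝓝[>] 0, γ s + r * (-I * deriv γ s / ‖deriv γ s‖) ∈ D ∧
      γ s - r * (-I * deriv γ s / ‖deriv γ s‖) ∉ closure D) {c : ℝ} (hc : 0 < c) :
    (∀ᶠ z in 𝓝 (γ s), z ∈ rightSector γ s c → z ∈ D) ∧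
      ∀ᶠ z in 𝓝 (γ s), z ∈ leftSector γ s c → z ∉ closure D := by
  have hd : 0 < ‖deriv γ s‖ := norm_pos_iff.2 (h.deriv_ne_zero s)
  -- With aperture at most 1 the sector contains the normal direction, where the imaginary part
  -- equals the norm.
  set c' : ℝ := min c 1
  have hc' : 0 < c' := by positivity
  obtain ⟨r, hr, hball⟩ := Metric.eventually_nhds_iff_ball.1 (h.eventually_notMem_range s hc')
  have hsub : ∀ A : Set ℂ, IsPreconnected A → (∀ ζ ∈ A, ‖ζ‖ < r ∧ ζ ≠ 0 ∧ c' * ‖ζ‖ ≤ |ζ.im|) →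
      IsPreconnected ((fun ζ => γ s + deriv γ s * ζ) '' A) ∧
        (fun ζ => γ s + deriv γ s * ζ) '' A ∩ frontier D = ∅ := by
    refine fun A hA hAr => ⟨hA.image _ (by fun_prop), ?_⟩
    rw [eq_empty_iff_forall_notMem]
    rintro _ ⟨⟨ζ, hζ, rfl⟩, hf⟩
    obtain ⟨h1, h2, h3⟩ := hAr ζ hζ
    exact hball ζ (by simpa using h1) h2 h3 (hD ▸ hf)
  have hconv := convex_sector r c' hc'.le
  obtain ⟨hL1, hL2⟩ := hsub _ hconv.isPreconnected fun ζ hζ =>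
    ⟨hζ.1, by rintro rfl; simpa using hζ.2.1, hζ.2.2.trans (le_abs_self _)⟩
  obtain ⟨hR1, hR2⟩ := hsub _ (hconv.neg).isPreconnected fun ζ hζ => by
    rw [Set.mem_neg] at hζ
    obtain ⟨h1, h2, h3⟩ := hζ
    rw [norm_neg] at h1 h3
    exact ⟨h1, by rintro rfl; simp at h2, h3.trans ((le_abs_self _).trans (by simp))⟩
  -- A test point on each side of the curve, along the normal. Each truncated sector is connected
  -- and misses the frontier, so it lies on the same side as its test point.
  obtain ⟨q, ⟨hq1, hq2⟩, hq0, hqr⟩ := (hin.and (Ioo_mem_nhdsGT (mul_pos hr hd))).exists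
  have hnorm : ∀ σ : ℝ, deriv γ s * (σ * (q / ‖deriv γ s‖) * I) =
      -(σ * (q * (-I * deriv γ s / ‖deriv γ s‖))) := fun σ => by ring
  have hqd : q / ‖deriv γ s‖ < r := (div_lt_iff₀ hd).2 hqr
  have hqd0 : 0 < q / ‖deriv γ s‖ := by positivity
  have hmemL : ((q / ‖deriv γ s‖ : ℝ) : ℂ) * I ∈
      {ζ : ℂ | ‖ζ‖ < r ∧ 0 < ζ.im ∧ c' * ‖ζ‖ ≤ ζ.im} := by
    have h1 : ‖((q / ‖deriv γ s‖ : ℝ) : ℂ) * I‖ = q / ‖deriv γ s‖ := by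
      rw [norm_mul, Complex.norm_I, mul_one, Complex.norm_real, Real.norm_of_nonneg hqd0.le]
    have h2 : (((q / ‖deriv γ s‖ : ℝ) : ℂ) * I).im = q / ‖deriv γ s‖ := by
      rw [Complex.im_ofReal_mul, Complex.I_im, mul_one]
    refine ⟨by rw [h1]; exact hqd, by rw [h2]; exact hqd0, ?_⟩
    rw [h1, h2]
    exact mul_le_of_le_one_left hqd0.le (min_le_right _ _)
  have hζ : Tendsto (fun z => ‖tangentCoord γ s z‖) (𝓝 (γ s)) (𝓝 0) :=
    (continuous_tangentCoord γ s).norm.tendsto' _ _ (by simp [tangentCoord_self])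
  have hback : ∀ z, γ s + deriv γ s * tangentCoord γ s z = z := fun z => by
    rw [tangentCoord, mul_div_cancel₀ _ (h.deriv_ne_zero s)]
    ring
  have hcc : ∀ x : ℝ, 0 ≤ x → c' * x ≤ c * x := fun x hx => by gcongr; exact min_le_left _ _
  constructor
  · filter_upwards [hζ.eventually (Iio_mem_nhds hr)] with z hzr hz
    by_contra hzD
    refine absurd hR2 (nonempty_iff_ne_empty.1 (hR1.inter_frontier_nonempty ?_ ?_))
    · refine ⟨_, ⟨-(((q / ‖deriv γ s‖ : ℝ) : ℂ) * I), Set.neg_mem_neg.2 hmemL, rfl⟩, ?_⟩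
      have := hnorm (-1)
      push_cast at this ⊢
      convert hq1 using 1
      linear_combination this
    · refine ⟨z, ⟨tangentCoord γ s z, ?_, hback z⟩, hzD⟩
      rw [Set.mem_neg]
      refine ⟨by simpa using hzr, by simpa using hz.1, ?_⟩
      rw [norm_neg, Complex.neg_im]
      exact (hcc _ (norm_nonneg _)).trans hz.2
  · filter_upwards [hζ.eventually (Iio_mem_nhds hr)] with z hzr hz hzD
    have hne := hL1.inter_frontier_nonempty (A := closure D)
      ⟨z, ⟨tangentCoord γ s z, ⟨hzr, hz.1, (hcc _ (norm_nonneg _)).trans hz.2⟩, hback z⟩, hzD⟩ ?_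
    · obtain ⟨w, hw1, hw2⟩ := hne
      exact (eq_empty_iff_forall_notMem.1 hL2 w) ⟨hw1, frontier_closure_subset hw2⟩
    · refine ⟨_, ⟨((q / ‖deriv γ s‖ : ℝ) : ℂ) * I, hmemL, rfl⟩, ?_⟩
      have := hnorm 1
      push_cast at this ⊢
      convert hq2 using 2
      linear_combination this

end IsRegularLoop

lemma IsCompact.eventually_forall_sub_mem {K O : Set ℂ} (hK : IsCompact K) (hO : IsOpen O) {z : ℂ}
    (hz : ∀ w ∈ K, z - w ∈ O) : ∀ᶠ x in 𝓝 z, ∀ w ∈ K, x - w ∈ O := by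
  refine hK.eventually_forall_of_forall_eventually fun w hw => ?_
  have h1 : ContinuousAt (fun p : ℂ × ℂ => p.1 - p.2) (z, w) := by fun_prop
  exact h1.eventually (hO.mem_nhds (hz w hw))

namespace HoledTorus

variable {τ : ℂ} {M : ℕ} (Ω : HoledTorus τ M)

/-! ### The boundary -/

lemma isRegularLoop (j : Fin M) : IsRegularLoop (Ω.curve j) :=
  ⟨Ω.contDiff_curve j, Ω.periodic_curve j, Ω.injOn_curve j, Ω.deriv_curve_ne_zero j⟩

lemma continuous_curve (j : Fin M) : Continuous (Ω.curve j) := (Ω.contDiff_curve j).continuous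

lemma exists_curve_eq {z : ℂ} (hz : z ∈ Ω.boundary) : ∃ j t, Ω.curve j t = z := by
  obtain ⟨j, hj⟩ := mem_iUnion.1 hz
  rw [← Ω.range_curve j] at hj
  exact ⟨j, hj⟩

lemma curve_mem_closure (j : Fin M) (t : ℝ) : Ω.curve j t ∈ closure (Ω.hole j) :=
  frontier_subset_closure (Ω.range_curve j ▸ mem_range_self t)

lemma eq_of_curve_sub_mem {i j : Fin M} {s t : ℝ}
    (h : Ω.curve i s - Ω.curve j t ∈ torusLattice τ) : i = j ∧ Ω.curve i s = Ω.curve j t :=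
  Ω.disjoint_closures i j _ (Ω.curve_mem_closure i s) _ (Ω.curve_mem_closure j t) h

lemma curve_sub_mem_latticeCompl (i j : Fin M) (s t : ℝ) :
    Ω.curve i s - Ω.curve j t ∈ latticeCompl τ :=
  mem_latticeCompl.2 fun h => sub_eq_zero.2 (Ω.eq_of_curve_sub_mem h).2

lemma curve_mem_periodicBoundary (j : Fin M) (t : ℝ) : Ω.curve j t ∈ Ω.periodicBoundary :=
  ⟨0, zero_mem _, by rw [sub_zero]; exact Ω.curve_mem_boundary j t⟩

lemma notMem_torusLattice {z : ℂ} (hz : z ∉ Ω.periodicBoundary) (j : Fin M) (t : ℝ) :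
    z - Ω.curve j t ∉ torusLattice τ := fun h =>
  hz ⟨z - Ω.curve j t, h, by rw [sub_sub_cancel]; exact Ω.curve_mem_boundary j t⟩

lemma ae_notMem_torusLattice (z : ℂ) (j : Fin M) : ∀ᵐ t : ℝ, z - Ω.curve j t ∉ torusLattice τ := by
  have hC : {w | z - w ∈ torusLattice τ}.Countable := by
    refine ((countable_torusLattice τ).image fun l => z - l).mono ?_
    exact fun w hw => ⟨z - w, hw, sub_sub_cancel z w⟩
  exact compl_mem_ae_iff.2 (((Ω.periodic_curve j).countable_preimage (Ω.injOn_curve j)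
    hC).measure_zero volume)

/-- The density `φ(γⱼ(t)) |γⱼ'(t)|` of the measure `φ |dξ|`. -/
noncomputable def density (φ : C(Ω.boundary, ℝ)) (j : Fin M) (t : ℝ) : ℝ :=
  φ (Ω.pt j t) * ‖deriv (Ω.curve j) t‖

lemma continuous_density (φ : C(Ω.boundary, ℝ)) (j : Fin M) : Continuous (Ω.density φ j) :=
  (φ.continuous.comp (Ω.continuous_pt j)).mul (Ω.continuous_norm_deriv j)

lemma periodic_density (φ : C(Ω.boundary, ℝ)) (j : Fin M) :
    Function.Periodic (Ω.density φ j) 1 := by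
  intro t
  have h1 : Ω.pt j (t + 1) = Ω.pt j t := Subtype.ext (Ω.periodic_curve j t)
  have h2 : deriv (Ω.curve j) (t + 1) = deriv (Ω.curve j) t := by
    rw [← deriv_comp_add_const]
    congr 1
    exact funext (Ω.periodic_curve j)
  rw [density, density, h1, h2]

lemma singleLayer_eq (φ : C(Ω.boundary, ℝ)) (z : ℂ) : Ω.singleLayer φ z =
    ∑ j, ∫ t in (0 : ℝ)..1, Ω.density φ j t • torusGreen τ (z - Ω.curve j t) := by
  rw [singleLayer, arcIntegral]
  refine Finset.sum_congr rfl fun j _ => intervalIntegral.integral_congr fun t _ => ?_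
  simp only [density, pt, smul_eq_mul]
  ring

/-! ### Periodicity and integrability -/

lemma ae_torusGreen_add (hτ : 0 < τ.im) {l : ℂ} (hl : l ∈ torusLattice τ) (z : ℂ) (j : Fin M) :
    ∀ᵐ t : ℝ, torusGreen τ (z + l - Ω.curve j t) = torusGreen τ (z - Ω.curve j t) := by
  filter_upwards [Ω.ae_notMem_torusLattice z j] with t ht
  rw [← torusGreen_add_of_mem hτ hl _ ht]
  congr 1
  ring

lemma singleLayer_add_of_mem (hτ : 0 < τ.im) {l : ℂ} (hl : l ∈ torusLattice τ)
    (φ : C(Ω.boundary, ℝ)) (z : ℂ) : Ω.singleLayer φ (z + l) = Ω.singleLayer φ z := by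
  rw [singleLayer_eq, singleLayer_eq]
  refine Finset.sum_congr rfl fun j _ => intervalIntegral.integral_congr_ae ?_
  filter_upwards [Ω.ae_torusGreen_add hτ hl z j] with t ht _
  rw [ht]

lemma intervalIntegrable_log (z : ℂ) (j : Fin M) :
    IntervalIntegrable (fun t => Real.log ‖z - Ω.curve j t‖) volume 0 1 :=
  (exists_integral_abs_log_sub_le (Ω.isRegularLoop j).contDiff_one (Ω.periodic_curve j)
    (Ω.injOn_curve j) (Ω.deriv_curve_ne_zero j)).1 z

lemma intervalIntegrable_torusGreen_of_latticeCompl (hτ : 0 < τ.im) {z : ℂ} {j : Fin M}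
    (hz : ∀ t ∈ Icc (0 : ℝ) 1, z - Ω.curve j t ∈ latticeCompl τ) :
    IntervalIntegrable (fun t => torusGreen τ (z - Ω.curve j t)) volume 0 1 := by
  obtain ⟨R, hR, hG⟩ := exists_torusGreen_eq hτ
  have hc := Ω.continuous_curve j
  have h1 : IntervalIntegrable (fun t => R (z - Ω.curve j t)) volume 0 1 :=
    (hR.continuousOn.comp (f := fun t => z - Ω.curve j t) (by fun_prop)
      hz).intervalIntegrable_of_Icc zero_le_one
  refine (((Ω.intervalIntegrable_log z j).const_mul (-(1 / (2 * Real.pi)))).add h1).congr_ae ?_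
  rw [Filter.EventuallyEq, ae_restrict_iff' measurableSet_uIoc]
  filter_upwards [Ω.ae_notMem_torusLattice z j] with t ht _
  exact (hG _ (mem_latticeCompl_of_notMem ht) fun h => ht (h ▸ zero_mem _)).symm

/-- A pole on a translate of ∂Ω is moved back to ∂Ω, where differences with boundary points avoid
the nonzero lattice; any other pole gives differences avoiding the lattice altogether. -/
lemma intervalIntegrable_torusGreen (hτ : 0 < τ.im) (z : ℂ) (j : Fin M) :
    IntervalIntegrable (fun t => torusGreen τ (z - Ω.curve j t)) volume 0 1 := by
  by_cases hz : z ∈ Ω.periodicBoundary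
  · obtain ⟨l, hl, hzl⟩ := hz
    obtain ⟨i, s, his⟩ := Ω.exists_curve_eq hzl
    refine (Ω.intervalIntegrable_torusGreen_of_latticeCompl hτ (z := z - l) (j := j)
      fun t _ => his ▸ Ω.curve_sub_mem_latticeCompl i j s t).congr_ae ?_
    refine ae_restrict_of_ae ?_
    filter_upwards [Ω.ae_torusGreen_add hτ hl (z - l) j] with t ht
    rw [← ht, sub_add_cancel]
  · exact Ω.intervalIntegrable_torusGreen_of_latticeCompl hτ fun t _ =>
      mem_latticeCompl_of_notMem (Ω.notMem_torusLattice hz j t)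

lemma arcIntegrable_torusGreen_mul (hτ : 0 < τ.im) (φ : C(Ω.boundary, ℝ)) (z : ℂ) :
    Ω.ArcIntegrable fun ξ => torusGreen τ (z - ξ) * φ ξ := by
  intro j
  refine ((Ω.intervalIntegrable_torusGreen hτ z j).mul_continuousOn
    (Ω.continuous_density φ j).continuousOn).congr fun t _ => ?_
  simp only [density, pt]
  ring

/-! ### Continuity and compactness -/

/-- The `L¹` distance of the kernels with poles `z` and `w`. -/
noncomputable def kernelDist (z w : ℂ) : ℝ :=
  ∑ j, ∫ t in (0 : ℝ)..1,
    |torusGreen τ (z - Ω.curve j t) - torusGreen τ (w - Ω.curve j t)| * ‖deriv (Ω.curve j) t‖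

lemma abs_density_le (φ : C(Ω.boundary, ℝ)) (j : Fin M) (t : ℝ) :
    |Ω.density φ j t| ≤ ‖φ‖ * ‖deriv (Ω.curve j) t‖ := by
  rw [density, abs_mul, abs_norm]
  gcongr
  exact φ.norm_coe_le_norm _

lemma intervalIntegrable_density_smul (hτ : 0 < τ.im) (φ : C(Ω.boundary, ℝ)) (z : ℂ) (j : Fin M) :
    IntervalIntegrable (fun t => Ω.density φ j t • torusGreen τ (z - Ω.curve j t)) volume 0 1 :=
  (Ω.intervalIntegrable_torusGreen hτ z j).continuousOn_mul (Ω.continuous_density φ j).continuousOn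

/-- The modulus of continuity depends on φ only through its norm; both continuity and equicontinuity
are drawn from this. -/
lemma abs_singleLayer_sub_le (hτ : 0 < τ.im) (φ : C(Ω.boundary, ℝ)) (z w : ℂ) :
    |Ω.singleLayer φ z - Ω.singleLayer φ w| ≤ ‖φ‖ * Ω.kernelDist z w := by
  rw [singleLayer_eq, singleLayer_eq, ← Finset.sum_sub_distrib, kernelDist, Finset.mul_sum]
  refine (Finset.abs_sum_le_sum_abs _ _).trans (Finset.sum_le_sum fun j _ => ?_)
  rw [← intervalIntegral.integral_sub (Ω.intervalIntegrable_density_smul hτ φ z j)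
    (Ω.intervalIntegrable_density_smul hτ φ w j), ← intervalIntegral.integral_const_mul]
  rw [← Real.norm_eq_abs]
  refine intervalIntegral.norm_integral_le_of_norm_le zero_le_one (.of_forall fun t _ => ?_) ?_
  · rw [← smul_sub, norm_smul, Real.norm_eq_abs, Real.norm_eq_abs]
    have := Ω.abs_density_le φ j t
    calc _ ≤ ‖φ‖ * ‖deriv (Ω.curve j) t‖ *
          |torusGreen τ (z - Ω.curve j t) - torusGreen τ (w - Ω.curve j t)| := by gcongr
      _ = _ := by ring
  · exact ((((Ω.intervalIntegrable_torusGreen hτ z j).sub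
      (Ω.intervalIntegrable_torusGreen hτ w j)).abs).mul_continuousOn
      (Ω.continuous_norm_deriv j).continuousOn).const_mul _

lemma exists_abs_singleLayer_le (hτ : 0 < τ.im) (z : ℂ) : ∃ B, ∀ φ : C(Ω.boundary, ℝ),
    |Ω.singleLayer φ z| ≤ ‖φ‖ * B := by
  refine ⟨∑ j, ∫ t in (0 : ℝ)..1,
    |torusGreen τ (z - Ω.curve j t)| * ‖deriv (Ω.curve j) t‖, fun φ => ?_⟩
  rw [singleLayer_eq, Finset.mul_sum]
  refine (Finset.abs_sum_le_sum_abs _ _).trans (Finset.sum_le_sum fun j _ => ?_)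
  rw [← intervalIntegral.integral_const_mul]
  rw [← Real.norm_eq_abs]
  refine intervalIntegral.norm_integral_le_of_norm_le zero_le_one (.of_forall fun t _ => ?_) ?_
  · rw [norm_smul, Real.norm_eq_abs, Real.norm_eq_abs]
    have := Ω.abs_density_le φ j t
    calc _ ≤ ‖φ‖ * ‖deriv (Ω.curve j) t‖ * |torusGreen τ (z - Ω.curve j t)| := by gcongr
      _ = _ := by ring
  · exact (((Ω.intervalIntegrable_torusGreen hτ z j).abs).mul_continuousOn
      (Ω.continuous_norm_deriv j).continuousOn).const_mul _

lemma tendsto_kernelDist (hτ : 0 < τ.im) (i : Fin M) (s : ℝ) :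
    Tendsto (fun z => Ω.kernelDist z (Ω.curve i s)) (𝓝 (Ω.curve i s)) (𝓝 0) := by
  set z₀ := Ω.curve i s
  have hj : ∀ j, Tendsto (fun z => ∫ t in (0 : ℝ)..1,
      |torusGreen τ (z - Ω.curve j t) - torusGreen τ (z₀ - Ω.curve j t)| * ‖deriv (Ω.curve j) t‖)
      (𝓝 z₀) (𝓝 0) := by
    intro j
    obtain ⟨R, hR, hG⟩ := exists_torusGreen_eq hτ
    obtain ⟨B, hB⟩ := (exists_integral_abs_log_sub_le (Ω.isRegularLoop j).contDiff_one
      (Ω.periodic_curve j) (Ω.injOn_curve j) (Ω.deriv_curve_ne_zero j)).2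
    obtain ⟨K, hK⟩ := isCompact_Icc.exists_bound_of_continuousOn (s := Icc (0 : ℝ) 1)
      (Ω.continuous_norm_deriv j).continuousOn
    have hK0 : 0 ≤ K := (norm_nonneg _).trans (hK 0 (by simp))
    rw [Metric.tendsto_nhds]
    intro ε hε
    have hsmall : Tendsto (fun z => K * (1 / (2 * Real.pi) * (B * Real.sqrt ‖z - z₀‖))) (𝓝 z₀)
        (𝓝 0) := by
      refine Continuous.tendsto' (by fun_prop) _ _ ?_
      simp
    -- K bounds the speed of the curve, so this tolerance for R contributes at most ε/2; K + 1
    -- avoids dividing by zero.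
    have hev := eventually_forall_comp_sub (isOpen_latticeCompl hτ) hR.continuousOn
      (Ω.continuous_curve j) (z := z₀) (fun t _ => Ω.curve_sub_mem_latticeCompl i j s t)
      (show 0 < ε / (2 * (K + 1)) by positivity)
    filter_upwards [hev, hsmall.eventually (Iio_mem_nhds (half_pos hε))] with z hz hzs
    have hdiff := (Ω.intervalIntegrable_torusGreen hτ z j).sub
      (Ω.intervalIntegrable_torusGreen hτ z₀ j)
    have hlogdiff := (Ω.intervalIntegrable_log z j).sub (Ω.intervalIntegrable_log z₀ j)
    rw [dist_zero_right, Real.norm_of_nonneg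
      (intervalIntegral.integral_nonneg zero_le_one fun t _ => by positivity)]
    calc ∫ t in (0 : ℝ)..1, |torusGreen τ (z - Ω.curve j t) - torusGreen τ (z₀ - Ω.curve j t)| *
          ‖deriv (Ω.curve j) t‖
        ≤ ∫ t in (0 : ℝ)..1, (K * (1 / (2 * Real.pi)) *
          |Real.log ‖z - Ω.curve j t‖ - Real.log ‖z₀ - Ω.curve j t‖| +
            K * (ε / (2 * (K + 1)))) := by
          refine intervalIntegral.integral_mono_ae_restrict zero_le_one
            (hdiff.abs.mul_continuousOn (Ω.continuous_norm_deriv j).continuousOn)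
            ((hlogdiff.abs.const_mul _).add intervalIntegrable_const) ?_
          rw [Filter.EventuallyLE, ae_restrict_iff' measurableSet_Icc]
          filter_upwards [Ω.ae_notMem_torusLattice z j, Ω.ae_notMem_torusLattice z₀ j]
            with t ht1 ht2 ht
          have hne : ∀ {w : ℂ}, w ∉ torusLattice τ → w ≠ 0 := fun hw h0 => hw (h0 ▸ zero_mem _)
          rw [hG _ (mem_latticeCompl_of_notMem ht1) (hne ht1),
            hG _ (mem_latticeCompl_of_notMem ht2) (hne ht2)]
          have h1 := (hz t ht).2
          rw [Real.norm_eq_abs] at h1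
          have h2 := hK t ht
          rw [Real.norm_of_nonneg (norm_nonneg _)] at h2
          have h3 : |-(1 / (2 * Real.pi)) * Real.log ‖z - Ω.curve j t‖ + R (z - Ω.curve j t) -
              (-(1 / (2 * Real.pi)) * Real.log ‖z₀ - Ω.curve j t‖ + R (z₀ - Ω.curve j t))| ≤
              1 / (2 * Real.pi) * |Real.log ‖z - Ω.curve j t‖ - Real.log ‖z₀ - Ω.curve j t‖| +
                ε / (2 * (K + 1)) := by
            have hpi : (0 : ℝ) ≤ 1 / (2 * Real.pi) := by positivity
            rw [show -(1 / (2 * Real.pi)) * Real.log ‖z - Ω.curve j t‖ + R (z - Ω.curve j t) -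
              (-(1 / (2 * Real.pi)) * Real.log ‖z₀ - Ω.curve j t‖ + R (z₀ - Ω.curve j t)) =
              (1 / (2 * Real.pi)) * -(Real.log ‖z - Ω.curve j t‖ - Real.log ‖z₀ - Ω.curve j t‖) +
                (R (z - Ω.curve j t) - R (z₀ - Ω.curve j t)) by ring]
            refine (abs_add_le _ _).trans ?_
            rw [abs_mul, abs_neg, abs_of_nonneg hpi]
            gcongr
          calc _ ≤ (1 / (2 * Real.pi) * |Real.log ‖z - Ω.curve j t‖ -
                Real.log ‖z₀ - Ω.curve j t‖| + ε / (2 * (K + 1))) * K := by gcongr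
            _ = _ := by ring
      _ = K * (1 / (2 * Real.pi) * ∫ t in (0 : ℝ)..1,
          |Real.log ‖z - Ω.curve j t‖ - Real.log ‖z₀ - Ω.curve j t‖|) +
            K * (ε / (2 * (K + 1))) := by
          rw [intervalIntegral.integral_add (hlogdiff.abs.const_mul _) intervalIntegrable_const,
            intervalIntegral.integral_const_mul]
          simp
          ring
      _ ≤ K * (1 / (2 * Real.pi) * (B * Real.sqrt ‖z - z₀‖)) + K * (ε / (2 * (K + 1))) := by
          have := hB z z₀
          gcongr
      _ < ε / 2 + ε / 2 := by
          refine add_lt_add_of_lt_of_le hzs ?_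
          rw [← mul_div_assoc, div_le_div_iff₀ (by positivity) (by positivity)]
          nlinarith
      _ = ε := add_halves ε
  have := tendsto_finsetSum Finset.univ fun j _ => hj j
  simpa [kernelDist] using this

lemma continuousAt_singleLayer_curve (hτ : 0 < τ.im) (φ : C(Ω.boundary, ℝ)) (i : Fin M) (s : ℝ) :
    ContinuousAt (Ω.singleLayer φ) (Ω.curve i s) := by
  rw [ContinuousAt, tendsto_iff_dist_tendsto_zero]
  refine squeeze_zero (fun _ => dist_nonneg) (fun z => Ω.abs_singleLayer_sub_le hτ φ z _) ?_
  simpa using (Ω.tendsto_kernelDist hτ i s).const_mul ‖φ‖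

lemma hasFDerivAt_singleLayer (hτ : 0 < τ.im) (φ : C(Ω.boundary, ℝ)) {z : ℂ}
    (hz : z ∉ Ω.periodicBoundary) : HasFDerivAt (Ω.singleLayer φ)
      (∑ j, ∫ t in (0 : ℝ)..1, Ω.density φ j t • fderiv ℝ (torusGreen τ) (z - Ω.curve j t)) z := by
  have hO : IsOpen (torusLattice τ : Set ℂ)ᶜ :=
    (isClosed_of_subset_torusLattice hτ subset_rfl).isOpen_compl
  rw [show Ω.singleLayer φ = fun z => ∑ j, ∫ t in (0 : ℝ)..1,
    Ω.density φ j t • torusGreen τ (z - Ω.curve j t) from funext (Ω.singleLayer_eq φ)]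
  exact HasFDerivAt.fun_sum fun j _ => hasFDerivAt_integral_comp_sub (𝕜 := ℝ) hO
    ((contDiffOn_torusGreen hτ).of_le (by exact_mod_cast le_top)) (Ω.continuous_curve j)
    (Ω.continuous_density φ j) fun t _ => Ω.notMem_torusLattice hz j t

lemma continuous_singleLayer (hτ : 0 < τ.im) (φ : C(Ω.boundary, ℝ)) :
    Continuous (Ω.singleLayer φ) := by
  rw [continuous_iff_continuousAt]
  intro z
  by_cases hz : z ∈ Ω.periodicBoundary
  · obtain ⟨l, hl, hzl⟩ := hz
    obtain ⟨i, s, his⟩ := Ω.exists_curve_eq hzl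
    have h := Ω.continuousAt_singleLayer_curve hτ φ i s
    rw [his] at h
    have h2 : ContinuousAt (fun w => Ω.singleLayer φ (w - l)) z :=
      ContinuousAt.comp (f := fun w => w - l) h (by fun_prop)
    refine h2.congr (.of_forall fun w => ?_)
    simp only
    rw [← Ω.singleLayer_add_of_mem hτ hl φ (w - l), sub_add_cancel]
  · exact (Ω.hasFDerivAt_singleLayer hτ φ hz).continuousAt

lemma exists_continuousMap_quotient (hτ : 0 < τ.im) (φ : C(Ω.boundary, ℝ)) :
    ∃ u : C(ℂ ⧸ torusLattice τ, ℝ), ∀ z : ℂ, u (z : ℂ ⧸ torusLattice τ) = Ω.singleLayer φ z := by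
  have hq : IsQuotientMap ((↑) : ℂ → ℂ ⧸ torusLattice τ) := QuotientAddGroup.isQuotientMap_mk _
  set π : C(ℂ, ℂ ⧸ torusLattice τ) := ⟨_, hq.continuous⟩
  have hπ : IsQuotientMap π := hq
  set f : C(ℂ, ℝ) := ⟨_, Ω.continuous_singleLayer hτ φ⟩
  have hf : Function.FactorsThrough f π := fun a b hab => by
    have h : -a + b ∈ torusLattice τ := QuotientAddGroup.eq.1 hab
    have := Ω.singleLayer_add_of_mem hτ h φ a
    rw [add_neg_cancel_left] at this
    exact this.symm
  exact ⟨hπ.lift f hf, fun z => congrArg (fun f : C(ℂ, ℝ) => f z) (hπ.lift_comp f hf)⟩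

lemma singleLayer_add_smul (hτ : 0 < τ.im) (φ ψ : C(Ω.boundary, ℝ)) (c : ℝ) (z : ℂ) :
    Ω.singleLayer (c • φ + ψ) z = c * Ω.singleLayer φ z + Ω.singleLayer ψ z := by
  rw [singleLayer_eq, singleLayer_eq, singleLayer_eq, Finset.mul_sum, ← Finset.sum_add_distrib]
  refine Finset.sum_congr rfl fun j _ => ?_
  rw [← intervalIntegral.integral_const_mul, ← intervalIntegral.integral_add
    ((Ω.intervalIntegrable_density_smul hτ φ z j).const_mul c)
    (Ω.intervalIntegrable_density_smul hτ ψ z j)]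
  refine intervalIntegral.integral_congr fun t _ => ?_
  simp only [density, ContinuousMap.add_apply, ContinuousMap.smul_apply, smul_eq_mul]
  ring

/-- By Arzelà–Ascoli the image of the unit ball is relatively compact: it is uniformly bounded, and
`kernelDist` is a common modulus of continuity at each point. -/
lemma exists_compact_operator (hτ : 0 < τ.im) : ∃ T : Ω.C0 →L[ℝ] C(Ω.boundary, ℝ),
    (∀ (φ : Ω.C0) (ξ : Ω.boundary), T φ ξ = Ω.singleLayer φ ξ) ∧ IsCompactOperator T := by
  have hdist : ∀ ξ : Ω.boundary, Tendsto (fun η : Ω.boundary => Ω.kernelDist η ξ) (𝓝 ξ) (𝓝 0) := by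
    rintro ⟨ξ, hξ⟩
    obtain ⟨i, s, rfl⟩ := Ω.exists_curve_eq hξ
    exact (Ω.tendsto_kernelDist hτ i s).comp continuous_subtype_val.continuousAt
  obtain ⟨B, hB0, hB⟩ : ∃ B, 0 ≤ B ∧ ∀ (ξ : Ω.boundary) (φ : C(Ω.boundary, ℝ)),
      |Ω.singleLayer φ ξ| ≤ B * ‖φ‖ := by
    -- A bound at ξ extends to a neighbourhood of ξ, at the cost of adding 1, because the kernels
    -- vary continuously in L¹; compactness of ∂Ω makes it global.
    obtain ⟨B, hB0, hB⟩ := isCompact_univ.induction_on (X := Ω.boundary)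
      (p := fun A => ∃ B : ℝ, 0 ≤ B ∧ ∀ ξ ∈ A, ∀ φ : C(Ω.boundary, ℝ),
        |Ω.singleLayer φ ξ| ≤ B * ‖φ‖) ⟨0, le_rfl, by simp⟩
      (fun A A' hAA' ⟨B, hB0, hB⟩ => ⟨B, hB0, fun ξ hξ => hB ξ (hAA' hξ)⟩)
      (fun A A' ⟨B, hB0, hB⟩ ⟨B', hB0', hB'⟩ => ⟨B + B', by positivity, fun ξ hξ φ => by
        have h1 : 0 ≤ B * ‖φ‖ := by positivity
        have h2 : 0 ≤ B' * ‖φ‖ := by positivity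
        rw [add_mul]
        rcases hξ with hξ | hξ
        · linarith [hB ξ hξ φ]
        · linarith [hB' ξ hξ φ]⟩)
      (fun ξ _ => by
        obtain ⟨B, hB⟩ := Ω.exists_abs_singleLayer_le hτ ξ
        refine ⟨_, mem_nhdsWithin_of_mem_nhds ((hdist ξ).eventually (Iio_mem_nhds one_pos)),
          |B| + 1, by positivity, fun η hη φ => ?_⟩
        have h1 := Ω.abs_singleLayer_sub_le hτ φ η ξ
        have h2 : ‖φ‖ * Ω.kernelDist η ξ ≤ ‖φ‖ * 1 := by
          gcongr
          exact (mem_Iio.1 hη).le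
        have h3 : ‖φ‖ * B ≤ ‖φ‖ * |B| := by gcongr; exact le_abs_self B
        have h4 := abs_sub_abs_le_abs_sub (Ω.singleLayer φ η) (Ω.singleLayer φ ξ)
        linarith [hB φ])
    exact ⟨B, hB0, fun ξ => hB ξ (mem_univ ξ)⟩
  let L : Ω.C0 →ₗ[ℝ] C(Ω.boundary, ℝ) :=
    { toFun := fun φ => ⟨fun ξ => Ω.singleLayer φ ξ,
        (Ω.continuous_singleLayer hτ φ).comp continuous_subtype_val⟩
      map_add' := fun φ ψ => by
        ext ξ
        simpa using Ω.singleLayer_add_smul hτ φ ψ 1 ξ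
      map_smul' := fun c φ => by
        ext ξ
        have h0 : Ω.singleLayer (0 : C(Ω.boundary, ℝ)) ξ = 0 := by
          simp [singleLayer, arcIntegral]
        simpa [h0] using Ω.singleLayer_add_smul hτ φ 0 c ξ }
  have hL : ∀ φ : Ω.C0, ‖L φ‖ ≤ B * ‖φ‖ := fun φ =>
    (ContinuousMap.norm_le _ (by positivity)).2 fun ξ => hB ξ φ
  refine ⟨L.mkContinuous B hL, fun φ ξ => rfl, ?_⟩
  set e := ContinuousMap.isometryEquivBoundedOfCompact Ω.boundary ℝ
  set A : Set (BoundedContinuousFunction Ω.boundary ℝ) :=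
    (fun φ : Ω.C0 => e (L φ)) '' Metric.closedBall 0 1
  have hA : IsCompact (closure A) := by
    refine BoundedContinuousFunction.arzela_ascoli (Metric.closedBall 0 B)
      (isCompact_closedBall _ _) A ?_ ?_
    · rintro _ ξ ⟨φ, hφ, rfl⟩
      rw [mem_closedBall_zero_iff] at hφ ⊢
      exact (hB ξ φ).trans (mul_le_of_le_one_right hB0 hφ)
    · intro ξ
      refine Metric.equicontinuousAt_of_continuity_modulus
        (fun η : Ω.boundary => Ω.kernelDist η ξ) (hdist ξ) _ (.of_forall ?_)
      rintro η ⟨_, φ, hφ, rfl⟩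
      rw [mem_closedBall_zero_iff] at hφ
      rw [dist_comm]
      have h1 := Ω.abs_singleLayer_sub_le hτ φ η ξ
      have h2 : 0 ≤ Ω.kernelDist η ξ := Finset.sum_nonneg fun j _ =>
        intervalIntegral.integral_nonneg zero_le_one fun t _ => by positivity
      exact h1.trans (mul_le_of_le_one_left h2 hφ)
  rw [isCompactOperator_iff_exists_mem_nhds_image_subset_compact]
  refine ⟨Metric.closedBall 0 1, Metric.closedBall_mem_nhds 0 one_pos, e.symm '' closure A,
    hA.image e.symm.continuous, ?_⟩
  rintro _ ⟨φ, hφ, rfl⟩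
  exact ⟨e (L φ), subset_closure ⟨φ, hφ, rfl⟩, e.symm_apply_apply _⟩

/-! ### Harmonicity -/

lemma sum_integral_density {φ : C(Ω.boundary, ℝ)} (hφ : φ ∈ Ω.C0) :
    ∑ j, ∫ t in (0 : ℝ)..1, Ω.density φ j t = 0 := hφ

/-- Expanding (Im(w - ξ))², the coefficient of (Im w)² is the integral of φ, which vanishes. Only an
affine function of Im w is left, and that is harmonic. -/
lemma exists_singleLayer_eq_re (hτ : 0 < τ.im) {φ : C(Ω.boundary, ℝ)} (hφ : φ ∈ Ω.C0) {z : ℂ}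
    (hz : z ∉ Ω.periodicBoundary) :
    ∃ F : ℂ → ℂ, AnalyticAt ℂ F z ∧ Ω.singleLayer φ =ᶠ[𝓝 z] fun w => (F w).re := by
  have hF := fun j => exists_analyticAt_integral_log_norm (differentiable_theta1 hτ)
    (Ω.continuous_curve j) (Ω.continuous_density φ j) (z := z)
    fun t _ => theta1_ne_zero hτ (Ω.notMem_torusLattice hz j t)
  choose F hFa hF using hF
  have hcont : ∀ j, Continuous fun t => (Ω.curve j t).im := fun j =>
    Complex.continuous_im.comp (Ω.continuous_curve j)
  set A : ℝ := ∑ j, ∫ t in (0 : ℝ)..1, Ω.density φ j t * (Ω.curve j t).im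
  set B : ℝ := ∑ j, ∫ t in (0 : ℝ)..1, Ω.density φ j t * (Ω.curve j t).im ^ 2
  have hsq : ∀ w : ℂ, ∑ j, ∫ t in (0 : ℝ)..1, Ω.density φ j t * (w - Ω.curve j t).im ^ 2 =
      B - 2 * w.im * A := by
    intro w
    have h1 : ∀ j, ∫ t in (0 : ℝ)..1, Ω.density φ j t * (w - Ω.curve j t).im ^ 2 =
        w.im ^ 2 * (∫ t in (0 : ℝ)..1, Ω.density φ j t) -
          2 * w.im * (∫ t in (0 : ℝ)..1, Ω.density φ j t * (Ω.curve j t).im) +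
          ∫ t in (0 : ℝ)..1, Ω.density φ j t * (Ω.curve j t).im ^ 2 := by
      intro j
      have hd := Ω.continuous_density φ j
      have hc := hcont j
      rw [← intervalIntegral.integral_const_mul, ← intervalIntegral.integral_const_mul,
        ← intervalIntegral.integral_sub, ← intervalIntegral.integral_add]
      · refine intervalIntegral.integral_congr fun t _ => ?_
        simp only [sub_im]
        ring
      all_goals exact Continuous.intervalIntegrable (by fun_prop) _ _
    simp only [h1, Finset.sum_add_distrib, Finset.sum_sub_distrib, ← Finset.mul_sum,
      Ω.sum_integral_density hφ]
    ring
  have hO : IsOpen (torusLattice τ : Set ℂ)ᶜ :=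
    (isClosed_of_subset_torusLattice hτ subset_rfl).isOpen_compl
  have hev : ∀ᶠ w in 𝓝 z, ∀ j, ∀ t ∈ Icc (0 : ℝ) 1, w - Ω.curve j t ∉ torusLattice τ :=
    eventually_all.2 fun j => (eventually_forall_comp_sub hO (k := fun _ => (0 : ℝ))
      continuousOn_const (Ω.continuous_curve j) (fun t _ => Ω.notMem_torusLattice hz j t)
      one_pos).mono fun w hw t ht => (hw t ht).1
  -- Since Re(iw) = -Im w, the last term has real part (B - 2A Im w)/(2 Im τ), the contribution of
  -- the quadratic term of G.
  refine ⟨fun w => -(1 / (2 * Real.pi) : ℝ) * ∑ j, F j w +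
    (1 / (2 * τ.im) : ℝ) * ((B : ℝ) + 2 * A * (I * w)), ?_, ?_⟩
  · have h1 : AnalyticAt ℂ (fun w => ∑ j, F j w) z :=
      Finset.analyticAt_fun_sum _ fun j _ => hFa j
    fun_prop
  · filter_upwards [eventually_all.2 hF, hev] with w hw hwO
    have hint1 : ∀ j, IntervalIntegrable
        (fun t => Ω.density φ j t * Real.log ‖theta1 τ (w - Ω.curve j t)‖) volume 0 1 := by
      intro j
      refine ContinuousOn.intervalIntegrable_of_Icc zero_le_one
        ((Ω.continuous_density φ j).continuousOn.mul (ContinuousOn.log ?_ fun t ht =>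
          norm_ne_zero_iff.2 (theta1_ne_zero hτ (hwO j t ht))))
      have h1 := (differentiable_theta1 hτ).continuous
      have h2 := Ω.continuous_curve j
      fun_prop
    have hint2 : ∀ j, IntervalIntegrable
        (fun t => Ω.density φ j t * (w - Ω.curve j t).im ^ 2) volume 0 1 := by
      intro j
      have hd := Ω.continuous_density φ j
      have hc := hcont j
      simp only [sub_im]
      exact Continuous.intervalIntegrable (by fun_prop) _ _
    have hj : ∀ j, ∫ t in (0 : ℝ)..1, Ω.density φ j t • torusGreen τ (w - Ω.curve j t) =
        -(1 / (2 * Real.pi)) * (F j w).re + 1 / (2 * τ.im) *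
          ∫ t in (0 : ℝ)..1, Ω.density φ j t * (w - Ω.curve j t).im ^ 2 := by
      intro j
      rw [← hw j, ← intervalIntegral.integral_const_mul, ← intervalIntegral.integral_const_mul,
        ← intervalIntegral.integral_add ((hint1 j).const_mul _) ((hint2 j).const_mul _)]
      refine intervalIntegral.integral_congr fun t _ => ?_
      simp only [torusGreen, smul_eq_mul]
      ring
    rw [singleLayer_eq]
    simp only [hj, Finset.sum_add_distrib, ← Finset.mul_sum, hsq]
    rw [← ofReal_neg, add_re, re_ofReal_mul, re_ofReal_mul, re_sum]
    congr 2
    simp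
    ring

lemma contDiffOn_singleLayer (hτ : 0 < τ.im) {φ : C(Ω.boundary, ℝ)} (hφ : φ ∈ Ω.C0) :
    ContDiffOn ℝ ∞ (Ω.singleLayer φ) Ω.periodicBoundaryᶜ := by
  intro z hz
  obtain ⟨F, hF, heq⟩ := Ω.exists_singleLayer_eq_re hτ hφ hz
  have h1 : ContDiffAt ℝ ∞ F z := (hF.contDiffAt (n := ∞)).restrict_scalars ℝ
  exact ((reCLM.contDiff.contDiffAt.comp z h1).congr_of_eventuallyEq heq).contDiffWithinAt

lemma harmonicOnNhd_singleLayer (hτ : 0 < τ.im) {φ : C(Ω.boundary, ℝ)} (hφ : φ ∈ Ω.C0) :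
    InnerProductSpace.HarmonicOnNhd (Ω.singleLayer φ) Ω.periodicBoundaryᶜ := by
  intro z hz
  obtain ⟨F, hF, heq⟩ := Ω.exists_singleLayer_eq_re hτ hφ hz
  exact (InnerProductSpace.harmonicAt_congr_nhds heq).2 hF.harmonicAt_re

/-! ### The normal derivative near the boundary -/

/-- The normal derivative of the logarithmic potential of the `j`-th boundary curve. -/
noncomputable def logNormal (φ : C(Ω.boundary, ℝ)) (i : Fin M) (s : ℝ) (j : Fin M) (z : ℂ) : ℝ :=
  ∫ t in (0 : ℝ)..1, (Ω.normal i s / (z - Ω.curve j t)).re * Ω.density φ j t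

lemma ne_zero_of_ne {i j : Fin M} (hij : i ≠ j) (s t : ℝ) : Ω.curve i s - Ω.curve j t ≠ 0 :=
  fun h => hij (Ω.eq_of_curve_sub_mem (h ▸ zero_mem _)).1

lemma normal_eq (i : Fin M) (s : ℝ) :
    Ω.normal i s = -I * deriv (Ω.curve i) s / ‖deriv (Ω.curve i) s‖ := rfl

lemma contDiffOn_normal_div (ν : ℂ) : ContDiffOn ℝ 1 (fun w : ℂ => (ν / w).re) {0}ᶜ := by
  have h1 : ContDiffOn ℂ 1 (fun w : ℂ => ν / w) {0}ᶜ :=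
    contDiffOn_const.div contDiffOn_id fun w hw => hw
  exact reCLM.contDiff.comp_contDiffOn (h1.restrict_scalars ℝ)

lemma continuousAt_logNormal (φ : C(Ω.boundary, ℝ)) {i j : Fin M} (hij : i ≠ j) (s : ℝ) :
    ContinuousAt (Ω.logNormal φ i s j) (Ω.curve i s) := by
  have h := (hasFDerivAt_integral_comp_sub (𝕜 := ℝ) isOpen_compl_singleton
    (contDiffOn_normal_div (Ω.normal i s)) (Ω.continuous_curve j) (Ω.continuous_density φ j)
    (z := Ω.curve i s) fun t _ => Ω.ne_zero_of_ne hij s t).continuousAt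
  refine h.congr (.of_forall fun z => ?_)
  simp only [logNormal, smul_eq_mul, mul_comm]

lemma intervalIntegrable_logNormal (φ : C(Ω.boundary, ℝ)) (i j : Fin M) (s : ℝ) :
    IntervalIntegrable (fun t => (Ω.normal i s / (Ω.curve i s - Ω.curve j t)).re *
      Ω.density φ j t) volume 0 1 := by
  by_cases hij : i = j
  · subst hij
    exact (Ω.isRegularLoop i).intervalIntegrable_normal_div (Ω.continuous_density φ i)
      (Ω.periodic_density φ i) s
  · refine ContinuousOn.intervalIntegrable_of_Icc zero_le_one
      (ContinuousOn.mul ?_ (Ω.continuous_density φ j).continuousOn)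
    have hc := Ω.continuous_curve j
    exact (contDiffOn_normal_div (Ω.normal i s)).continuousOn.comp
      (f := fun t => Ω.curve i s - Ω.curve j t) (by fun_prop) fun t _ => Ω.ne_zero_of_ne hij s t

lemma inv_norm_mul_density (φ : C(Ω.boundary, ℝ)) (i : Fin M) (s : ℝ) :
    ‖deriv (Ω.curve i) s‖⁻¹ * Ω.density φ i s = φ (Ω.pt i s) := by
  rw [density, mul_left_comm, inv_mul_cancel₀ (norm_ne_zero_iff.2 (Ω.deriv_curve_ne_zero i s)),
    mul_one]

/-- Only the curve through the base point jumps; the contributions of the others are continuous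
there. -/
lemma tendsto_sum_logNormal_left (φ : C(Ω.boundary, ℝ)) (i : Fin M) (s : ℝ) {c : ℝ} (hc : 0 < c) :
    Tendsto (fun z => ∑ j, Ω.logNormal φ i s j z) (𝓝[leftSector (Ω.curve i) s c] (Ω.curve i s))
      (𝓝 (∑ j, Ω.logNormal φ i s j (Ω.curve i s) - Real.pi * φ (Ω.pt i s))) := by
  have h0 := (Ω.isRegularLoop i).tendsto_integral_normal_div_left (Ω.continuous_density φ i)
    (Ω.periodic_density φ i) s hc
  rw [Ω.inv_norm_mul_density] at h0
  have h1 : Tendsto (Ω.logNormal φ i s i) (𝓝[leftSector (Ω.curve i) s c] (Ω.curve i s))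
      (𝓝 (Ω.logNormal φ i s i (Ω.curve i s) - Real.pi * φ (Ω.pt i s))) := h0
  have h2 := tendsto_finsetSum (Finset.univ.erase i) fun j hj =>
    (Ω.continuousAt_logNormal φ (Finset.ne_of_mem_erase hj).symm s).tendsto.mono_left
      (nhdsWithin_le_nhds (s := leftSector (Ω.curve i) s c))
  simp only [← Finset.add_sum_erase _ _ (Finset.mem_univ i)]
  convert h1.add h2 using 2
  ring

lemma tendsto_sum_logNormal_right (φ : C(Ω.boundary, ℝ)) (i : Fin M) (s : ℝ) {c : ℝ} (hc : 0 < c) :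
    Tendsto (fun z => ∑ j, Ω.logNormal φ i s j z) (𝓝[rightSector (Ω.curve i) s c] (Ω.curve i s))
      (𝓝 (∑ j, Ω.logNormal φ i s j (Ω.curve i s) + Real.pi * φ (Ω.pt i s))) := by
  have h0 := (Ω.isRegularLoop i).tendsto_integral_normal_div_right (Ω.continuous_density φ i)
    (Ω.periodic_density φ i) s hc
  rw [Ω.inv_norm_mul_density] at h0
  have h1 : Tendsto (Ω.logNormal φ i s i) (𝓝[rightSector (Ω.curve i) s c] (Ω.curve i s))
      (𝓝 (Ω.logNormal φ i s i (Ω.curve i s) + Real.pi * φ (Ω.pt i s))) := h0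
  have h2 := tendsto_finsetSum (Finset.univ.erase i) fun j hj =>
    (Ω.continuousAt_logNormal φ (Finset.ne_of_mem_erase hj).symm s).tendsto.mono_left
      (nhdsWithin_le_nhds (s := rightSector (Ω.curve i) s c))
  simp only [← Finset.add_sum_erase _ _ (Finset.mem_univ i)]
  convert h1.add h2 using 2
  ring

/-- The integral of the kernel `∂_ν G(z - ξ)` against `φ`. -/
noncomputable def greenNormal (φ : C(Ω.boundary, ℝ)) (i : Fin M) (s : ℝ) (z : ℂ) : ℝ :=
  ∑ j, ∫ t in (0 : ℝ)..1,
    Ω.density φ j t * fderiv ℝ (torusGreen τ) (z - Ω.curve j t) (Ω.normal i s)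

lemma fderiv_torusGreen_apply {R : ℂ → ℝ} (hτ : 0 < τ.im) (hR : ContDiffOn ℝ ∞ R (latticeCompl τ))
    (hG : ∀ z ∈ latticeCompl τ, z ≠ 0 →
      torusGreen τ z = -(1 / (2 * Real.pi)) * Real.log ‖z‖ + R z)
    {w : ℂ} (hw : w ∈ latticeCompl τ) (hw0 : w ≠ 0) (ν : ℂ) :
    fderiv ℝ (torusGreen τ) w ν = -(1 / (2 * Real.pi)) * (ν / w).re + fderiv ℝ R w ν := by
  have h1 := hasFDerivAt_log_norm (θ := fun z => z) differentiable_id hw0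
  have hmem := (isOpen_latticeCompl hτ).mem_nhds hw
  have h2 := ((hR.contDiffAt hmem).differentiableAt (by simp)).hasFDerivAt
  have h3 := ((h1.const_mul (-(1 / (2 * Real.pi)))).add h2).congr_of_eventuallyEq
    (f₁ := torusGreen τ) (by
      filter_upwards [hmem, isOpen_ne.mem_nhds hw0] with z hz hz0
      exact hG z hz hz0)
  rw [h3.fderiv]
  simp [reMul_apply, div_eq_inv_mul]

/-- The kernel splits into its logarithmic and smooth parts only almost everywhere: the pole itself
may lie on the curve, where the derivative is a default value. -/
lemma integral_fderiv_torusGreen {R : ℂ → ℝ} (hτ : 0 < τ.im)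
    (hR : ContDiffOn ℝ ∞ R (latticeCompl τ))
    (hG : ∀ z ∈ latticeCompl τ, z ≠ 0 →
      torusGreen τ z = -(1 / (2 * Real.pi)) * Real.log ‖z‖ + R z)
    (φ : C(Ω.boundary, ℝ)) (i j : Fin M) (s : ℝ) {z : ℂ}
    (hz : ∀ t ∈ Icc (0 : ℝ) 1, z - Ω.curve j t ∈ latticeCompl τ)
    (hi : IntervalIntegrable (fun t => (Ω.normal i s / (z - Ω.curve j t)).re * Ω.density φ j t)
      volume 0 1) :
    IntervalIntegrable (fun t => Ω.density φ j t *
      fderiv ℝ (torusGreen τ) (z - Ω.curve j t) (Ω.normal i s)) volume 0 1 ∧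
    ∫ t in (0 : ℝ)..1, Ω.density φ j t *
      fderiv ℝ (torusGreen τ) (z - Ω.curve j t) (Ω.normal i s) =
      -(1 / (2 * Real.pi)) * Ω.logNormal φ i s j z +
        ∫ t in (0 : ℝ)..1, Ω.density φ j t • fderiv ℝ R (z - Ω.curve j t) (Ω.normal i s) := by
  have hR' : ContinuousOn (fun w => fderiv ℝ R w (Ω.normal i s)) (latticeCompl τ) :=
    (hR.continuousOn_fderiv_of_isOpen (isOpen_latticeCompl hτ) (by simp)).clm_apply
      continuousOn_const
  have h1 := (continuousOn_smul_comp_sub hR' (Ω.continuous_curve j) (Ω.continuous_density φ j)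
    hz).intervalIntegrable_of_Icc (μ := volume) zero_le_one
  have hae : ∀ᵐ t : ℝ, t ∈ Set.uIoc (0 : ℝ) 1 → -(1 / (2 * Real.pi)) *
      ((Ω.normal i s / (z - Ω.curve j t)).re * Ω.density φ j t) +
      Ω.density φ j t • fderiv ℝ R (z - Ω.curve j t) (Ω.normal i s) =
      Ω.density φ j t * fderiv ℝ (torusGreen τ) (z - Ω.curve j t) (Ω.normal i s) := by
    filter_upwards [Ω.ae_notMem_torusLattice z j] with t ht _
    rw [fderiv_torusGreen_apply hτ hR hG (mem_latticeCompl_of_notMem ht)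
      fun h => ht (h ▸ zero_mem _), smul_eq_mul]
    ring
  have h2 := (hi.const_mul (-(1 / (2 * Real.pi)))).add h1
  refine ⟨h2.congr_ae ?_, ?_⟩
  · rw [Filter.EventuallyEq, ae_restrict_iff' measurableSet_uIoc]
    exact hae
  · rw [logNormal, ← intervalIntegral.integral_const_mul, ← intervalIntegral.integral_add
      (hi.const_mul _) h1]
    exact (intervalIntegral.integral_congr_ae hae).symm

lemma intervalIntegrable_greenNormal (hτ : 0 < τ.im) (φ : C(Ω.boundary, ℝ)) (i j : Fin M) (s : ℝ) :
    IntervalIntegrable (fun t => Ω.density φ j t *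
      fderiv ℝ (torusGreen τ) (Ω.curve i s - Ω.curve j t) (Ω.normal i s)) volume 0 1 := by
  obtain ⟨R, hR, hG⟩ := exists_torusGreen_eq hτ
  exact (Ω.integral_fderiv_torusGreen hτ hR hG φ i j s
    (fun t _ => Ω.curve_sub_mem_latticeCompl i j s t) (Ω.intervalIntegrable_logNormal φ i j s)).1

lemma fderiv_singleLayer_apply (hτ : 0 < τ.im) (φ : C(Ω.boundary, ℝ)) (i : Fin M) (s : ℝ) {z : ℂ}
    (hz : z ∉ Ω.periodicBoundary) :
    fderiv ℝ (Ω.singleLayer φ) z (Ω.normal i s) = Ω.greenNormal φ i s z := by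
  have hO : IsOpen (torusLattice τ : Set ℂ)ᶜ :=
    (isClosed_of_subset_torusLattice hτ subset_rfl).isOpen_compl
  rw [(Ω.hasFDerivAt_singleLayer hτ φ hz).fderiv, sum_apply, greenNormal]
  refine Finset.sum_congr rfl fun j _ => ?_
  rw [ContinuousLinearMap.intervalIntegral_apply]
  · simp
  · exact (continuousOn_smul_comp_sub ((contDiffOn_torusGreen hτ).continuousOn_fderiv_of_isOpen hO
      (by simp)) (Ω.continuous_curve j) (Ω.continuous_density φ j)
      fun t _ => Ω.notMem_torusLattice hz j t).intervalIntegrable_of_Icc zero_le_one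

/-- The regular part of the normal derivative is continuous at the boundary. -/
lemma exists_greenNormal_eq (hτ : 0 < τ.im) (φ : C(Ω.boundary, ℝ)) (i : Fin M) (s : ℝ) :
    ∃ Q : ℂ → ℝ, ContinuousAt Q (Ω.curve i s) ∧
      Ω.greenNormal φ i s (Ω.curve i s) =
        -(1 / (2 * Real.pi)) * ∑ j, Ω.logNormal φ i s j (Ω.curve i s) + Q (Ω.curve i s) ∧
      ∀ᶠ z in 𝓝 (Ω.curve i s), z ∉ Ω.periodicBoundary → Ω.greenNormal φ i s z =
        -(1 / (2 * Real.pi)) * ∑ j, Ω.logNormal φ i s j z + Q z := by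
  obtain ⟨R, hR, hG⟩ := exists_torusGreen_eq hτ
  have hmem := fun j t => Ω.curve_sub_mem_latticeCompl i j s t
  refine ⟨fun z => ∑ j, ∫ t in (0 : ℝ)..1,
    Ω.density φ j t • fderiv ℝ R (z - Ω.curve j t) (Ω.normal i s), ?_, ?_, ?_⟩
  · refine tendsto_finsetSum _ fun j _ => ?_
    have hR' : ContDiffOn ℝ 1 (fun w => fderiv ℝ R w (Ω.normal i s)) (latticeCompl τ) :=
      (hR.fderiv_of_isOpen (isOpen_latticeCompl hτ) (by norm_cast)).clm_apply contDiffOn_const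
    exact (hasFDerivAt_integral_comp_sub (𝕜 := ℝ) (isOpen_latticeCompl hτ) hR'
      (Ω.continuous_curve j) (Ω.continuous_density φ j) fun t _ => hmem j t).continuousAt
  · rw [greenNormal, Finset.mul_sum, ← Finset.sum_add_distrib]
    exact Finset.sum_congr rfl fun j _ => (Ω.integral_fderiv_torusGreen hτ hR hG φ i j s
      (fun t _ => hmem j t) (Ω.intervalIntegrable_logNormal φ i j s)).2
  · refine .of_forall fun z hz => ?_
    rw [greenNormal, Finset.mul_sum, ← Finset.sum_add_distrib]
    refine Finset.sum_congr rfl fun j _ => (Ω.integral_fderiv_torusGreen hτ hR hG φ i j s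
      (fun t _ => mem_latticeCompl_of_notMem (Ω.notMem_torusLattice hz j t)) ?_).2
    refine ContinuousOn.intervalIntegrable_of_Icc zero_le_one
      (ContinuousOn.mul ?_ (Ω.continuous_density φ j).continuousOn)
    have hc := Ω.continuous_curve j
    exact (contDiffOn_normal_div (Ω.normal i s)).continuousOn.comp
      (f := fun t => z - Ω.curve j t) (by fun_prop) fun t _ h =>
        Ω.notMem_torusLattice hz j t (by
          rw [show z - Ω.curve j t = 0 from h]
          exact zero_mem _)

/-! ### Approach to the boundary -/

/-- Near a boundary point of a hole, there is no other hole and no other translate of the hole. -/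
lemma eventually_eq_of_sub_mem_closure (hτ : 0 < τ.im) (i : Fin M) (s : ℝ) :
    ∀ᶠ z in 𝓝 (Ω.curve i s), ∀ j, ∀ l ∈ torusLattice τ, z - l ∈ closure (Ω.hole j) →
      l = 0 ∧ j = i := by
  refine eventually_all.2 fun j => ?_
  have hmem := Ω.curve_mem_closure i s
  have h1 := (Metric.isCompact_of_isClosed_isBounded isClosed_closure
    (Ω.isBounded_hole j).closure).eventually_forall_sub_mem (isOpen_latticeCompl hτ)
    (z := Ω.curve i s) fun w hw => mem_latticeCompl.2 fun h =>
      sub_eq_zero.2 (Ω.disjoint_closures i j _ hmem w hw h).2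
  have h2 : ∀ᶠ z in 𝓝 (Ω.curve i s), z ∈ closure (Ω.hole j) → j = i := by
    by_cases hij : j = i
    · exact .of_forall fun _ _ => hij
    · have hnot : Ω.curve i s ∉ closure (Ω.hole j) := fun h =>
        hij (Ω.disjoint_closures i j _ hmem _ h (by simp)).1.symm
      filter_upwards [isClosed_closure.isOpen_compl.mem_nhds hnot] with z hz h using absurd h hz
  filter_upwards [h1, h2] with z hz1 hz2 l hl hzl
  have hl0 : l = 0 := by
    have := hz1 _ hzl
    rw [sub_sub_cancel] at this
    exact mem_latticeCompl.1 this hl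
  exact ⟨hl0, hz2 (by simpa [hl0] using hzl)⟩

/-- Other holes and translates stay away from the vertex, so only the curve itself could be met, and
a small sector misses it. -/
lemma eventually_notMem_periodicBoundary (hτ : 0 < τ.im) (i : Fin M) (s : ℝ) {c : ℝ} (hc : 0 < c) :
    ∀ᶠ z in 𝓝 (Ω.curve i s), tangentCoord (Ω.curve i) s z ≠ 0 →
      c * ‖tangentCoord (Ω.curve i) s z‖ ≤ |(tangentCoord (Ω.curve i) s z).im| →
      z ∉ Ω.periodicBoundary := by
  have h1 := ((continuous_tangentCoord (Ω.curve i) s).tendsto' _ _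
    (tangentCoord_self _ s)).eventually ((Ω.isRegularLoop i).eventually_notMem_range s hc)
  filter_upwards [h1, Ω.eventually_eq_of_sub_mem_closure hτ i s] with z hz hz2 h0 hsec
  rintro ⟨l, hl, hzl⟩
  obtain ⟨j, hj⟩ := mem_iUnion.1 hzl
  obtain ⟨rfl, rfl⟩ := hz2 j l hl (frontier_subset_closure hj)
  refine hz h0 hsec ?_
  rwa [tangentCoord, mul_div_cancel₀ _ (Ω.deriv_curve_ne_zero j s), add_sub_cancel, Ω.range_curve,
    ← sub_zero z]

/-- All but the logarithmic part is continuous, so its jump a passes through the factor -1/(2π): a =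
∓πφ becomes ±φ/2. -/
lemma tendsto_fderiv_of_tendsto (hτ : 0 < τ.im) (φ : C(Ω.boundary, ℝ)) (i : Fin M) (s : ℝ)
    {A : Set ℂ} {a : ℝ} (hA : ∀ᶠ z in 𝓝[A] (Ω.curve i s), z ∉ Ω.periodicBoundary)
    (ha : Tendsto (fun z => ∑ j, Ω.logNormal φ i s j z) (𝓝[A] (Ω.curve i s))
      (𝓝 (∑ j, Ω.logNormal φ i s j (Ω.curve i s) + a))) :
    Tendsto (fun z => fderiv ℝ (Ω.singleLayer φ) z (Ω.normal i s)) (𝓝[A] (Ω.curve i s))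
      (𝓝 (Ω.greenNormal φ i s (Ω.curve i s) - 1 / (2 * Real.pi) * a)) := by
  obtain ⟨Q, hQ, h0, hev⟩ := Ω.exists_greenNormal_eq hτ φ i s
  have h1 := (ha.const_mul (-(1 / (2 * Real.pi)))).add (hQ.tendsto.mono_left nhdsWithin_le_nhds)
  rw [h0]
  convert h1.congr' ?_ using 2
  · ring
  · filter_upwards [hA, hev.filter_mono nhdsWithin_le_nhds] with z hz hz2
    rw [Ω.fderiv_singleLayer_apply hτ φ i s hz, hz2 hz]

lemma tendsto_fderiv_left (hτ : 0 < τ.im) (φ : C(Ω.boundary, ℝ)) (i : Fin M) (s : ℝ) {c : ℝ}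
    (hc : 0 < c) :
    Tendsto (fun z => fderiv ℝ (Ω.singleLayer φ) z (Ω.normal i s))
      (𝓝[leftSector (Ω.curve i) s c] (Ω.curve i s))
      (𝓝 (Ω.greenNormal φ i s (Ω.curve i s) + 1 / 2 * φ (Ω.pt i s))) := by
  have h := Ω.tendsto_fderiv_of_tendsto hτ φ i s (A := leftSector (Ω.curve i) s c)
    (a := -(Real.pi * φ (Ω.pt i s))) ?_ (by
      simpa only [sub_eq_add_neg] using Ω.tendsto_sum_logNormal_left φ i s hc)
  · convert h using 2
    field_simp
    ring
  · filter_upwards [(Ω.eventually_notMem_periodicBoundary hτ i s hc).filter_mono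
      nhdsWithin_le_nhds, self_mem_nhdsWithin] with z hz hzs
    exact hz (fun h => by simpa [h] using hzs.1) (hzs.2.trans (le_abs_self _))

lemma tendsto_fderiv_right (hτ : 0 < τ.im) (φ : C(Ω.boundary, ℝ)) (i : Fin M) (s : ℝ) {c : ℝ}
    (hc : 0 < c) :
    Tendsto (fun z => fderiv ℝ (Ω.singleLayer φ) z (Ω.normal i s))
      (𝓝[rightSector (Ω.curve i) s c] (Ω.curve i s))
      (𝓝 (Ω.greenNormal φ i s (Ω.curve i s) - 1 / 2 * φ (Ω.pt i s))) := by
  have h := Ω.tendsto_fderiv_of_tendsto hτ φ i s (A := rightSector (Ω.curve i) s c) ?_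
    (Ω.tendsto_sum_logNormal_right φ i s hc)
  · convert h using 2
    field_simp
  · filter_upwards [(Ω.eventually_notMem_periodicBoundary hτ i s hc).filter_mono
      nhdsWithin_le_nhds, self_mem_nhdsWithin] with z hz hzs
    exact hz (fun h => by simpa [h] using hzs.1) (hzs.2.trans (neg_le_abs _))

lemma tangentCoord_add_normal (i : Fin M) (s h : ℝ) :
    tangentCoord (Ω.curve i) s (Ω.curve i s + h * Ω.normal i s) =
      -((h / ‖deriv (Ω.curve i) s‖ : ℝ) * I) := by
  have h1 := Ω.deriv_curve_ne_zero i s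
  have h2 : (‖deriv (Ω.curve i) s‖ : ℂ) ≠ 0 := by exact_mod_cast norm_ne_zero_iff.2 h1
  rw [tangentCoord, normal_eq]
  push_cast
  field_simp
  ring

lemma add_normal_mem_rightSector (i : Fin M) (s : ℝ) {h : ℝ} (hh : 0 < h) :
    Ω.curve i s + h * Ω.normal i s ∈ rightSector (Ω.curve i) s 1 := by
  have h1 : 0 < h / ‖deriv (Ω.curve i) s‖ :=
    div_pos hh (norm_pos_iff.2 (Ω.deriv_curve_ne_zero i s))
  rw [rightSector, mem_ofPred_eq, tangentCoord_add_normal, norm_neg, norm_mul, norm_real, norm_I,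
    Real.norm_of_nonneg h1.le, neg_im, im_ofReal_mul, I_im]
  constructor <;> linarith

lemma sub_normal_mem_leftSector (i : Fin M) (s : ℝ) {h : ℝ} (hh : 0 < h) :
    Ω.curve i s - h * Ω.normal i s ∈ leftSector (Ω.curve i) s 1 := by
  have h1 : 0 < h / ‖deriv (Ω.curve i) s‖ :=
    div_pos hh (norm_pos_iff.2 (Ω.deriv_curve_ne_zero i s))
  have h2 := Ω.tangentCoord_add_normal i s (-h)
  rw [ofReal_neg, neg_mul, ← sub_eq_add_neg, neg_div, ofReal_neg, neg_mul, neg_neg] at h2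
  rw [leftSector, mem_ofPred_eq, h2, norm_mul, norm_real, norm_I,
    Real.norm_of_nonneg h1.le, im_ofReal_mul, I_im]
  constructor <;> linarith

lemma tendsto_add_normal (i : Fin M) (s : ℝ) :
    Tendsto (fun h : ℝ => Ω.curve i s + h * Ω.normal i s) (𝓝[>] 0)
      (𝓝[rightSector (Ω.curve i) s 1] (Ω.curve i s)) := by
  refine tendsto_nhdsWithin_iff.2 ⟨(Continuous.tendsto' (by fun_prop) _ _ (by simp)).mono_left
    nhdsWithin_le_nhds, ?_⟩
  filter_upwards [self_mem_nhdsWithin] with h hh using Ω.add_normal_mem_rightSector i s hh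

lemma tendsto_sub_normal (i : Fin M) (s : ℝ) :
    Tendsto (fun h : ℝ => Ω.curve i s - h * Ω.normal i s) (𝓝[>] 0)
      (𝓝[leftSector (Ω.curve i) s 1] (Ω.curve i s)) := by
  refine tendsto_nhdsWithin_iff.2 ⟨(Continuous.tendsto' (by fun_prop) _ _ (by simp)).mono_left
    nhdsWithin_le_nhds, ?_⟩
  filter_upwards [self_mem_nhdsWithin] with h hh using Ω.sub_normal_mem_leftSector i s hh

lemma eventually_mem_sector_of_mem_approachRegion (A : Set ℂ) (i : Fin M) (s : ℝ) {c : ℝ}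
    (hc : 0 < c) : ∀ᶠ z in 𝓝 (Ω.curve i s), z ∈ Ω.approachRegion A i s c → z ≠ Ω.curve i s →
      z ∈ leftSector (Ω.curve i) s (c / 2) ∨ z ∈ rightSector (Ω.curve i) s (c / 2) := by
  filter_upwards [(Ω.isRegularLoop i).eventually_le_abs_im s hc] with z hz hzA hne
  have h1 := hz fun t => hzA.2.trans <| by
    rw [← dist_eq_norm]
    exact Metric.infDist_le_dist_of_mem (Ω.curve_mem_periodicBoundary i t)
  have h2 : 0 < ‖tangentCoord (Ω.curve i) s z‖ :=
    norm_pos_iff.2 (div_ne_zero (sub_ne_zero.2 hne) (Ω.deriv_curve_ne_zero i s))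
  have h3 : 0 < c / 2 * ‖tangentCoord (Ω.curve i) s z‖ := by positivity
  rcases le_total 0 (tangentCoord (Ω.curve i) s z).im with h | h
  · rw [abs_of_nonneg h] at h1
    exact .inl ⟨h3.trans_le h1, h1⟩
  · rw [abs_of_nonpos h] at h1
    exact .inr ⟨by linarith, h1⟩

lemma nhdsWithin_approachRegion_outerRegion_le (i : Fin M) (s : ℝ) {c : ℝ} (hc : 0 < c) :
    𝓝[Ω.approachRegion Ω.outerRegion i s c] (Ω.curve i s) ≤
      𝓝[leftSector (Ω.curve i) s (c / 2)] (Ω.curve i s) := by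
  refine nhdsWithin_le_iff.2 (eventually_nhdsWithin_iff.2 ?_)
  filter_upwards [Ω.eventually_mem_sector_of_mem_approachRegion Ω.outerRegion i s hc,
    ((Ω.isRegularLoop i).eventually_mem_of_sector (Ω.range_curve i).symm (Ω.normal_inward i s)
      (half_pos hc)).1] with z hz hz2 hzA
  -- Being outside the closed hole rules out the vertex, and rules out the right sector because that
  -- lies in the hole near the vertex.
  have h1 : z ∉ closure (Ω.hole i) := by simpa using hzA.1 i 0 (zero_mem _)
  refine (hz hzA fun h => h1 (h ▸ Ω.curve_mem_closure i s)).resolve_right fun h => ?_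
  exact h1 (subset_closure (hz2 h))

lemma nhdsWithin_approachRegion_innerRegion_le (hτ : 0 < τ.im) (i : Fin M) (s : ℝ) {c : ℝ}
    (hc : 0 < c) :
    𝓝[Ω.approachRegion Ω.innerRegion i s c] (Ω.curve i s) ≤
      𝓝[rightSector (Ω.curve i) s (c / 2)] (Ω.curve i s) := by
  refine nhdsWithin_le_iff.2 (eventually_nhdsWithin_iff.2 ?_)
  filter_upwards [Ω.eventually_mem_sector_of_mem_approachRegion Ω.innerRegion i s hc,
    ((Ω.isRegularLoop i).eventually_mem_of_sector (Ω.range_curve i).symm (Ω.normal_inward i s)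
      (half_pos hc)).2, Ω.eventually_eq_of_sub_mem_closure hτ i s] with z hz hz2 hz3 hzA
  obtain ⟨j, l, hl, hzl⟩ := hzA.1
  obtain ⟨rfl, rfl⟩ := hz3 j l hl (subset_closure hzl)
  rw [sub_zero] at hzl
  refine (hz hzA fun h => ?_).resolve_left fun h => hz2 h (subset_closure hzl)
  have h1 : z ∈ frontier (Ω.hole j) := h ▸ Ω.range_curve j ▸ mem_range_self s
  rw [(Ω.isOpen_hole j).frontier_eq] at h1
  exact h1.2 hzl

/-! ### The principal value -/

lemma isOpen_setOf_lt_norm_sub (i j : Fin M) (s ε : ℝ) :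
    IsOpen {t | ε < ‖Ω.curve i s - Ω.curve j t‖} := by
  have hc := Ω.continuous_curve j
  exact isOpen_lt continuous_const (by fun_prop)

lemma indicator_mul_norm_deriv (φ : C(Ω.boundary, ℝ)) (i j : Fin M) (s ε t : ℝ) :
    ({ξ : Ω.boundary | ε < ‖Ω.curve i s - ξ‖}.indicator (fun ξ =>
        fderiv ℝ (torusGreen τ) (Ω.curve i s - ξ) (Ω.normal i s) * φ ξ)) (Ω.pt j t) *
      ‖deriv (Ω.curve j) t‖ = {t | ε < ‖Ω.curve i s - Ω.curve j t‖}.indicator (fun t =>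
        Ω.density φ j t * fderiv ℝ (torusGreen τ) (Ω.curve i s - Ω.curve j t) (Ω.normal i s)) t := by
  by_cases h : ε < ‖Ω.curve i s - Ω.curve j t‖
  · rw [indicator_of_mem (show Ω.pt j t ∈ _ from h), indicator_of_mem (show t ∈ _ from h)]
    simp only [density, pt]
    ring
  · rw [indicator_of_notMem (show Ω.pt j t ∉ _ from h), indicator_of_notMem (show t ∉ _ from h),
      zero_mul]

lemma arcIntegrable_indicator (hτ : 0 < τ.im) (φ : C(Ω.boundary, ℝ)) (i : Fin M) (s ε : ℝ) :
    Ω.ArcIntegrable ({ξ : Ω.boundary | ε < ‖Ω.curve i s - ξ‖}.indicator fun ξ =>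
      fderiv ℝ (torusGreen τ) (Ω.curve i s - ξ) (Ω.normal i s) * φ ξ) := by
  intro j
  simp only [indicator_mul_norm_deriv]
  have h := Ω.intervalIntegrable_greenNormal hτ φ i j s
  rw [intervalIntegrable_iff] at h ⊢
  exact h.indicator (Ω.isOpen_setOf_lt_norm_sub i j s ε).measurableSet

/-- The kernel is absolutely integrable along the boundary, so it dominates its own truncations,
which converge almost everywhere. -/
lemma tendsto_adjointDoubleLayerTrunc (hτ : 0 < τ.im) (φ : C(Ω.boundary, ℝ)) (i : Fin M) (s : ℝ) :
    Tendsto (Ω.adjointDoubleLayerTrunc φ i s) (𝓝[>] 0)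
      (𝓝 (Ω.greenNormal φ i s (Ω.curve i s))) := by
  refine tendsto_finsetSum _ fun j _ => ?_
  have h := Ω.intervalIntegrable_greenNormal hτ φ i j s
  simp only [indicator_mul_norm_deriv]
  refine intervalIntegral.tendsto_integral_filter_of_dominated_convergence _
    (.of_forall fun ε => ?_)
    (.of_forall fun ε => .of_forall fun t _ => norm_indicator_le_norm_self _ t) h.norm ?_
  · exact (h.def'.aestronglyMeasurable).indicator
      (Ω.isOpen_setOf_lt_norm_sub i j s ε).measurableSet
  · filter_upwards [Ω.ae_notMem_torusLattice (Ω.curve i s) j] with t ht _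
    have h0 : 0 < ‖Ω.curve i s - Ω.curve j t‖ :=
      norm_pos_iff.2 fun h => ht (h ▸ zero_mem _)
    refine tendsto_const_nhds.congr' ?_
    filter_upwards [mem_nhdsWithin_of_mem_nhds (Iio_mem_nhds h0)] with ε hε
    rw [indicator_of_mem (show t ∈ _ from hε)]

lemma adjointDoubleLayer_eq (hτ : 0 < τ.im) (φ : C(Ω.boundary, ℝ)) (i : Fin M) (s : ℝ) :
    Ω.adjointDoubleLayer φ i s = Ω.greenNormal φ i s (Ω.curve i s) :=
  (Ω.tendsto_adjointDoubleLayerTrunc hτ φ i s).limUnder_eq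

end HoledTorus

/-! ### The main theorem -/

theorem mainTheorem6 (τ : ℂ) (hτ : 0 < τ.im) (M : ℕ) (Ω : HoledTorus τ M) :
    -- the potential is well defined, doubly periodic, continuous on the torus, smooth and harmonic
    (∀ φ ∈ Ω.C0,
      (∀ z : ℂ, Ω.ArcIntegrable fun ξ => torusGreen τ (z - ξ) * φ ξ) ∧
      (∀ z : ℂ, Ω.singleLayer φ (z + 1) = Ω.singleLayer φ z ∧
        Ω.singleLayer φ (z + τ) = Ω.singleLayer φ z) ∧
      (∃ u : C(ℂ ⧸ torusLattice τ, ℝ), ∀ z : ℂ, u (z : ℂ ⧸ torusLattice τ) = Ω.singleLayer φ z) ∧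
      ContDiffOn ℝ ∞ (Ω.singleLayer φ) Ω.periodicBoundaryᶜ ∧
      InnerProductSpace.HarmonicOnNhd (Ω.singleLayer φ) Ω.periodicBoundaryᶜ) ∧
    -- the jump relations
    (∀ φ ∈ Ω.C0, ∀ (i : Fin M) (s : ℝ),
      -- the principal value exists
      (∀ ε > 0, Ω.ArcIntegrable ({ξ : Ω.boundary | ε < ‖Ω.curve i s - ξ‖}.indicator fun ξ =>
        fderiv ℝ (torusGreen τ) (Ω.curve i s - ξ) (Ω.normal i s) * φ ξ)) ∧
      Tendsto (Ω.adjointDoubleLayerTrunc φ i s) (𝓝[>] 0) (𝓝 (Ω.adjointDoubleLayer φ i s)) ∧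
      -- limits along the normal, from `Ω` and from `D`
      Tendsto (fun h : ℝ =>
          fderiv ℝ (Ω.singleLayer φ) (Ω.curve i s - h * Ω.normal i s) (Ω.normal i s))
        (𝓝[>] 0) (𝓝 (Ω.adjointDoubleLayer φ i s + 1 / 2 * φ (Ω.pt i s))) ∧
      Tendsto (fun h : ℝ =>
          fderiv ℝ (Ω.singleLayer φ) (Ω.curve i s + h * Ω.normal i s) (Ω.normal i s))
        (𝓝[>] 0) (𝓝 (Ω.adjointDoubleLayer φ i s - 1 / 2 * φ (Ω.pt i s))) ∧
      -- nontangential limits, from `Ω` and from `D`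
      (∀ c > 0,
        Tendsto (fun z => fderiv ℝ (Ω.singleLayer φ) z (Ω.normal i s))
          (𝓝[Ω.approachRegion Ω.outerRegion i s c] (Ω.curve i s))
          (𝓝 (Ω.adjointDoubleLayer φ i s + 1 / 2 * φ (Ω.pt i s))) ∧
        Tendsto (fun z => fderiv ℝ (Ω.singleLayer φ) z (Ω.normal i s))
          (𝓝[Ω.approachRegion Ω.innerRegion i s c] (Ω.curve i s))
          (𝓝 (Ω.adjointDoubleLayer φ i s - 1 / 2 * φ (Ω.pt i s))))) ∧
    -- the boundary operator is a compact linear operator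
    (∃ T : Ω.C0 →L[ℝ] C(Ω.boundary, ℝ),
      (∀ (φ : Ω.C0) (ξ : Ω.boundary), T φ ξ = Ω.singleLayer φ ξ) ∧ IsCompactOperator T) := by
  refine ⟨fun φ hφ => ⟨Ω.arcIntegrable_torusGreen_mul hτ φ, fun z =>
    ⟨Ω.singleLayer_add_of_mem hτ (one_mem_torusLattice τ) φ z,
      Ω.singleLayer_add_of_mem hτ (tau_mem_torusLattice τ) φ z⟩,
    Ω.exists_continuousMap_quotient hτ φ, Ω.contDiffOn_singleLayer hτ hφ,
    Ω.harmonicOnNhd_singleLayer hτ hφ⟩, fun φ _ i s => ?_, Ω.exists_compact_operator hτ⟩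
  rw [Ω.adjointDoubleLayer_eq hτ]
  exact ⟨fun ε _ => Ω.arcIntegrable_indicator hτ φ i s ε,
    Ω.tendsto_adjointDoubleLayerTrunc hτ φ i s,
    (Ω.tendsto_fderiv_left hτ φ i s one_pos).comp (Ω.tendsto_sub_normal i s),
    (Ω.tendsto_fderiv_right hτ φ i s one_pos).comp (Ω.tendsto_add_normal i s),
    fun c hc => ⟨(Ω.tendsto_fderiv_left hτ φ i s (half_pos hc)).mono_left
      (Ω.nhdsWithin_approachRegion_outerRegion_le i s hc),
    (Ω.tendsto_fderiv_right hτ φ i s (half_pos hc)).mono_left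
      (Ω.nhdsWithin_approachRegion_innerRegion_le hτ i s hc)⟩⟩
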